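/- **Model.** There are $K$ arms and $M$ players, $1\le M\le K$, and a horizon $T\ge 2$. Arm $k$ has a law $\nu_k$ on $[0,1]$ with mean $\mu_k$; at the stages $t=1,\dots,T$ the values $X_k(t)$ are drawn from $\nu_k$, independently over $t$. Player $j$ enters at a deterministic time $\tau_j\in\{0,\dots,T-1\}$ and stays until $T$; $\mathbf M(t)=\{j:\tau_j<t\}$ is the set of players in the game at stage $t$, so $\#\mathbf M(T)=M$. If the players in $\mathbf M(t)$ pull the arms $\pi^j(t)$, player $j$ receives, and observes nothing but, $r^j(t)=X_{\pi^j(t)}(t)$ if no other player in $\mathbf M(t)$ pulls $\pi^j(t)$, and $r^j(t)=0$ otherwise. Player $j$ knows $K$ and $T^j=T-\tau_j$, but not $\tau_j$, $M$ or $\mathbf M(t)$. Let $\mu_{(1)}\ge\dots\ge\mu_{(K)}$ be the order statistics of $\mu$, $\mu_{(K+1)}:=0$, and $\bar\Delta_{(M)}=\min_{i=1,\dots,M}(\mu_{(i)}-\mu_{(i+1)})$. The regret is $$R_T=\sum_{t=1}^T\sum_{k=1}^{\#\mathbf M(t)}\mu_{(k)}-\mathbb E\Big[\sum_{t=1}^T\sum_{j\in\mathbf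 M(t)}r^j(t)\Big].$$ **Algorithm DYN-MMAB** (run by each player $j$). Keep an ordered list Preferences and a set Occupied, both initially empty; an arm is active if it is in neither. Set $p=1$, $L[k]=+\infty$, $r_{\inf}[k]=0$, $r_{\sup}[k]=1$, and let all counters be $0$. Let $B(t)=2\sqrt{6K\log(T^j)/t}$. At the $t$-th stage after entering, as long as the player explores, she pulls an arm $k$ uniformly at random in $[K]$ (independently of everything else), observes a reward $r$, and then, in this order: 1. she updates the number of pulls $N[k]$ and the sum of rewards $S[k]$ of arm $k$, and the same quantities $N'[k],S'[k]$ for the current block of arm $k$; for every arm $i$ with $N[i]>0$ she sets $r_{\inf}[i]=(S[i]/N[i]-B(t))^+$ and $r_{\sup}[i]=\min(S[i]/N[i]+B(t),1)$; 2. she sets $L[k]\leftarrow\min\big(2e\log(T^j)/r_{\inf}[k],\,L[k]\big)$, where a quotient by $0$ is $+\infty$; 3. if $k=\text{Preferences}[p]$ and $r>0$, she exploits $k$, i.e. pulls $k$ at all later stages until the horizon; 4. if $\text{Preferences}[p]\in\text{Occupied}$, then $p\leftarrow p+1$; 5. if $N'[k]\ge L[k]$, she adds $k$ to Occupied in case $S'[k]=0$,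 and resets $N'[k],S'[k]$ to $0$; 6. if some active arm $i$ satisfies $r_{\inf}[i]>r_{\sup}[l]$ for all other active arms $l$, she appends $i$ to Preferences; 7. if $r_{\inf}[l]>r_{\sup}[\text{Preferences}[p]]$ for some arm $l$ that is active or stands in Preferences after position $p$, she adds $\text{Preferences}[p]$ to Occupied. **Theorem 2.** There is a universal constant $C>0$ such that, for all $K,M,T,(\tau_j),(\nu_k)$ as above with $\bar\Delta_{(M)}>0$, the regret of DYN-MMAB satisfies $$R_T\le C\left(\frac{M^2K\log T}{\mu_{(M)}}+\frac{MK\log T}{\bar\Delta_{(M)}^2}\right).$$ -/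

import Mathlib

open MeasureTheory ProbabilityTheory
open scoped ENNReal

namespace DynMMAB

noncomputable section

/-! ### Order statistics and gaps -/

/-- The `n`-th order statistic `μ_(n)` (`n = 1` is the largest value) of `μ : Fin K → ℝ`, with the
convention `μ_(n) = 0` for `n > K`. -/
def orderStat {K : ℕ} (μ : Fin K → ℝ) (n : ℕ) : ℝ :=
  if h : 1 ≤ n ∧ n ≤ K then μ (Tuple.sort (fun i => -μ i) ⟨n - 1, by omega⟩) else 0

/-- The smallest gap `min_{i = 1, …, M} (μ_(i) - μ_(i+1))`; the index `i : Fin M` stands for the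
rank `i + 1`. -/
def minGap {K : ℕ} (μ : Fin K → ℝ) (M : ℕ) : ℝ :=
  ⨅ i : Fin M, (orderStat μ (i + 1) - orderStat μ (i + 2))

/-! ### The algorithm DYN-MMAB, run by a single player -/

/-- The memory of a player. -/
structure PlayerState (K : ℕ) where
  /-- number of stages the player has spent exploring -/
  time : ℕ
  /-- position in `prefs`, counted from `0`, of the arm that the player tries to occupy -/
  pos : ℕ
  /-- the arm exploited by the player; `none` during exploration -/
  fixed : Option (Fin K)
  /-- the ordered list `Preferences` -/
  prefs : List (Fin K)
  /-- the set `Occupied` -/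
  occ : Finset (Fin K)
  /-- number of pulls of every arm -/
  pulls : Fin K → ℕ
  /-- number of pulls of every arm in its current block -/
  pullsTemp : Fin K → ℕ
  /-- sum of the rewards observed on every arm -/
  sum : Fin K → ℝ
  /-- sum of the rewards observed on every arm in its current block -/
  sumTemp : Fin K → ℝ
  /-- length of a block of zero rewards after which an arm is declared occupied -/
  len : Fin K → ℝ≥0∞
  /-- lower confidence bounds -/
  rinf : Fin K → ℝ
  /-- upper confidence bounds -/
  rsup : Fin K → ℝ

/-- The state of a player who has not yet played. -/
def initState (K : ℕ) : PlayerState K where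
  time := 0
  pos := 0
  fixed := none
  prefs := []
  occ := ∅
  pulls := fun _ => 0
  pullsTemp := fun _ => 0
  sum := fun _ => 0
  sumTemp := fun _ => 0
  len := fun _ => ⊤
  rinf := fun _ => 0
  rsup := fun _ => 1

/-- The confidence radius `B^j(t) = 2 √(6 K log(T^j) / t)`, for personal horizon `n = T^j`. -/
def radius (K n t : ℕ) : ℝ := 2 * Real.sqrt (6 * K * Real.log n / t)

/-- `2 e log(T^j) / r`, equal to `+∞` for `r = 0`, for personal horizon `n = T^j`. -/
def blockLength (n : ℕ) (r : ℝ) : ℝ≥0∞ :=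
  if r = 0 then ⊤ else ENNReal.ofReal (2 * Real.exp 1 * Real.log n / r)

/-- An arm is active if it is neither in `Preferences` nor in `Occupied`. -/
def IsActive {K : ℕ} (prefs : List (Fin K)) (occ : Finset (Fin K)) (i : Fin K) : Prop :=
  i ∉ prefs ∧ i ∉ occ

open Classical in
/-- One iteration of the exploration loop of a player with personal horizon `n`, after the player
has pulled the (uniformly sampled) arm `k` and observed the reward `r`. Intermediate values are
named in the order in which the lines of the algorithm are executed. -/
def explore {K : ℕ} (n : ℕ) (st : PlayerState K) (k : Fin K) (r : ℝ) : PlayerState K :=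
  let t := st.time + 1
  let pullsTemp := Function.update st.pullsTemp k (st.pullsTemp k + 1)
  let pulls := Function.update st.pulls k (st.pulls k + 1)
  let sumTemp := Function.update st.sumTemp k (st.sumTemp k + r)
  let sum := Function.update st.sum k (st.sum k + r)
  -- confidence bounds; an arm that was never pulled keeps its initial bounds `0` and `1`
  let rinf : Fin K → ℝ := fun i =>
    if pulls i = 0 then st.rinf i else max (sum i / pulls i - radius K n t) 0
  let rsup : Fin K → ℝ := fun i =>
    if pulls i = 0 then st.rsup i else min (sum i / pulls i + radius K n t) 1
  let len := Function.update st.len k (min (blockLength n (rinf k)) (st.len k))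
  -- a positive reward on the arm to occupy: start exploiting it
  let fixed := if st.prefs[st.pos]? = some k ∧ 0 < r then some k else st.fixed
  -- the arm to occupy is known to be exploited by another player: move to the next one
  let pos := if ∃ i ∈ st.prefs[st.pos]?, i ∈ st.occ then st.pos + 1 else st.pos
  -- end of a block of pulls of `k`
  let blockEnd : Prop := len k ≤ (pullsTemp k : ℝ≥0∞)
  let occ₁ := if blockEnd ∧ sumTemp k = 0 then insert k st.occ else st.occ
  let sumTemp' := if blockEnd then Function.update sumTemp k 0 else sumTemp
  let pullsTemp' := if blockEnd then Function.update pullsTemp k 0 else pullsTemp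
  -- append to `Preferences` an active arm that dominates all the other active arms
  let prefs := st.prefs ++ ((List.finRange K).find? (fun i => decide
    (IsActive st.prefs occ₁ i ∧
      ∀ l, l ≠ i → IsActive st.prefs occ₁ l → rsup l < rinf i))).toList
  -- the arm to occupy is dominated by an active arm or by a later element of `Preferences`
  let occ₂ := occ₁ ∪ Finset.univ.filter (fun a => prefs[pos]? = some a ∧
    ∃ l, (IsActive prefs occ₁ l ∨ l ∈ prefs.drop (pos + 1)) ∧ rsup a < rinf l)
  { time := t
    pos := pos
    fixed := fixed
    prefs := prefs
    occ := occ₂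
    pulls := pulls
    pullsTemp := pullsTemp'
    sum := sum
    sumTemp := sumTemp'
    len := len
    rinf := rinf
    rsup := rsup }

/-! ### The dynamic game without sensing

Stages are numbered `0, …, T - 1`. Player `j` enters at the time `τ j`, takes part in all the stages
`s ≥ τ j`, and knows her personal horizon `T - τ j`. -/

/-- The set of players in the game at stage `s`. -/
def players {M : ℕ} (τ : Fin M → ℕ) (s : ℕ) : Finset (Fin M) :=
  Finset.univ.filter (fun j => τ j ≤ s)

/-- The collision indicator of arm `k` when the players in `A` pull the arms given by `π`. -/
def collision {K M : ℕ} (A : Finset (Fin M)) (π : Fin M → Fin K) (k : Fin K) : ℝ :=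
  if 1 < (A.filter (fun j => π j = k)).card then 1 else 0

/-- The reward of player `j` when the players in `A` pull the arms given by `π` and the arms
produce the values `x`. -/
def reward {K M : ℕ} (A : Finset (Fin M)) (π : Fin M → Fin K) (x : Fin K → ℝ) (j : Fin M) : ℝ :=
  x (π j) * (1 - collision A π (π j))

/-- The arms pulled by the players: the exploited arm, or the uniform sample `u j` of player `j` as
long as she explores. -/
def pulledArm {K M : ℕ} (st : Fin M → PlayerState K) (u : Fin M → Fin K) (j : Fin M) : Fin K :=
  (st j).fixed.getD (u j)

open Classical in
/-- The states of all the players before stage `s`, when all of them run DYN-MMAB, arm `k` produces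
the value `x s k` and player `j` has the sample `u s j` at stage `s`. A player updates her state
with her own arm and her own reward only. -/
def states {K M : ℕ} (T : ℕ) (τ : Fin M → ℕ) (x : ℕ → Fin K → ℝ) (u : ℕ → Fin M → Fin K) :
    ℕ → Fin M → PlayerState K
  | 0 => fun _ => initState K
  | s + 1 => fun j =>
    let st := states T τ x u s
    let π := pulledArm st (u s)
    if j ∈ players τ s ∧ (st j).fixed = none then
      explore (T - τ j) (st j) (π j) (reward (players τ s) π (x s) j)
    else st j

/-- The reward `r^j` of player `j` at stage `s`. -/
def stageReward {K M : ℕ} (T : ℕ) (τ : Fin M → ℕ) (x : ℕ → Fin K → ℝ) (u : ℕ → Fin M → Fin K)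
    (s : ℕ) (j : Fin M) : ℝ :=
  reward (players τ s) (pulledArm (states T τ x u s) (u s)) (x s) j

/-- The cumulated reward of all the players up to the horizon `T`. -/
def totalReward {K M : ℕ} (T : ℕ) (τ : Fin M → ℕ) (x : ℕ → Fin K → ℝ) (u : ℕ → Fin M → Fin K) :
    ℝ :=
  ∑ s ∈ Finset.range T, ∑ j ∈ players τ s, stageReward T τ x u s j

/-- The randomness of the game: `X s` is the vector of values of the arms at stage `s` and `U s` the
vector of the private uniform samples of the players. The stages are independent, arm `k` has law
`ν k` at every stage, and at each stage the samples of the players are uniform, independent of each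
other and of the values of the arms. -/
structure IsModel {K M : ℕ} {Ω : Type*} [MeasurableSpace Ω] (P : Measure Ω)
    (ν : Fin K → Measure ℝ) (X : ℕ → Ω → Fin K → ℝ) (U : ℕ → Ω → Fin M → Fin K) : Prop where
  measurable_value : ∀ s, Measurable (X s)
  measurable_sample : ∀ s, Measurable (U s)
  law_value : ∀ s k, P.map (fun ω => X s ω k) = ν k
  law_sample : ∀ s j k, P {ω | U s ω j = k} = (K : ℝ≥0∞)⁻¹
  indep_stages : iIndepFun (fun s ω => (X s ω, U s ω)) P
  indep_value_sample : ∀ s, IndepFun (X s) (U s) P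
  indep_samples : ∀ s, iIndepFun (fun j ω => U s ω j) P

/-- The mean `μ_k` of arm `k`. -/
def armMean {K : ℕ} (ν : Fin K → Measure ℝ) (k : Fin K) : ℝ := ∫ y, y ∂(ν k)

/-- The (expected) regret of DYN-MMAB up to the horizon `T`. -/
def regret {K M : ℕ} {Ω : Type*} [MeasurableSpace Ω] (P : Measure Ω) (ν : Fin K → Measure ℝ)
    (X : ℕ → Ω → Fin K → ℝ) (U : ℕ → Ω → Fin M → Fin K) (T : ℕ) (τ : Fin M → ℕ) : ℝ :=
  (∑ s ∈ Finset.range T, ∑ n ∈ Finset.Icc 1 (players τ s).card, orderStat (armMean ν) n)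
    - ∫ ω, totalReward T τ (fun s => X s ω) (fun s => U s ω) ∂P

end

end DynMMAB

/-! A player who samples uniformly sees on arm `k`, on average, the mean `μ k` times the probability
that the other players leave `k` alone. This probability is `0` once another player exploits `k`;
otherwise it is `availability`, which is the same for all free arms and at least `exp (-1)`, because
there are at most `K - 1` exploring rivals. Empirical means are thus deflated, but they still rank
the free arms correctly. `Run.mass` is the cumulated deflation factor.

On the event `IsFavorable` the analysis of a player is deterministic and has two halves. Soundness
(`isSound`): an arm enters Occupied only if another player exploits it. A long block of zeros does
not happen on a free arm, and a free arm cannot be overtaken by an arm that it once beat. Hence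
every arm better than the one that the player tries to occupy is already exploited
(`mem_taken_of_better`), and the exploited arms are always distinct and closed under passing to
better arms (`isWellPlaced`). Apart from the explorers, the allocation is optimal. Progress
(`exists_fixing_of_stable`): once the radius is below a constant times the gap, a period of four
windows of `8 K m` steps during which the set of arms exploited by others does not change ends with
the player exploiting the best free arm. Here `m` has order `log T / μ_(M)`. That set only grows and
has fewer than `M` elements, so there are fewer than `M` changes, and `lt_of_explores` bounds the
exploration by a multiple of `K log T / Δ² + M K log T / μ_(M)`.

The deviations are controlled by products of factors whose expectation given the past is at most
`1`, together with a maximal inequality (`measure_exists_le_prod`). Player `j` is unfavorable with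
probability at most `12 K / (T - τ j)` (`measure_not_isFavorable_le`), which offsets the length of
her stay in the game.

Finally, up to a term centred given the past, a stage costs at most `2` per explorer if the players
are well placed and at most `2 M` otherwise (`stage_loss_le`). Summing over the stages and over the
`M` players gives the bound. -/

namespace DynMMAB

noncomputable section

/-! ### One exploration step -/

section Explore

variable {K : ℕ} (n : ℕ) (st : PlayerState K) (k : Fin K) (r : ℝ)

/-- The current block of the pulled arm `k` ends with this step. -/
def BlockEnds : Prop := (explore n st k r).len k ≤ ((st.pullsTemp k + 1 : ℕ) : ℝ≥0∞)

open Classical in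
/-- The set `Occupied` after the detection of zero blocks, before the detection of dominated arms. -/
def occMid : Finset (Fin K) :=
  if BlockEnds n st k r ∧ st.sumTemp k + r = 0 then insert k st.occ else st.occ

/-- The arm `i` is active and dominates all the other active arms. -/
def Dominates (i : Fin K) : Prop :=
  IsActive st.prefs (occMid n st k r) i ∧
    ∀ l, l ≠ i → IsActive st.prefs (occMid n st k r) l →
      (explore n st k r).rsup l < (explore n st k r).rinf i

/-- The arm `a` stands at the current position and is dominated by an active arm or by a later
element of `Preferences`. -/
def IsDominated (a : Fin K) : Prop :=
  (explore n st k r).prefs[(explore n st k r).pos]? = some a ∧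
    ∃ l, (IsActive (explore n st k r).prefs (occMid n st k r) l ∨
      l ∈ (explore n st k r).prefs.drop ((explore n st k r).pos + 1)) ∧
      (explore n st k r).rsup a < (explore n st k r).rinf l

lemma explore_time : (explore n st k r).time = st.time + 1 := rfl

lemma explore_pulls : (explore n st k r).pulls = Function.update st.pulls k (st.pulls k + 1) := rfl

lemma explore_sum : (explore n st k r).sum = Function.update st.sum k (st.sum k + r) := rfl

lemma explore_rinf (i : Fin K) : (explore n st k r).rinf i =
    if (explore n st k r).pulls i = 0 then st.rinf i else
      max ((explore n st k r).sum i / (explore n st k r).pulls i - radius K n (st.time + 1)) 0 := rfl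

lemma explore_rsup (i : Fin K) : (explore n st k r).rsup i =
    if (explore n st k r).pulls i = 0 then st.rsup i else
      min ((explore n st k r).sum i / (explore n st k r).pulls i + radius K n (st.time + 1)) 1 := rfl

lemma explore_len : (explore n st k r).len =
    Function.update st.len k (min (blockLength n ((explore n st k r).rinf k)) (st.len k)) := rfl

lemma explore_fixed : (explore n st k r).fixed =
    if st.prefs[st.pos]? = some k ∧ 0 < r then some k else st.fixed := by
  unfold explore; dsimp only

lemma explore_pos_of_mem {a : Fin K} (h : st.prefs[st.pos]? = some a) (ha : a ∈ st.occ) :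
    (explore n st k r).pos = st.pos + 1 := by
  have : ∃ i ∈ st.prefs[st.pos]?, i ∈ st.occ := ⟨a, h, ha⟩
  simp only [explore]
  rw [if_pos this]

lemma explore_pos_of_not_mem (h : ∀ a, st.prefs[st.pos]? = some a → a ∉ st.occ) :
    (explore n st k r).pos = st.pos := by
  have : ¬ ∃ i ∈ st.prefs[st.pos]?, i ∈ st.occ := by
    rintro ⟨i, hi, hi'⟩; exact h i hi hi'
  simp only [explore]
  rw [if_neg this]

lemma explore_pullsTemp_of_ends (h : BlockEnds n st k r) :
    (explore n st k r).pullsTemp = Function.update st.pullsTemp k 0 := by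
  have h' := h
  unfold BlockEnds at h'
  simp only [explore, Function.update_self] at h' ⊢
  rw [if_pos h', Function.update_idem]

lemma explore_sumTemp_of_ends (h : BlockEnds n st k r) :
    (explore n st k r).sumTemp = Function.update st.sumTemp k 0 := by
  have h' := h
  unfold BlockEnds at h'
  simp only [explore, Function.update_self] at h' ⊢
  rw [if_pos h', Function.update_idem]

lemma explore_pullsTemp_of_not_ends (h : ¬ BlockEnds n st k r) :
    (explore n st k r).pullsTemp = Function.update st.pullsTemp k (st.pullsTemp k + 1) := by
  have h' := h
  unfold BlockEnds at h'
  simp only [explore, Function.update_self] at h' ⊢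
  rw [if_neg h']

lemma explore_sumTemp_of_not_ends (h : ¬ BlockEnds n st k r) :
    (explore n st k r).sumTemp = Function.update st.sumTemp k (st.sumTemp k + r) := by
  have h' := h
  unfold BlockEnds at h'
  simp only [explore, Function.update_self] at h' ⊢
  rw [if_neg h']

open Classical in
lemma explore_prefs : (explore n st k r).prefs =
    st.prefs ++ ((List.finRange K).find? (fun i => decide (Dominates n st k r i))).toList := by
  simp only [Dominates, occMid, BlockEnds, explore, Function.update_self]

open Classical in
lemma explore_occ : (explore n st k r).occ =
    occMid n st k r ∪ Finset.univ.filter (fun a => IsDominated n st k r a) := by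
  simp only [IsDominated, occMid, BlockEnds, explore, Function.update_self]

lemma explore_prefs_cases : ((explore n st k r).prefs = st.prefs ∧ ∀ i, ¬ Dominates n st k r i) ∨
    ∃ i, Dominates n st k r i ∧ (explore n st k r).prefs = st.prefs ++ [i] := by
  classical
  rw [explore_prefs]
  rcases h : (List.finRange K).find? (fun i => decide (Dominates n st k r i)) with _ | i
  · left
    refine ⟨by simp, fun i => ?_⟩
    have := List.find?_eq_none.1 h i (List.mem_finRange i)
    simpa using this
  · right
    have := List.find?_some h
    exact ⟨i, by simpa using this, by simp⟩

lemma mem_explore_occ {a : Fin K} :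
    a ∈ (explore n st k r).occ ↔ a ∈ occMid n st k r ∨ IsDominated n st k r a := by
  classical
  rw [explore_occ]; simp

lemma occ_subset_occMid : st.occ ⊆ occMid n st k r := by
  unfold occMid; split_ifs
  · exact Finset.subset_insert _ _
  · exact subset_rfl

lemma occMid_subset_explore_occ : occMid n st k r ⊆ (explore n st k r).occ := by
  intro a ha
  rw [mem_explore_occ]; exact Or.inl ha

lemma mem_occMid {a : Fin K} : a ∈ occMid n st k r ↔
    a ∈ st.occ ∨ (a = k ∧ BlockEnds n st k r ∧ st.sumTemp k + r = 0) := by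
  unfold occMid
  split_ifs with h
  · rw [Finset.mem_insert]; tauto
  · tauto

end Explore

/-! ### Exploration runs -/

/-- The data seen by a player during exploration: the sampled arms, the rewards, the probability
`avail t` that no other exploring player pulls a given arm at the local time `t`, and the set of
arms exploited by other players. -/
structure Run (K : ℕ) where
  /-- the arm sampled at every stage -/
  arm : ℕ → Fin K
  /-- the reward observed at every stage -/
  rew : ℕ → ℝ
  /-- probability that a free arm is pulled by no other explorer -/
  avail : ℕ → ℝ
  /-- arms exploited by the other players -/
  taken : ℕ → Finset (Fin K)

namespace Run

variable {K : ℕ} (R : Run K) (n : ℕ)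

/-- The state of the player after `t` steps of exploration. -/
def state : ℕ → PlayerState K
  | 0 => initState K
  | t + 1 => explore n (state t) (R.arm t) (R.rew t)

/-- Number of pulls of `k` at the times in `[s, t)`. -/
def count (k : Fin K) (s t : ℕ) : ℕ := ((Finset.Ico s t).filter (fun i => R.arm i = k)).card

/-- Sum of the rewards of arm `k` at the times in `[s, t)`. -/
def gain (k : Fin K) (s t : ℕ) : ℝ := ∑ i ∈ Finset.Ico s t, if R.arm i = k then R.rew i else 0

/-- Cumulated availability of arm `k` before time `t`. -/
def mass (k : Fin K) (t : ℕ) : ℝ := ∑ i ∈ Finset.range t, if k ∈ R.taken i then 0 else R.avail i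

lemma state_succ (t : ℕ) : R.state n (t + 1) = explore n (R.state n t) (R.arm t) (R.rew t) := rfl

lemma count_self (k : Fin K) (s : ℕ) : R.count k s s = 0 := by simp [count]

lemma count_succ (k : Fin K) {s t : ℕ} (h : s ≤ t) :
    R.count k s (t + 1) = R.count k s t + if R.arm t = k then 1 else 0 := by
  unfold count
  rw [← Finset.insert_Ico_right_eq_Ico_add_one h, Finset.filter_insert]
  split_ifs
  · rw [Finset.card_insert_of_notMem (by simp)]
  · simp

lemma gain_self (k : Fin K) (s : ℕ) : R.gain k s s = 0 := by simp [gain]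

lemma gain_succ (k : Fin K) {s t : ℕ} (h : s ≤ t) :
    R.gain k s (t + 1) = R.gain k s t + if R.arm t = k then R.rew t else 0 := by
  unfold gain
  rw [Finset.sum_Ico_succ_top h]

lemma mass_succ (k : Fin K) (t : ℕ) :
    R.mass k (t + 1) = R.mass k t + if k ∈ R.taken t then 0 else R.avail t := by
  unfold mass
  rw [Finset.sum_range_succ]

lemma count_add (k : Fin K) {s t u : ℕ} (h : s ≤ t) (h' : t ≤ u) :
    R.count k s u = R.count k s t + R.count k t u := by
  induction u, h' using Nat.le_induction with
  | base => simp [count_self]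
  | succ u hu ih => rw [count_succ _ _ (h.trans hu), count_succ _ _ hu, ih]; ring

lemma exists_arm_of_count_pos {k : Fin K} {s t : ℕ} (h : 0 < R.count k s t) :
    ∃ i, s ≤ i ∧ i < t ∧ R.arm i = k := by
  obtain ⟨i, hi⟩ := Finset.card_pos.1 h
  simp only [Finset.mem_filter, Finset.mem_Ico] at hi
  exact ⟨i, hi.1.1, hi.1.2, hi.2⟩

@[simp] lemma state_time (t : ℕ) : (R.state n t).time = t := by
  induction t with
  | zero => rfl
  | succ t ih => rw [state_succ, explore_time, ih]

lemma state_pulls (t : ℕ) (k : Fin K) : (R.state n t).pulls k = R.count k 0 t := by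
  induction t with
  | zero => simp [count_self]; rfl
  | succ t ih =>
    rw [state_succ, explore_pulls, count_succ _ _ (Nat.zero_le _), Function.update_apply]
    split_ifs with h h' h'
    · rw [← h, ih]
    · exact absurd h.symm h'
    · exact absurd h'.symm h
    · simpa using ih

lemma state_sum (t : ℕ) (k : Fin K) : (R.state n t).sum k = R.gain k 0 t := by
  induction t with
  | zero => simp [gain_self]; rfl
  | succ t ih =>
    rw [state_succ, explore_sum, gain_succ _ _ (Nat.zero_le _), Function.update_apply]
    split_ifs with h h' h'
    · rw [← h, ih]
    · exact absurd h.symm h'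
    · exact absurd h'.symm h
    · simpa using ih

/-- The bounds of all the arms pulled so far are recomputed at every step from the totals, so they
depend on the past only through `count` and `gain`. An arm never pulled keeps its initial value. -/
lemma state_rinf (t : ℕ) (k : Fin K) : (R.state n t).rinf k =
    if R.count k 0 t = 0 then 0 else
      max (R.gain k 0 t / R.count k 0 t - radius K n t) 0 := by
  induction t with
  | zero => simp [count_self]; rfl
  | succ t ih =>
    rw [state_succ, explore_rinf, ← state_succ, state_pulls, state_sum, state_time]
    split_ifs with h
    · rw [ih, if_pos]
      rw [count_succ _ _ (Nat.zero_le _)] at h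
      omega
    · rfl

lemma state_rsup (t : ℕ) (k : Fin K) : (R.state n t).rsup k =
    if R.count k 0 t = 0 then 1 else
      min (R.gain k 0 t / R.count k 0 t + radius K n t) 1 := by
  induction t with
  | zero => simp [count_self]; rfl
  | succ t ih =>
    rw [state_succ, explore_rsup, ← state_succ, state_pulls, state_sum, state_time]
    split_ifs with h
    · rw [ih, if_pos]
      rw [count_succ _ _ (Nat.zero_le _)] at h
      omega
    · rfl

lemma prefs_prefix (t : ℕ) : (R.state n t).prefs <+: (R.state n (t + 1)).prefs := by
  classical
  rw [state_succ, explore_prefs]; exact List.prefix_append _ _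

lemma occ_mono : Monotone fun t => (R.state n t).occ :=
  monotone_nat_of_le_succ fun t => by
    rw [state_succ]
    exact (occ_subset_occMid _ _ _ _).trans (occMid_subset_explore_occ _ _ _ _)

lemma len_antitone (k : Fin K) : Antitone fun t => (R.state n t).len k :=
  antitone_nat_of_succ_le fun t => by
    rw [state_succ, explore_len, Function.update_apply]
    split_ifs with h
    · subst h; exact min_le_right _ _
    · exact le_rfl

end Run

end

end DynMMAB

/-! ### Confidence bounds for the deflated means under controlled deviations. -/

namespace DynMMAB

noncomputable section

/-- A linear combination of deviations of the gain and of the number of pulls. -/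
lemma abs_sub_le_of_dev {a b N S μ g : ℝ} (ha : 0 ≤ a) (hb : 0 ≤ b) (hb' : b ≤ 1 / 2)
    (hμ : 0 ≤ μ) (hμ' : μ ≤ 1) (hg : 0 ≤ g) (hg' : g ≤ 1)
    (hS : |S - μ * N / 2 - μ * a * (g - 1 / 2)| ≤ 2 / 3 * a * b)
    (hN : a * (1 - 5 / 6 * b) ≤ N) (hN' : N ≤ a * (1 + 4 / 3 * b)) :
    |S - μ * g * N| ≤ 2 * b * N := by
  -- Centring the rewards at `μ / 2` instead of `0` pays off here: the error of the count enters
  -- with weight at most `1 / 2`, which is what makes the radius of the algorithm large enough.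
  have h1 : |μ * (g - 1 / 2) * (a - N)| ≤ 1 / 2 * |a - N| := by
    rw [abs_mul]
    refine mul_le_mul_of_nonneg_right ?_ (abs_nonneg _)
    rw [abs_mul, abs_of_nonneg hμ]
    have : |g - 1 / 2| ≤ 1 / 2 := by rw [abs_le]; constructor <;> linarith
    nlinarith [abs_nonneg (g - 1 / 2)]
  have h2 : |S - μ * g * N| ≤ 2 / 3 * a * b + 1 / 2 * |a - N| := by
    have : S - μ * g * N = (S - μ * N / 2 - μ * a * (g - 1 / 2)) + μ * (g - 1 / 2) * (a - N) := by
      ring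
    rw [this]
    exact (abs_add_le _ _).trans (add_le_add hS h1)
  refine h2.trans ?_
  have hab : 0 ≤ a * b := mul_nonneg ha hb
  -- If `a ≤ N`, the sum is at most `(2/3 + 2/3) a b ≤ 2 b N`. If `N ≤ a`, it is at most `(2/3 +
  -- 5/12) a b = 13/12 a b`, while `N ≥ 7/12 a` gives `2 b N ≥ 14/12 a b`.
  rcases le_total a N with h | h
  · rw [abs_of_nonpos (by linarith)]
    nlinarith [mul_le_mul_of_nonneg_right h hb]
  · rw [abs_of_nonneg (by linarith)]
    have h3 : a * (7 / 12) ≤ N := by nlinarith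
    nlinarith [mul_le_mul_of_nonneg_right h3 hb]

lemma radius_nonneg (K n t : ℕ) : 0 ≤ radius K n t := by unfold radius; positivity

lemma radius_anti (K n : ℕ) {s t : ℕ} (hs : 1 ≤ s) (h : s ≤ t) : radius K n t ≤ radius K n s := by
  unfold radius
  have : 0 ≤ Real.log n := Real.log_natCast_nonneg n
  have hs' : (0 : ℝ) < s := by exact_mod_cast hs
  gcongr

namespace Run

variable {K : ℕ}

/-- A run during whose first `N` steps all the deviations are under control. The number of pulls of
an arm during a window of `8 K m` steps is at least `4 m`. -/
structure IsGood (R : Run K) (n m : ℕ) (μ : Fin K → ℝ) (N : ℕ) : Prop where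
  two_le : 2 ≤ n
  mean_nonneg : ∀ k, 0 ≤ μ k
  mean_le_one : ∀ k, μ k ≤ 1
  rew_nonneg : ∀ t, 0 ≤ R.rew t
  rew_le_one : ∀ t, R.rew t ≤ 1
  le_avail : ∀ t, Real.exp (-1) ≤ R.avail t
  avail_le_one : ∀ t, R.avail t ≤ 1
  taken_mono : Monotone R.taken
  rew_of_taken : ∀ t < N, R.arm t ∈ R.taken t → R.rew t = 0
  gain_dev : ∀ k t, 1 ≤ t → t ≤ N → radius K n t ≤ 1 →
    |R.gain k 0 t - μ k * R.count k 0 t / 2 - μ k / K * (R.mass k t - t / 2)| <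
      2 / 3 * (t / K) * (radius K n t / 2)
  lt_count : ∀ k t, 1 ≤ t → t ≤ N → radius K n t ≤ 1 →
    (t / K : ℝ) * (1 - 5 / 6 * (radius K n t / 2)) < R.count k 0 t
  count_lt : ∀ k t, 1 ≤ t → t ≤ N → radius K n t ≤ 1 →
    (R.count k 0 t : ℝ) < t / K * (1 + 4 / 3 * (radius K n t / 2))
  window : ∀ k s, s ≤ N → 4 * m ≤ R.count k s (s + 8 * K * m)
  zeros : ∀ k s t, s ≤ t → t ≤ N → (∀ i, s ≤ i → i < t → k ∉ R.taken i) →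
    (∀ i, s ≤ i → i < t → R.arm i = k → R.rew i = 0) →
    R.count k s t * μ k < 2 * Real.exp 1 * Real.log n

namespace IsGood

variable {R : Run K} {n m : ℕ} {μ : Fin K → ℝ} {N : ℕ} (h : R.IsGood n m μ N)

include h

omit h in
lemma pos_K (R : Run K) : 0 < K := Fin.pos (R.arm 0)

lemma avail_pos (t : ℕ) : 0 < R.avail t := (Real.exp_pos _).trans_le (h.le_avail t)

lemma log_pos : 0 < Real.log n := Real.log_pos (by exact_mod_cast h.two_le)

lemma mass_nonneg (k : Fin K) (t : ℕ) : 0 ≤ R.mass k t :=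
  Finset.sum_nonneg fun i _ => by split_ifs; exacts [le_rfl, (h.avail_pos i).le]

lemma mass_le (k : Fin K) (t : ℕ) : R.mass k t ≤ t := by
  have : R.mass k t ≤ ∑ i ∈ Finset.range t, (1 : ℝ) :=
    Finset.sum_le_sum fun i _ => by split_ifs; exacts [zero_le_one, h.avail_le_one i]
  simpa using this

lemma mass_mono (k : Fin K) : Monotone (R.mass k) :=
  monotone_nat_of_le_succ fun t => by
    rw [mass_succ]; split_ifs <;> linarith [h.avail_pos t]

omit h in
lemma mass_of_free {k : Fin K} {t : ℕ} (hk : ∀ i < t, k ∉ R.taken i) :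
    R.mass k t = ∑ i ∈ Finset.range t, R.avail i :=
  Finset.sum_congr rfl fun i hi => if_neg (hk i (Finset.mem_range.1 hi))

/-- All free arms share the same availability, so an arm that has been free throughout has the
largest possible mass. Every comparison between arms rests on this fact. -/
lemma mass_le_of_free {k : Fin K} (l : Fin K) {t : ℕ} (hk : ∀ i < t, k ∉ R.taken i) :
    R.mass l t ≤ R.mass k t := by
  rw [mass_of_free hk]
  exact Finset.sum_le_sum fun i _ => by split_ifs; exacts [(h.avail_pos i).le, le_rfl]

lemma le_mass_of_free {k : Fin K} {t : ℕ} (hk : ∀ i < t, k ∉ R.taken i) :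
    Real.exp (-1) * t ≤ R.mass k t := by
  rw [mass_of_free hk]
  have : ∑ i ∈ Finset.range t, Real.exp (-1) ≤ ∑ i ∈ Finset.range t, R.avail i :=
    Finset.sum_le_sum fun i _ => h.le_avail i
  simpa [mul_comm] using this

lemma mass_eq_of_taken {k : Fin K} {s t : ℕ} (hk : k ∈ R.taken s) (hst : s ≤ t) :
    R.mass k t = R.mass k s := by
  induction t, hst using Nat.le_induction with
  | base => rfl
  | succ t ht ih => rw [mass_succ, if_pos (h.taken_mono ht hk), ih, add_zero]

lemma free_of_not_mem {k : Fin K} {t : ℕ} (hk : k ∉ R.taken t) : ∀ i < t, k ∉ R.taken i :=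
  fun _ hi hki => hk (h.taken_mono hi.le hki)

lemma gain_le_count (k : Fin K) (s t : ℕ) : R.gain k s t ≤ R.count k s t := by
  unfold gain count
  rw [Finset.card_filter]
  push_cast
  exact Finset.sum_le_sum fun i _ => by split_ifs; exacts [h.rew_le_one i, le_rfl]

lemma gain_nonneg (k : Fin K) (s t : ℕ) : 0 ≤ R.gain k s t :=
  Finset.sum_nonneg fun i _ => by split_ifs; exacts [h.rew_nonneg i, le_rfl]

lemma abs_gain_sub_le (k : Fin K) {t : ℕ} (h1 : 1 ≤ t) (h2 : t ≤ N) (h3 : radius K n t ≤ 1) :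
    |R.gain k 0 t - μ k * (R.mass k t / t) * R.count k 0 t| ≤ radius K n t * R.count k 0 t := by
  have ht : (0 : ℝ) < t := by exact_mod_cast h1
  have hK : (0 : ℝ) < K := by exact_mod_cast pos_K R
  have := abs_sub_le_of_dev (a := t / K) (b := radius K n t / 2) (N := R.count k 0 t)
    (S := R.gain k 0 t) (μ := μ k) (g := R.mass k t / t) (by positivity)
    (by linarith [radius_nonneg K n t]) (by linarith) (h.mean_nonneg k) (h.mean_le_one k)
    (div_nonneg (h.mass_nonneg k t) ht.le) ((div_le_one ht).2 (h.mass_le k t))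
    (by
      have e : μ k * (t / K : ℝ) * (R.mass k t / t - 1 / 2) = μ k / K * (R.mass k t - t / 2) := by
        field_simp
      rw [e]
      exact (h.gain_dev k t h1 h2 h3).le)
    (h.lt_count k t h1 h2 h3).le (h.count_lt k t h1 h2 h3).le
  linarith

lemma count_pos (k : Fin K) {t : ℕ} (h1 : 1 ≤ t) (h2 : t ≤ N) (h3 : radius K n t ≤ 1) :
    0 < R.count k 0 t := by
  have ht : (0 : ℝ) < t := by exact_mod_cast h1
  have hK : (0 : ℝ) < K := by exact_mod_cast pos_K R
  have := h.lt_count k t h1 h2 h3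
  have h4 : (0 : ℝ) ≤ (t / K : ℝ) * (1 - 5 / 6 * (radius K n t / 2)) :=
    mul_nonneg (by positivity) (by linarith)
  exact_mod_cast h4.trans_lt this

/-- The empirical mean is within the confidence radius of the effective mean. -/
lemma abs_div_sub_le (k : Fin K) {t : ℕ} (h1 : 1 ≤ t) (h2 : t ≤ N) (h3 : radius K n t ≤ 1) :
    |R.gain k 0 t / R.count k 0 t - μ k * (R.mass k t / t)| ≤ radius K n t := by
  have hc : (0 : ℝ) < R.count k 0 t := by exact_mod_cast h.count_pos k h1 h2 h3
  have h4 := h.abs_gain_sub_le k h1 h2 h3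
  have e : R.gain k 0 t / R.count k 0 t - μ k * (R.mass k t / t) =
      (R.gain k 0 t - μ k * (R.mass k t / t) * R.count k 0 t) / R.count k 0 t := by
    field_simp
  rw [e, abs_div, abs_of_pos hc, div_le_iff₀ hc]
  exact h4

lemma mean_mul_nonneg (k : Fin K) (t : ℕ) : 0 ≤ μ k * (R.mass k t / t) :=
  mul_nonneg (h.mean_nonneg k) (div_nonneg (h.mass_nonneg k t) t.cast_nonneg)

lemma mean_mul_le (k : Fin K) (t : ℕ) : μ k * (R.mass k t / t) ≤ μ k := by
  refine mul_le_of_le_one_right (h.mean_nonneg k) ?_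
  exact div_le_one_of_le₀ (h.mass_le k t) t.cast_nonneg

omit h in
lemma rinf_nonneg (k : Fin K) (t : ℕ) : 0 ≤ (R.state n t).rinf k := by
  rw [state_rinf]; split_ifs
  · exact le_rfl
  · exact le_max_right _ _

lemma rinf_le_rsup (k : Fin K) (t : ℕ) : (R.state n t).rinf k ≤ (R.state n t).rsup k := by
  rw [state_rinf, state_rsup]
  split_ifs with h0
  · exact zero_le_one
  · have hc : (0 : ℝ) < R.count k 0 t := by exact_mod_cast Nat.pos_of_ne_zero h0
    have h1 : R.gain k 0 t / R.count k 0 t ≤ 1 := (div_le_one hc).2 (h.gain_le_count k 0 t)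
    have h2 : 0 ≤ R.gain k 0 t / R.count k 0 t := div_nonneg (h.gain_nonneg k 0 t) hc.le
    have h3 := radius_nonneg K n t
    exact max_le (le_min (by linarith) (by linarith)) (le_min (by linarith) zero_le_one)

omit h in
lemma rsup_le_rinf_add (k : Fin K) {t : ℕ} (hc : 0 < R.count k 0 t) :
    (R.state n t).rsup k ≤ (R.state n t).rinf k + 2 * radius K n t := by
  rw [state_rinf, state_rsup, if_neg hc.ne', if_neg hc.ne']
  refine (min_le_left _ _).trans ?_
  linarith [le_max_left (R.gain k 0 t / R.count k 0 t - radius K n t) 0]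

/-- A radius above `1` clips the lower bound to `0`, and in `le_rsup` the upper bound to `1`, so the
estimate is then trivial. This is why `IsGood` controls the gain and the count only when the radius
is at most `1`. -/
lemma rinf_le (k : Fin K) {t : ℕ} (h2 : t ≤ N) :
    (R.state n t).rinf k ≤ μ k * (R.mass k t / t) := by
  rw [state_rinf]
  have h5 := h.mean_mul_nonneg k t
  split_ifs with h0
  · exact h5
  have h1 : 1 ≤ t := by
    rcases Nat.eq_zero_or_pos t with rfl | h1
    · simp [count_self] at h0
    · exact h1
  refine max_le ?_ h5
  rcases le_or_gt (radius K n t) 1 with h3 | h3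
  · linarith [(abs_le.1 (h.abs_div_sub_le k h1 h2 h3)).2]
  · have hc : (0 : ℝ) < R.count k 0 t := by exact_mod_cast Nat.pos_of_ne_zero h0
    have h1 : R.gain k 0 t / R.count k 0 t ≤ 1 := (div_le_one hc).2 (h.gain_le_count k 0 t)
    linarith

lemma le_rsup (k : Fin K) {t : ℕ} (h2 : t ≤ N) :
    μ k * (R.mass k t / t) ≤ (R.state n t).rsup k := by
  rw [state_rsup]
  have h5 := (h.mean_mul_le k t).trans (h.mean_le_one k)
  split_ifs with h0
  · exact h5
  have h1 : 1 ≤ t := by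
    rcases Nat.eq_zero_or_pos t with rfl | h1
    · simp [count_self] at h0
    · exact h1
  refine le_min ?_ h5
  rcases le_or_gt (radius K n t) 1 with h3 | h3
  · linarith [(abs_le.1 (h.abs_div_sub_le k h1 h2 h3)).1]
  · have hc : (0 : ℝ) < R.count k 0 t := by exact_mod_cast Nat.pos_of_ne_zero h0
    have h1 : 0 ≤ R.gain k 0 t / R.count k 0 t := div_nonneg (h.gain_nonneg k 0 t) hc.le
    linarith

lemma le_rinf (k : Fin K) {t : ℕ} (h1 : 1 ≤ t) (h2 : t ≤ N) (h3 : radius K n t ≤ 1) :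
    μ k * (R.mass k t / t) - 2 * radius K n t ≤ (R.state n t).rinf k := by
  rw [state_rinf, if_neg (h.count_pos k h1 h2 h3).ne']
  refine le_trans ?_ (le_max_left _ _)
  linarith [(abs_le.1 (h.abs_div_sub_le k h1 h2 h3)).1]

lemma rsup_le (k : Fin K) {t : ℕ} (h1 : 1 ≤ t) (h2 : t ≤ N) (h3 : radius K n t ≤ 1) :
    (R.state n t).rsup k ≤ μ k * (R.mass k t / t) + 2 * radius K n t := by
  have := rsup_le_rinf_add (n := n) k (h.count_pos k h1 h2 h3)
  linarith [h.rinf_le k h2]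

lemma mean_lt_of_rsup_lt_rinf {i l : Fin K} {t : ℕ} (h2 : t ≤ N)
    (hil : (R.state n t).rsup l < (R.state n t).rinf i) :
    μ l * R.mass l t < μ i * R.mass i t := by
  have h3 := (h.le_rsup l h2).trans_lt (hil.trans_le (h.rinf_le i h2))
  rcases Nat.eq_zero_or_pos t with rfl | h1
  · simp [mass] at h3
  have ht : (0 : ℝ) < t := by exact_mod_cast h1
  rw [← mul_div_assoc, ← mul_div_assoc, div_lt_div_iff_of_pos_right ht] at h3
  exact h3

end IsGood

end Run

end

end DynMMAB

/-! ### Soundness: Occupied contains only exploited arms, and Preferences is well ordered. -/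

namespace DynMMAB

noncomputable section

namespace Run

variable {K : ℕ}

lemma prefs_getElem?_mono (R : Run K) (n : ℕ) {s t p : ℕ} {a : Fin K} (hst : s ≤ t)
    (h : (R.state n s).prefs[p]? = some a) : (R.state n t).prefs[p]? = some a := by
  induction t, hst using Nat.le_induction with
  | base => exact h
  | succ t ht ih =>
    obtain ⟨l, hl⟩ := R.prefs_prefix n t
    rw [← hl, List.getElem?_append_left (List.getElem?_eq_some_iff.1 ih).1, ih]

/-- The properties of the memory of an exploring player that make her decisions sound. -/
structure IsSound (R : Run K) (n : ℕ) (μ : Fin K → ℝ) (t : ℕ) : Prop where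
  occ_subset : (R.state n t).occ ⊆ R.taken t
  nodup : (R.state n t).prefs.Nodup
  pos : ∀ p < (R.state n t).pos, ∃ a, (R.state n t).prefs[p]? = some a ∧ a ∈ (R.state n t).occ
  order : ∀ (p : ℕ) (i l : Fin K), (R.state n t).prefs[p]? = some i →
    (IsActive (R.state n t).prefs (R.state n t).occ l ∨ l ∈ (R.state n t).prefs.drop (p + 1)) →
    ∃ t₀ ≤ t, μ l * R.mass l t₀ < μ i * R.mass i t₀
  block : ∀ k, ∃ s ≤ t, (R.state n t).pullsTemp k = R.count k s t ∧
    (R.state n t).sumTemp k = R.gain k s t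

lemma isActive_mono {prefs prefs' : List (Fin K)} {occ occ' : Finset (Fin K)} {l : Fin K}
    (hp : prefs ⊆ prefs') (ho : occ ⊆ occ') (h : IsActive prefs' occ' l) : IsActive prefs occ l :=
  ⟨fun hl => h.1 (hp hl), fun hl => h.2 (ho hl)⟩

namespace IsGood

variable {R : Run K} {n m : ℕ} {μ : Fin K → ℝ} {N : ℕ} (h : R.IsGood n m μ N)

include h

/-- A finite block length always comes from a lower confidence bound `ρ`, which underestimates the
deflated mean and hence `μ k`. Blocks are therefore never shorter than the true mean requires. -/
lemma len_cases (k : Fin K) {t : ℕ} (ht : t ≤ N) : (R.state n t).len k = ⊤ ∨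
    ∃ ρ, 0 < ρ ∧ ρ ≤ μ k ∧
      (R.state n t).len k = ENNReal.ofReal (2 * Real.exp 1 * Real.log n / ρ) := by
  induction t with
  | zero => exact Or.inl rfl
  | succ t ih =>
    have ih := ih (by omega)
    rw [state_succ, explore_len, Function.update_apply]
    split_ifs with hk
    · rw [← state_succ, ← hk]
      rcases min_choice (blockLength n ((R.state n (t + 1)).rinf k)) ((R.state n t).len k)
        with e | e
      · rw [e]
        unfold blockLength
        split_ifs with h0
        · exact Or.inl rfl
        · refine Or.inr ⟨_, lt_of_le_of_ne (rinf_nonneg _ _) (Ne.symm h0), ?_, rfl⟩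
          exact (h.rinf_le k ht).trans (h.mean_mul_le k _)
      · rw [e]; exact ih
    · exact ih

lemma mean_mul_mass_le {i l : Fin K} {t : ℕ} (hl : ∀ s < t, l ∉ R.taken s) (hil : μ i ≤ μ l) :
    μ i * R.mass i t ≤ μ l * R.mass l t :=
  mul_le_mul hil (h.mass_le_of_free i hl) (h.mass_nonneg i t) (h.mean_nonneg l)

/-- A complete block of `k` has at least `2 e log n / ρ` pulls with `ρ ≤ μ k`. If all of them gave
`0` on a free arm, `IsGood.zeros` would be violated. -/
lemma mem_taken_of_zero_block {t : ℕ} (ht : t + 1 ≤ N) {k : Fin K} (hk : R.arm t = k)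
    (hS : R.IsSound n μ t) (hb : BlockEnds n (R.state n t) k (R.rew t))
    (h0 : (R.state n t).sumTemp k + R.rew t = 0) : k ∈ R.taken t := by
  by_contra hkt
  obtain ⟨s, hs, hp, hsum⟩ := hS.block k
  have hg : R.gain k s (t + 1) = 0 := by rw [gain_succ _ _ hs, if_pos hk, ← hsum, h0]
  have hc : R.count k s (t + 1) = (R.state n t).pullsTemp k + 1 := by
    rw [count_succ _ _ hs, if_pos hk, hp]
  have hz := h.zeros k s (t + 1) (by omega) ht
    (fun i _ hi hki => hkt (h.taken_mono (Nat.lt_succ_iff.1 hi) hki))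
    (fun i hi hi' hik => by
      have := (Finset.sum_eq_zero_iff_of_nonneg (fun i _ => by
        split_ifs; exacts [h.rew_nonneg i, le_rfl])).1 hg i (Finset.mem_Ico.2 ⟨hi, hi'⟩)
      simpa [hik] using this)
  unfold BlockEnds at hb
  rw [← hc] at hb
  have hlen := h.len_cases k ht
  rw [state_succ, hk] at hlen
  rcases hlen with e | ⟨ρ, hρ, hρ', e⟩
  · rw [e] at hb
    exact absurd hb (by simp)
  · rw [e, ENNReal.ofReal_le_natCast, div_le_iff₀ hρ] at hb
    have : (R.count k s (t + 1) : ℝ) * ρ ≤ R.count k s (t + 1) * μ k := by gcongr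
    linarith

/-- The witness `t₀` is the time at which `i` was appended: `i` then dominated every other active
arm, and the arms that are still active or stand after `i` were active at that time. The set
`occMid` appears because domination is tested between the two updates of Occupied. -/
lemma order_mid {t : ℕ} (ht : t + 1 ≤ N) (hS : R.IsSound n μ t) (p : ℕ) (i l : Fin K)
    (hp : (R.state n (t + 1)).prefs[p]? = some i)
    (hl : IsActive (R.state n (t + 1)).prefs (occMid n (R.state n t) (R.arm t) (R.rew t)) l ∨
      l ∈ (R.state n (t + 1)).prefs.drop (p + 1)) :
    ∃ t₀ ≤ t + 1, μ l * R.mass l t₀ < μ i * R.mass i t₀ := by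
  have key : ∀ (p : ℕ) (i : Fin K), (R.state n t).prefs[p]? = some i →
      (IsActive (R.state n t).prefs (occMid n (R.state n t) (R.arm t) (R.rew t)) l ∨
      l ∈ (R.state n t).prefs.drop (p + 1)) →
      ∃ t₀ ≤ t + 1, μ l * R.mass l t₀ < μ i * R.mass i t₀ := by
    intro p i hp hl
    obtain ⟨t₀, ht₀, hlt⟩ := hS.order p i l hp
      (hl.imp (isActive_mono (List.Subset.refl _) (occ_subset_occMid _ _ _ _)) id)
    exact ⟨t₀, by omega, hlt⟩
  rcases explore_prefs_cases n (R.state n t) (R.arm t) (R.rew t) with ⟨e, -⟩ | ⟨d, hd, e⟩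
  · rw [state_succ, e] at hp hl
    exact key p i hp hl
  rw [state_succ, e] at hp hl
  rcases lt_or_ge p (R.state n t).prefs.length with hlt | hge
  · rw [List.getElem?_append_left hlt] at hp
    refine key p i hp ?_
    rcases hl with hl | hl
    · exact Or.inl (isActive_mono (List.subset_append_left _ _) subset_rfl hl)
    · rw [List.drop_append_of_le_length (by omega)] at hl
      rcases List.mem_append.1 hl with hl | hl
      · exact Or.inr hl
      · rw [List.mem_singleton.1 hl]; exact Or.inl hd.1
  · have hpl : p = (R.state n t).prefs.length := by
      have := (List.getElem?_eq_some_iff.1 hp).1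
      simp at this; omega
    subst hpl
    simp only [List.getElem?_concat_length, Option.some.injEq] at hp
    subst hp
    rcases hl with hl | hl
    · have hne : l ≠ d := fun hld => hl.1 (by simp [hld])
      have := hd.2 l hne (isActive_mono (List.subset_append_left _ _) subset_rfl hl)
      exact ⟨t + 1, le_rfl, h.mean_lt_of_rsup_lt_rinf ht this⟩
    · simp at hl

lemma isSound {t : ℕ} (ht : t ≤ N) : R.IsSound n μ t := by
  induction t with
  | zero =>
    refine ⟨by simp [state, initState], by simp [state, initState], by simp [state, initState],
      by simp [state, initState], fun k => ⟨0, le_rfl, ?_, ?_⟩⟩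
    · rw [count_self]; rfl
    · rw [gain_self]; rfl
  | succ t ih =>
    have hS := ih (by omega)
    have hmid : occMid n (R.state n t) (R.arm t) (R.rew t) ⊆ R.taken t := by
      intro a ha
      rcases (mem_occMid _ _ _ _).1 ha with ha | ⟨rfl, hb, h0⟩
      · exact hS.occ_subset ha
      · exact h.mem_taken_of_zero_block ht rfl hS hb h0
    have hmid' : occMid n (R.state n t) (R.arm t) (R.rew t) ⊆ (R.state n (t + 1)).occ :=
      occMid_subset_explore_occ _ _ _ _
    refine ⟨?_, ?_, ?_, ?_, ?_⟩
    · intro a ha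
      rw [state_succ, mem_explore_occ] at ha
      rcases ha with ha | ⟨hp, l, hl, hlt⟩
      · exact h.taken_mono (Nat.le_succ t) (hmid ha)
      by_contra hat
      -- At `t₀` the arm `a` was ahead of `l`, and now `l` is ahead of `a`. If `a` is free, this
      -- reversal is impossible. For `μ l ≤ μ a` it contradicts the maximal mass of `a`. For `μ a <
      -- μ l`, being behind at `t₀` forces `l` to be taken by then, so its mass is frozen while that
      -- of `a` can only grow.
      obtain ⟨t₀, ht₀, hlt₀⟩ := h.order_mid ht hS _ a l hp hl
      have hlt' := h.mean_lt_of_rsup_lt_rinf ht hlt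
      have hfree := h.free_of_not_mem hat
      have hfree₀ : ∀ s < t₀, a ∉ R.taken s := fun s hs => hfree s (by omega)
      rcases lt_or_ge (μ a) (μ l) with hal | hal
      · have : l ∈ R.taken t₀ := by
          by_contra hlt₀'
          exact absurd hlt₀ (not_lt.2 (h.mean_mul_mass_le (h.free_of_not_mem hlt₀') hal.le))
        rw [h.mass_eq_of_taken this ht₀] at hlt'
        have := mul_le_mul_of_nonneg_left (h.mass_mono a ht₀) (h.mean_nonneg a)
        linarith
      · exact absurd hlt' (not_lt.2 (h.mean_mul_mass_le hfree hal))
    · rcases explore_prefs_cases n (R.state n t) (R.arm t) (R.rew t) with ⟨e, -⟩ | ⟨d, hd, e⟩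
      · rw [state_succ, e]; exact hS.nodup
      · rw [state_succ, e, List.nodup_append]
        refine ⟨hS.nodup, List.nodup_singleton d, ?_⟩
        intro a ha b hb hab
        rw [List.mem_singleton.1 hb] at hab
        exact hd.1.1 (hab ▸ ha)
    · have hext : ∀ (p : ℕ) (a : Fin K), (R.state n t).prefs[p]? = some a → a ∈ (R.state n t).occ →
          ∃ a, (R.state n (t + 1)).prefs[p]? = some a ∧ a ∈ (R.state n (t + 1)).occ := by
        intro p a hp ha
        refine ⟨a, ?_, R.occ_mono n (Nat.le_succ t) ha⟩
        exact R.prefs_getElem?_mono n (Nat.le_succ t) hp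
      intro p hp
      by_cases hx : ∃ a, (R.state n t).prefs[(R.state n t).pos]? = some a ∧ a ∈ (R.state n t).occ
      · obtain ⟨a, ha, ha'⟩ := hx
        rw [state_succ, explore_pos_of_mem _ _ _ _ ha ha'] at hp
        rcases Nat.lt_succ_iff_lt_or_eq.1 hp with hp | rfl
        · obtain ⟨a, ha, ha'⟩ := hS.pos p hp
          exact hext p a ha ha'
        · exact hext _ a ha ha'
      · push Not at hx
        rw [state_succ, explore_pos_of_not_mem _ _ _ _ hx] at hp
        obtain ⟨a, ha, ha'⟩ := hS.pos p hp
        exact hext p a ha ha'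
    · intro p i l hp hl
      exact h.order_mid ht hS p i l hp
        (hl.imp (isActive_mono (List.Subset.refl _) hmid') id)
    · intro k
      obtain ⟨s, hs, hp, hsum⟩ := hS.block k
      by_cases hk : R.arm t = k
      · by_cases hb : BlockEnds n (R.state n t) k (R.rew t)
        · refine ⟨t + 1, le_rfl, ?_, ?_⟩
          · rw [state_succ, hk, explore_pullsTemp_of_ends _ _ _ _ hb, count_self,
              Function.update_self]
          · rw [state_succ, hk, explore_sumTemp_of_ends _ _ _ _ hb, gain_self,
              Function.update_self]
        · refine ⟨s, by omega, ?_, ?_⟩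
          · rw [state_succ, hk, explore_pullsTemp_of_not_ends _ _ _ _ hb, Function.update_self, hp,
              count_succ _ _ hs, if_pos hk]
          · rw [state_succ, hk, explore_sumTemp_of_not_ends _ _ _ _ hb, Function.update_self, hsum,
              gain_succ _ _ hs, if_pos hk]
      · refine ⟨s, by omega, ?_, ?_⟩
        · rw [count_succ _ _ hs, if_neg hk, state_succ, add_zero, ← hp]
          by_cases hb : BlockEnds n (R.state n t) (R.arm t) (R.rew t)
          · rw [explore_pullsTemp_of_ends _ _ _ _ hb, Function.update_of_ne (Ne.symm hk)]
          · rw [explore_pullsTemp_of_not_ends _ _ _ _ hb, Function.update_of_ne (Ne.symm hk)]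
        · rw [gain_succ _ _ hs, if_neg hk, state_succ, add_zero, ← hsum]
          by_cases hb : BlockEnds n (R.state n t) (R.arm t) (R.rew t)
          · rw [explore_sumTemp_of_ends _ _ _ _ hb, Function.update_of_ne (Ne.symm hk)]
          · rw [explore_sumTemp_of_not_ends _ _ _ _ hb, Function.update_of_ne (Ne.symm hk)]

/-- All the arms that are better than the arm to occupy are exploited by other players. -/
lemma mem_taken_of_better {t : ℕ} (ht : t ≤ N) {i l : Fin K}
    (hi : (R.state n t).prefs[(R.state n t).pos]? = some i) (hil : μ i < μ l) :
    l ∈ R.taken t := by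
  have hS := h.isSound ht
  by_contra hl
  have hne : i ≠ l := fun e => by rw [e] at hil; exact lt_irrefl _ hil
  have hocc : l ∉ (R.state n t).occ := fun hlo => hl (hS.occ_subset hlo)
  -- All the positions before the current one hold arms of Occupied. As `l` is free, it is not in
  -- Occupied and so cannot stand there.
  have : IsActive (R.state n t).prefs (R.state n t).occ l ∨
      l ∈ (R.state n t).prefs.drop ((R.state n t).pos + 1) := by
    by_cases hlp : l ∈ (R.state n t).prefs
    · right
      obtain ⟨q, hq⟩ := List.mem_iff_getElem?.1 hlp
      rcases lt_trichotomy q (R.state n t).pos with hlt | rfl | hgt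
      · obtain ⟨a, ha, ha'⟩ := hS.pos q hlt
        rw [hq] at ha
        cases ha
        exact absurd ha' hocc
      · rw [hi] at hq
        cases hq
        exact absurd rfl hne
      · refine List.mem_iff_getElem?.2 ⟨q - ((R.state n t).pos + 1), ?_⟩
        rw [List.getElem?_drop, ← hq]
        congr 1
        omega
    · exact Or.inl ⟨hlp, hocc⟩
  obtain ⟨t₀, ht₀, hlt⟩ := hS.order _ i l hi this
  refine absurd hlt (not_lt.2 (h.mean_mul_mass_le ?_ hil.le))
  exact fun s hs hsl => hl (h.taken_mono (by omega) hsl)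

end IsGood

end Run

end

end DynMMAB

/-! ### Progress: how long exploration can last. -/

namespace DynMMAB

noncomputable section

namespace Run

variable {K : ℕ}

section General

variable (R : Run K) (n : ℕ)

lemma pullsTemp_lt_len (t : ℕ) (k : Fin K) : (R.state n t).pullsTemp k = 0 ∨
    ((R.state n t).pullsTemp k : ℝ≥0∞) < (R.state n t).len k := by
  induction t with
  | zero => exact Or.inl rfl
  | succ t ih =>
    rw [state_succ]
    by_cases hk : k = R.arm t
    · subst hk
      by_cases hb : BlockEnds n (R.state n t) (R.arm t) (R.rew t)
      · left
        rw [explore_pullsTemp_of_ends _ _ _ _ hb, Function.update_self]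
      · right
        rw [explore_pullsTemp_of_not_ends _ _ _ _ hb, Function.update_self]
        exact not_le.1 hb
    · have e : (explore n (R.state n t) (R.arm t) (R.rew t)).pullsTemp k =
          (R.state n t).pullsTemp k := by
        by_cases hb : BlockEnds n (R.state n t) (R.arm t) (R.rew t)
        · rw [explore_pullsTemp_of_ends _ _ _ _ hb, Function.update_of_ne hk]
        · rw [explore_pullsTemp_of_not_ends _ _ _ _ hb, Function.update_of_ne hk]
      rw [e, explore_len, Function.update_of_ne hk]
      exact ih

lemma pos_mono : Monotone fun t => (R.state n t).pos :=
  monotone_nat_of_le_succ fun t => by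
    rw [state_succ]
    by_cases hx : ∃ a, (R.state n t).prefs[(R.state n t).pos]? = some a ∧ a ∈ (R.state n t).occ
    · obtain ⟨a, ha, ha'⟩ := hx
      rw [explore_pos_of_mem _ _ _ _ ha ha']; omega
    · push Not at hx
      rw [explore_pos_of_not_mem _ _ _ _ hx]

end General

namespace IsGood

variable {R : Run K} {n m : ℕ} {μ : Fin K → ℝ} {N : ℕ} (h : R.IsGood n m μ N)

include h

lemma gain_eq_of_taken {k : Fin K} {s t : ℕ} (hk : k ∈ R.taken s) (hst : s ≤ t) (ht : t ≤ N) :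
    R.gain k 0 t = R.gain k 0 s := by
  induction t, hst using Nat.le_induction with
  | base => rfl
  | succ t hs ih =>
    rw [gain_succ _ _ (Nat.zero_le _), ih (by omega)]
    split_ifs with ha
    · rw [h.rew_of_taken t (by omega) (by rw [ha]; exact h.taken_mono hs hk), add_zero]
    · rw [add_zero]

/-- On a taken arm the total gain is frozen, the count increases and the radius decreases. An arm
found to be dominated therefore keeps a low upper bound, even if it is not pulled again. -/
lemma rsup_le_of_taken {k : Fin K} {s t : ℕ} (hk : k ∈ R.taken s) (hst : s ≤ t) (ht : t ≤ N)
    (hs : 1 ≤ s) (hc : 0 < R.count k 0 s) : (R.state n t).rsup k ≤ (R.state n s).rsup k := by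
  have hct : R.count k 0 s ≤ R.count k 0 t := by
    rw [R.count_add k (Nat.zero_le s) hst]; omega
  have hc' : (0 : ℝ) < R.count k 0 s := by exact_mod_cast hc
  rw [state_rsup, state_rsup, if_neg hc.ne', if_neg (by omega), h.gain_eq_of_taken hk hst ht]
  refine min_le_min_right _ (add_le_add ?_ (radius_anti K n hs hst))
  exact div_le_div_of_nonneg_left (h.gain_nonneg k 0 s) hc' (by exact_mod_cast hct)

/-- An arm exploited by another player whose block length is at most `m` is declared occupied
after at most `2 m` further pulls. -/
lemma mem_occ_of_lt_count (hm : 1 ≤ m) {k : Fin K} {s t : ℕ} (hk : k ∈ R.taken s) (hst : s ≤ t)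
    (ht : t ≤ N) (hl : (R.state n s).len k ≤ m) (hc : 2 * m < R.count k s t) :
    k ∈ (R.state n t).occ := by
  have hlt : ∀ t, s ≤ t → (R.state n t).pullsTemp k < m := by
    intro t hst
    rcases R.pullsTemp_lt_len n t k with h0 | h0
    · omega
    · exact_mod_cast h0.trans_le ((R.len_antitone n k hst).trans hl)
  -- The first alternative is the block in progress at time `s`, which may contain positive rewards
  -- from before `k` was taken and so may end without detection. It ends after at most `m` further
  -- pulls; the next block has only zeros and its end puts `k` into Occupied.
  have key : ∀ t, s ≤ t → t ≤ N → k ∉ (R.state n t).occ →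
      R.count k s t ≤ (R.state n t).pullsTemp k ∨
      ((R.state n t).sumTemp k = 0 ∧ R.count k s t ≤ (R.state n t).pullsTemp k + m) := by
    intro t hst
    induction t, hst using Nat.le_induction with
    | base => intro _ _; left; rw [count_self]; exact Nat.zero_le _
    | succ t hst ih =>
      intro ht hko
      have hko' : k ∉ (R.state n t).occ := fun hx => hko (R.occ_mono n (Nat.le_succ t) hx)
      have ih := ih (by omega) hko'
      rw [count_succ _ _ hst, state_succ]
      by_cases ha : R.arm t = k
      · rw [if_pos ha, ha]
        have hr : R.rew t = 0 := h.rew_of_taken t (by omega) (by rw [ha]; exact h.taken_mono hst hk)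
        by_cases hb : BlockEnds n (R.state n t) k (R.rew t)
        · rw [explore_pullsTemp_of_ends _ _ _ _ hb, explore_sumTemp_of_ends _ _ _ _ hb,
            Function.update_self, Function.update_self]
          have hne : (R.state n t).sumTemp k ≠ 0 := by
            intro h0
            apply hko
            rw [state_succ, mem_explore_occ, mem_occMid, ha]
            exact Or.inl (Or.inr ⟨rfl, hb, by rw [h0, hr, add_zero]⟩)
          right
          have := hlt t hst
          refine ⟨rfl, ?_⟩
          rcases ih with ih | ih
          · omega
          · exact absurd ih.1 hne
        · rw [explore_pullsTemp_of_not_ends _ _ _ _ hb, explore_sumTemp_of_not_ends _ _ _ _ hb,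
            Function.update_self, Function.update_self, hr, add_zero]
          rcases ih with ih | ih
          · left; omega
          · right; exact ⟨ih.1, by omega⟩
      · rw [if_neg ha, add_zero]
        have e : (explore n (R.state n t) (R.arm t) (R.rew t)).pullsTemp k =
            (R.state n t).pullsTemp k ∧ (explore n (R.state n t) (R.arm t) (R.rew t)).sumTemp k =
            (R.state n t).sumTemp k := by
          by_cases hb : BlockEnds n (R.state n t) (R.arm t) (R.rew t)
          · rw [explore_pullsTemp_of_ends _ _ _ _ hb, explore_sumTemp_of_ends _ _ _ _ hb,
              Function.update_of_ne (Ne.symm ha), Function.update_of_ne (Ne.symm ha)]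
            exact ⟨rfl, rfl⟩
          · rw [explore_pullsTemp_of_not_ends _ _ _ _ hb, explore_sumTemp_of_not_ends _ _ _ _ hb,
              Function.update_of_ne (Ne.symm ha), Function.update_of_ne (Ne.symm ha)]
            exact ⟨rfl, rfl⟩
        rw [e.1, e.2]
        exact ih
  by_contra hko
  have := hlt t hst
  rcases key t hst ht hko with h1 | h1 <;> omega

end IsGood

/-- The arm `i` is the best one among those that are not exploited by other players during a period
starting at time `s` that covers four windows, and the estimates are accurate at time `s`. -/
structure IsStable (R : Run K) (n m : ℕ) (μ : Fin K → ℝ) (μ₀ Δ : ℝ) (s : ℕ) (i : Fin K) :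
    Prop where
  one_le_m : 1 ≤ m
  one_le : 1 ≤ s
  gap_pos : 0 < Δ
  gap_le : Δ ≤ μ₀
  le_m : 8 * Real.exp 1 ^ 2 * Real.log n / μ₀ ≤ m
  radius_le : radius K n s ≤ Δ / (8 * Real.exp 1)
  radius_le_one : radius K n s ≤ 1
  taken_eq : R.taken (s + 4 * (8 * K * m)) = R.taken s
  free : i ∉ R.taken s
  le_mean : μ₀ ≤ μ i
  better : ∀ l, l ∉ R.taken s → l ≠ i → μ l + Δ ≤ μ i

namespace IsGood

variable {R : Run K} {n m : ℕ} {μ : Fin K → ℝ} {N : ℕ} (h : R.IsGood n m μ N)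
  {μ₀ Δ : ℝ} {s : ℕ} {i : Fin K} (hs : R.IsStable n m μ μ₀ Δ s i)

include h hs

omit h in
lemma radius_le_of_stable {t : ℕ} (hst : s ≤ t) : radius K n t ≤ Δ / (8 * Real.exp 1) :=
  (radius_anti K n hs.one_le hst).trans hs.radius_le

omit h in
lemma radius_le_one_of_stable {t : ℕ} (hst : s ≤ t) : radius K n t ≤ 1 :=
  (radius_anti K n hs.one_le hst).trans hs.radius_le_one

lemma taken_eq_of_stable {t : ℕ} (hst : s ≤ t) (ht : t ≤ s + 4 * (8 * K * m)) :
    R.taken t = R.taken s :=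
  Finset.Subset.antisymm (hs.taken_eq ▸ h.taken_mono ht) (h.taken_mono hst)

lemma exp_le_mass_div {t : ℕ} (hst : s ≤ t) (ht : t ≤ s + 4 * (8 * K * m)) :
    (Real.exp 1)⁻¹ ≤ R.mass i t / t := by
  have ht0 : (0 : ℝ) < t := by have := hs.one_le; exact_mod_cast (by omega : 0 < t)
  rw [le_div_iff₀ ht0, ← Real.exp_neg]
  exact h.le_mass_of_free (h.free_of_not_mem (by rw [h.taken_eq_of_stable hs hst ht]; exact hs.free))

lemma le_rinf_of_stable {t : ℕ} (hst : s ≤ t) (ht : t ≤ s + 4 * (8 * K * m)) (htN : t ≤ N) :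
    μ₀ / Real.exp 1 - Δ / (4 * Real.exp 1) ≤ (R.state n t).rinf i := by
  refine le_trans ?_ (h.le_rinf i (hs.one_le.trans hst) htN (radius_le_one_of_stable hs hst))
  have h1 := radius_le_of_stable hs hst
  have h2 : μ₀ / Real.exp 1 ≤ μ i * (R.mass i t / t) := by
    rw [div_eq_mul_inv]
    exact mul_le_mul hs.le_mean (h.exp_le_mass_div hs hst ht) (by positivity) (h.mean_nonneg i)
  have h3 : Δ / (4 * Real.exp 1) = 2 * (Δ / (8 * Real.exp 1)) := by field_simp; ring
  linarith

/-- The best free arm dominates the other free arms. -/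
lemma rsup_lt_rinf_of_free {t : ℕ} (hst : s ≤ t) (ht : t ≤ s + 4 * (8 * K * m)) (htN : t ≤ N)
    {l : Fin K} (hl : l ∉ R.taken s) (hli : l ≠ i) :
    (R.state n t).rsup l < (R.state n t).rinf i := by
  have ht1 := hs.one_le.trans hst
  have hr1 := radius_le_one_of_stable hs hst
  have hr := radius_le_of_stable hs hst
  have e := h.taken_eq_of_stable hs hst ht
  have h1 := h.rsup_le l ht1 htN hr1
  have h2 := h.le_rinf i ht1 htN hr1
  have h3 : R.mass l t = R.mass i t := by
    rw [mass_of_free (h.free_of_not_mem (e ▸ hl)), mass_of_free (h.free_of_not_mem (e ▸ hs.free))]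
  rw [h3] at h1
  have h4 := h.exp_le_mass_div hs hst ht
  have hE : (0 : ℝ) < (Real.exp 1)⁻¹ := by positivity
  -- The deflated means differ by at least `Δ / e`, and the four radii lost in the two bounds add up
  -- to at most `Δ / (2 e)`.
  have h5 : Δ * (Real.exp 1)⁻¹ ≤ (μ i - μ l) * (R.mass i t / t) :=
    mul_le_mul (by linarith [hs.better l hl hli]) h4 hE.le
      (by linarith [hs.better l hl hli, hs.gap_pos])
  have h6 : Δ / (8 * Real.exp 1) = Δ * (Real.exp 1)⁻¹ / 8 := by field_simp
  have h7 := mul_pos hs.gap_pos hE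
  linarith

/-- After one window, an arm exploited by another player has a short block length or is dominated
by the best free arm. -/
lemma len_le_or_dominated {k : Fin K} (hk : k ∈ R.taken s)
    (hN : s + 4 * (8 * K * m) ≤ N) : (R.state n (s + 8 * K * m)).len k ≤ m ∨
    ∀ t, s + 8 * K * m ≤ t → t ≤ s + 4 * (8 * K * m) →
      (R.state n t).rsup k < (R.state n t).rinf i := by
  obtain ⟨t', h1, h2, h3⟩ := R.exists_arm_of_count_pos (k := k) (s := s) (t := s + 8 * K * m)
    (by have := h.window k s (by omega); have := hs.one_le_m; omega)
  have hμ₀ : 0 < μ₀ := hs.gap_pos.trans_le hs.gap_le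
  have hE := Real.exp_pos 1
  -- Look at the bounds right after a pull of `k` in the window. A lower bound of at least `μ₀ / (4
  -- e)` gives a block length of at most `8 e² log n / μ₀ ≤ m`.
  rcases le_or_gt (μ₀ / (4 * Real.exp 1)) ((R.state n (t' + 1)).rinf k) with hr | hr
  · left
    refine (R.len_antitone n k (by omega : t' + 1 ≤ s + 8 * K * m)).trans ?_
    have hpos : 0 < μ₀ / (4 * Real.exp 1) := by positivity
    change (R.state n (t' + 1)).len k ≤ m
    rw [state_succ, explore_len, h3, Function.update_self]
    rw [state_succ, h3] at hr
    refine (min_le_left _ _).trans ?_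
    unfold blockLength
    rw [if_neg (hpos.trans_le hr).ne', ENNReal.ofReal_le_natCast]
    refine le_trans ?_ hs.le_m
    have : 8 * Real.exp 1 ^ 2 * Real.log n / μ₀ =
      2 * Real.exp 1 * Real.log n / (μ₀ / (4 * Real.exp 1)) := by field_simp; ring
    rw [this]
    have := h.log_pos
    gcongr
  · right
    intro t ht ht'
    have hc : 0 < R.count k 0 (t' + 1) := by
      rw [count_succ _ _ (Nat.zero_le _), if_pos h3]; omega
    -- Otherwise the upper bound of `k` is, from then on, below `μ₀ / (4 e) + Δ / (4 e) ≤ μ₀ / (2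
    -- e)`, whereas the lower bound of `i` is at least `μ₀ / e - Δ / (4 e) ≥ 3 μ₀ / (4 e)`.
    have h4 := h.rsup_le_of_taken (h.taken_mono (by omega : s ≤ t' + 1) hk)
      (by omega : t' + 1 ≤ t) (by omega) (by omega) hc
    have h5 := rsup_le_rinf_add (n := n) k hc
    have h6 := radius_le_of_stable hs (by omega : s ≤ t' + 1)
    have h7 := h.le_rinf_of_stable hs (by omega : s ≤ t) ht' (by omega)
    have h8 : μ₀ / (4 * Real.exp 1) = μ₀ * (Real.exp 1)⁻¹ / 4 := by field_simp
    have h9 : Δ / (8 * Real.exp 1) = Δ * (Real.exp 1)⁻¹ / 8 := by field_simp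
    have h10 : Δ / (4 * Real.exp 1) = Δ * (Real.exp 1)⁻¹ / 4 := by field_simp
    have h11 : Δ * (Real.exp 1)⁻¹ ≤ μ₀ * (Real.exp 1)⁻¹ :=
      mul_le_mul_of_nonneg_right hs.gap_le (by positivity)
    have h12 : 0 < μ₀ * (Real.exp 1)⁻¹ := by positivity
    rw [div_eq_mul_inv] at h7
    linarith

/-- After two windows, every arm but the best free one is declared occupied or dominated. -/
lemma mem_occ_or_dominated {l : Fin K} (hl : l ≠ i) (hN : s + 4 * (8 * K * m) ≤ N) :
    l ∈ (R.state n (s + 2 * (8 * K * m))).occ ∨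
    ∀ t, s + 2 * (8 * K * m) ≤ t → t ≤ s + 4 * (8 * K * m) →
      (R.state n t).rsup l < (R.state n t).rinf i := by
  by_cases hk : l ∈ R.taken s
  · rcases h.len_le_or_dominated hs hk hN with h1 | h1
    · left
      have hw := h.window l (s + 8 * K * m) (by omega)
      rw [add_assoc, ← two_mul] at hw
      have := hs.one_le_m
      exact h.mem_occ_of_lt_count hs.one_le_m (h.taken_mono (by omega) hk)
        (by omega : s + 8 * K * m ≤ s + 2 * (8 * K * m)) (by omega) h1 (by omega)
    · right
      intro t ht ht'
      exact h1 t (by omega) ht'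
  · right
    intro t ht ht'
    exact h.rsup_lt_rinf_of_free hs (by omega) ht' (by omega) hk hl

lemma not_mem_occ_of_stable (hN : s + 4 * (8 * K * m) ≤ N) {t : ℕ} (hst : s ≤ t)
    (ht : t ≤ s + 4 * (8 * K * m)) : i ∉ (R.state n t).occ := fun hi =>
  hs.free (h.taken_eq_of_stable hs hst ht ▸ (h.isSound (by omega)).occ_subset hi)

/-- After two windows every other arm that is still active is dominated by `i`, so `i` qualifies for
Preferences. Two arms cannot dominate each other, so the arm found by the search is `i` itself. -/
lemma mem_prefs_of_stable (hN : s + 4 * (8 * K * m) ≤ N) {t : ℕ} (hst : s + 2 * (8 * K * m) ≤ t)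
    (ht : t + 1 ≤ s + 4 * (8 * K * m)) : i ∈ (R.state n (t + 1)).prefs := by
  by_cases hi : i ∈ (R.state n t).prefs
  · exact (R.prefs_prefix n t).subset hi
  have hdom : Dominates n (R.state n t) (R.arm t) (R.rew t) i := by
    refine ⟨⟨hi, fun hio => ?_⟩, fun l hli hl => ?_⟩
    · exact h.not_mem_occ_of_stable hs hN (by omega) ht (occMid_subset_explore_occ _ _ _ _ hio)
    · rcases h.mem_occ_or_dominated hs hli hN with h1 | h1
      · exact absurd (occ_subset_occMid _ _ _ _ (R.occ_mono n hst h1)) hl.2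
      · exact h1 (t + 1) (by omega) ht
  rw [state_succ]
  rcases explore_prefs_cases n (R.state n t) (R.arm t) (R.rew t) with ⟨-, e⟩ | ⟨d, hd, e⟩
  · exact absurd hdom (e i)
  · rw [e]
    by_cases hdi : d = i
    · simp [hdi]
    · have h1 := hdom.2 d hdi hd.1
      have h2 := hd.2 i (Ne.symm hdi) hdom.1
      rw [← state_succ] at h1 h2
      linarith [h.rinf_le_rsup i (t + 1), h.rinf_le_rsup d (t + 1)]

/-- The player cannot skip `i`: skipped arms are in Occupied, which by soundness contains no free
arm. -/
lemma pos_le_of_stable (hN : s + 4 * (8 * K * m) ≤ N) {t q : ℕ} (hst : s ≤ t)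
    (ht : t ≤ s + 4 * (8 * K * m)) (hq : (R.state n t).prefs[q]? = some i) :
    (R.state n t).pos ≤ q := by
  by_contra hlt
  obtain ⟨a, ha, ha'⟩ := (h.isSound (by omega : t ≤ N)).pos q (not_le.1 hlt)
  rw [hq] at ha
  cases ha
  exact h.not_mem_occ_of_stable hs hN hst ht ha'

/-- An arm standing before `i` is in Occupied already or is dominated by `i`. The position is
updated before Occupied is, hence two steps: one to declare the arm occupied and one to move past
it. -/
lemma pos_lt_pos_of_stable (hN : s + 4 * (8 * K * m) ≤ N) {t q : ℕ}
    (hst : s + 2 * (8 * K * m) ≤ t) (ht : t + 2 ≤ s + 4 * (8 * K * m))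
    (hq : (R.state n t).prefs[q]? = some i) (hlt : (R.state n t).pos < q) :
    (R.state n t).pos < (R.state n (t + 2)).pos := by
  have hlen : (R.state n t).pos < (R.state n t).prefs.length :=
    hlt.trans (List.getElem?_eq_some_iff.1 hq).1
  obtain ⟨a, ha⟩ : ∃ a, (R.state n t).prefs[(R.state n t).pos]? = some a :=
    ⟨_, List.getElem?_eq_getElem hlen⟩
  by_cases hao : a ∈ (R.state n t).occ
  · have h1 : (R.state n (t + 1)).pos = (R.state n t).pos + 1 :=
      explore_pos_of_mem _ _ _ _ ha hao
    have h2 : (R.state n (t + 1)).pos ≤ (R.state n (t + 2)).pos := R.pos_mono n (Nat.le_succ _)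
    omega
  · have h1 : (R.state n (t + 1)).pos = (R.state n t).pos := by
      refine explore_pos_of_not_mem _ _ _ _ fun b hb => ?_
      rw [ha] at hb; cases hb; exact hao
    have ha1 := R.prefs_getElem?_mono n (Nat.le_succ t) ha
    have hq1 := R.prefs_getElem?_mono n (Nat.le_succ t) hq
    have hai : a ≠ i := by
      rintro rfl
      have := (List.getElem?_inj hlen (h.isSound (by omega : t ≤ N)).nodup).1 (ha.trans hq.symm)
      omega
    have hao1 : a ∈ (R.state n (t + 1)).occ := by
      rw [state_succ, mem_explore_occ]
      refine Or.inr ⟨?_, i, Or.inr ?_, ?_⟩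
      · rw [← state_succ, h1]; exact ha1
      · rw [← state_succ, h1, List.mem_iff_getElem?]
        refine ⟨q - ((R.state n t).pos + 1), ?_⟩
        rw [List.getElem?_drop, ← hq1]
        congr 1
        omega
      · rcases h.mem_occ_or_dominated hs hai hN with h2 | h2
        · exact absurd (R.occ_mono n hst h2) hao
        · exact h2 (t + 1) (by omega) (by omega)
    have h2 : (R.state n (t + 2)).pos = (R.state n (t + 1)).pos + 1 :=
      explore_pos_of_mem _ _ _ _ (by rw [h1]; exact ha1) hao1
    omega

/-- After three windows, the player tries to occupy the best free arm. -/
lemma prefs_pos_of_stable (hN : s + 4 * (8 * K * m) ≤ N) {t : ℕ}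
    (hst : s + 3 * (8 * K * m) ≤ t) (ht : t ≤ s + 4 * (8 * K * m)) :
    (R.state n t).prefs[(R.state n t).pos]? = some i := by
  have hK := pos_K R
  have hKm : K ≤ K * m := Nat.le_mul_of_pos_right K hs.one_le_m
  have e8 : 8 * K * m = 8 * (K * m) := by ring
  obtain ⟨q, hq⟩ := List.mem_iff_getElem?.1
    (h.mem_prefs_of_stable hs hN (le_refl (s + 2 * (8 * K * m))) (by omega))
  have hqK : q < K := by
    have h1 := (List.getElem?_eq_some_iff.1 hq).1
    have h2 := (h.isSound (by omega : s + 2 * (8 * K * m) + 1 ≤ N)).nodup.length_le_card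
    simp only [Fintype.card_fin] at h2
    omega
  -- One step to append `i` and two steps for each of at most `K` positions fit into the third
  -- window, because `1 + 2 K ≤ 8 K m`.
  have key : ∀ v, v ≤ K → min v q ≤ (R.state n (s + 2 * (8 * K * m) + 1 + 2 * v)).pos := by
    intro v
    induction v with
    | zero => intro _; omega
    | succ v ih =>
      intro hv
      have ih := ih (by omega)
      rcases lt_or_ge (R.state n (s + 2 * (8 * K * m) + 1 + 2 * v)).pos q with hlt | hge
      · have := h.pos_lt_pos_of_stable hs hN (by omega) (by omega)
          (R.prefs_getElem?_mono n (by omega) hq) hlt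
        have e : s + 2 * (8 * K * m) + 1 + 2 * (v + 1) = s + 2 * (8 * K * m) + 1 + 2 * v + 2 := by
          ring
        rw [e]
        omega
      · have := R.pos_mono n (by omega : s + 2 * (8 * K * m) + 1 + 2 * v ≤
          s + 2 * (8 * K * m) + 1 + 2 * (v + 1))
        dsimp only at this
        omega
  have hqt := R.prefs_getElem?_mono n (by omega : _ ≤ t) hq
  have h1 := h.pos_le_of_stable hs hN (by omega) ht hqt
  have h2 := key K le_rfl
  have h3 := R.pos_mono n (by omega : s + 2 * (8 * K * m) + 1 + 2 * K ≤ t)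
  dsimp only at h3
  rw [show (R.state n t).pos = q by omega]
  exact hqt

/-- The player starts exploiting the best free arm before the end of the four windows. -/
lemma exists_fixing_of_stable (hN : s + 4 * (8 * K * m) ≤ N) :
    ∃ t < N, (R.state n t).prefs[(R.state n t).pos]? = some (R.arm t) ∧ 0 < R.rew t := by
  by_contra hno
  push Not at hno
  have hw := h.window i (s + 3 * (8 * K * m)) (by omega)
  have e : s + 3 * (8 * K * m) + 8 * K * m = s + 4 * (8 * K * m) := by ring
  rw [e] at hw
  -- In the fourth window the free arm `i` is pulled at least `4 m` times while it is the arm to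
  -- occupy. Without fixation all these pulls give `0`, which is excluded since `4 m μ₀ ≥ 32 e² log
  -- n`.
  have hz := h.zeros i (s + 3 * (8 * K * m)) (s + 4 * (8 * K * m)) (by omega) hN
    (fun t h1 h2 => by rw [h.taken_eq_of_stable hs (by omega) h2.le]; exact hs.free)
    (fun t h1 h2 h3 => by
      refine le_antisymm (hno t (by omega) ?_) (h.rew_nonneg t)
      rw [h3]
      exact h.prefs_pos_of_stable hs hN h1 h2.le)
  have hμ₀ : 0 < μ₀ := hs.gap_pos.trans_le hs.gap_le
  have h1 := hs.le_m
  rw [div_le_iff₀ hμ₀] at h1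
  have h2 : (4 * m : ℝ) ≤ R.count i (s + 3 * (8 * K * m)) (s + 4 * (8 * K * m)) := by
    exact_mod_cast hw
  have h3 : (4 * m : ℝ) * μ₀ ≤
      R.count i (s + 3 * (8 * K * m)) (s + 4 * (8 * K * m)) * μ i :=
    mul_le_mul h2 hs.le_mean hμ₀.le (Nat.cast_nonneg _)
  have hE : 1 ≤ Real.exp 1 := Real.one_le_exp zero_le_one
  have h4 : Real.exp 1 * Real.log n ≤ Real.exp 1 ^ 2 * Real.log n :=
    mul_le_mul_of_nonneg_right (by nlinarith) h.log_pos.le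
  have h5 : 0 < Real.exp 1 * Real.log n := mul_pos (by linarith) h.log_pos
  linarith

omit hs in
/-- A player explores at most until the estimates are accurate, and then during four windows for
every change of the set of exploited arms. -/
theorem lt_of_explores (hm : 1 ≤ m) {s M : ℕ} (h1 : 1 ≤ s) (hΔ : 0 < Δ) (hΔ' : Δ ≤ μ₀)
    (hlm : 8 * Real.exp 1 ^ 2 * Real.log n / μ₀ ≤ m) (hr : radius K n s ≤ Δ / (8 * Real.exp 1))
    (hr1 : radius K n s ≤ 1) (hcard : ∀ t, (R.taken t).card < M)
    (hbest : ∀ A : Finset (Fin K), A.card < M →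
      ∃ i ∉ A, μ₀ ≤ μ i ∧ ∀ l, l ∉ A → l ≠ i → μ l + Δ ≤ μ i)
    (hno : ∀ t < N, ¬ ((R.state n t).prefs[(R.state n t).pos]? = some (R.arm t) ∧ 0 < R.rew t)) :
    N < s + 4 * (8 * K * m) * M := by
  by_contra hN
  -- Without fixation, the set of taken arms gains an element in each period of four windows.
  have key : ∀ v ≤ M, v ≤ (R.taken (s + 4 * (8 * K * m) * v)).card := by
    intro v
    induction v with
    | zero => intro _; omega
    | succ v ih =>
      intro hv
      have hle : 4 * (8 * K * m) * (v + 1) ≤ 4 * (8 * K * m) * M := Nat.mul_le_mul_left _ hv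
      have e : s + 4 * (8 * K * m) * (v + 1) = s + 4 * (8 * K * m) * v + 4 * (8 * K * m) := by ring
      refine (Nat.succ_le_succ (ih (by omega))).trans (Finset.card_lt_card ?_)
      refine Finset.ssubset_iff_subset_ne.2 ⟨h.taken_mono (by omega), fun heq => ?_⟩
      obtain ⟨i, hi, hi', hb⟩ := hbest _ (hcard (s + 4 * (8 * K * m) * v))
      have hle' : s ≤ s + 4 * (8 * K * m) * v := Nat.le_add_right _ _
      have hst : R.IsStable n m μ μ₀ Δ (s + 4 * (8 * K * m) * v) i :=
        ⟨hm, h1.trans hle', hΔ, hΔ', hlm, (radius_anti K n h1 hle').trans hr,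
          (radius_anti K n h1 hle').trans hr1, by rw [← e]; exact heq.symm, hi, hi', hb⟩
      obtain ⟨t, ht, ht'⟩ := h.exists_fixing_of_stable hst (by omega)
      exact hno t ht ht'
  exact absurd (key M le_rfl) (not_le.2 (hcard _))

end IsGood

end Run

end

end DynMMAB

/-! ### From the game to the runs of the single players. -/

namespace DynMMAB

noncomputable section

variable {K M : ℕ}

/-- The arms exploited by players other than `j`, when the players exploit the arms `F`. -/
def takenBy (F : Fin M → Option (Fin K)) (j : Fin M) : Finset (Fin K) :=
  Finset.univ.filter (fun k => ∃ j', j' ≠ j ∧ F j' = some k)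

/-- The exploring players of `A` other than `j`. -/
def rivals (A : Finset (Fin M)) (F : Fin M → Option (Fin K)) (j : Fin M) : Finset (Fin M) :=
  A.filter (fun j' => j' ≠ j ∧ F j' = none)

/-- The probability that no exploring player of `A` other than `j` pulls a given arm. -/
def availability (A : Finset (Fin M)) (F : Fin M → Option (Fin K)) (j : Fin M) : ℝ :=
  (1 - (K : ℝ)⁻¹) ^ (rivals A F j).card

lemma mem_takenBy {F : Fin M → Option (Fin K)} {j : Fin M} {k : Fin K} :
    k ∈ takenBy F j ↔ ∃ j', j' ≠ j ∧ F j' = some k := by simp [takenBy]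

/-- Each of the `M - 1` other players exploits at most one arm. -/
lemma card_takenBy_lt (F : Fin M → Option (Fin K)) (j : Fin M) : (takenBy F j).card < M := by
  classical
  have hsub : (takenBy F j).map ⟨some, Option.some_injective _⟩ ⊆ (Finset.univ.erase j).image F := by
    intro o ho
    simp only [Finset.mem_map, mem_takenBy] at ho
    obtain ⟨k, ⟨j', hj, hF⟩, rfl⟩ := ho
    exact Finset.mem_image.2 ⟨j', Finset.mem_erase.2 ⟨hj, Finset.mem_univ _⟩, hF⟩
  have h1 := Finset.card_le_card hsub
  rw [Finset.card_map] at h1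
  have h2 := h1.trans Finset.card_image_le
  rw [Finset.card_erase_of_mem (Finset.mem_univ _), Finset.card_univ, Fintype.card_fin] at h2
  have := j.pos
  omega

lemma card_rivals_lt (A : Finset (Fin M)) (F : Fin M → Option (Fin K)) (j : Fin M) :
    (rivals A F j).card < M := by
  have hsub : rivals A F j ⊆ Finset.univ.erase j := by
    intro j' hj'
    simp only [rivals, Finset.mem_filter] at hj'
    exact Finset.mem_erase.2 ⟨hj'.2.1, Finset.mem_univ _⟩
  have h2 := Finset.card_le_card hsub
  rw [Finset.card_erase_of_mem (Finset.mem_univ _), Finset.card_univ, Fintype.card_fin] at h2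
  have := j.pos
  omega

/-- With `k = K - 1`, `1 - 1 / K` is the inverse of `1 + 1 / k ≤ exp (1 / k)`, so it is at least
`exp (-1 / k)`, and the exponent `m` is at most `k`. -/
lemma exp_neg_one_le_pow {K m : ℕ} (hK : 1 ≤ K) (hm : m + 1 ≤ K) :
    Real.exp (-1) ≤ (1 - (K : ℝ)⁻¹) ^ m := by
  rcases Nat.eq_zero_or_pos m with rfl | hm0
  · simp
  obtain ⟨k, rfl⟩ : ∃ k, K = k + 1 := ⟨K - 1, by omega⟩
  have hk : 1 ≤ k := by omega
  have hk0 : (0 : ℝ) < k := by exact_mod_cast hk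
  have e : 1 - ((k + 1 : ℕ) : ℝ)⁻¹ = (1 + (k : ℝ)⁻¹)⁻¹ := by
    push_cast; field_simp; ring
  have h1 : (1 + (k : ℝ)⁻¹) ≤ Real.exp (k : ℝ)⁻¹ := by
    rw [add_comm]; exact Real.add_one_le_exp _
  have h2 : Real.exp (-(k : ℝ)⁻¹) ≤ 1 - ((k + 1 : ℕ) : ℝ)⁻¹ := by
    rw [e, Real.exp_neg]
    exact inv_anti₀ (by positivity) h1
  calc Real.exp (-1) = Real.exp (-(k : ℝ)⁻¹) ^ k := by
        rw [← Real.exp_nat_mul]; congr 1; field_simp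
    _ ≤ Real.exp (-(k : ℝ)⁻¹) ^ m :=
        pow_le_pow_of_le_one (Real.exp_pos _).le
          (Real.exp_le_one_iff.2 (by simp)) (by omega)
    _ ≤ _ := pow_le_pow_left₀ (Real.exp_pos _).le h2 m

lemma exp_neg_one_le_availability (hMK : M ≤ K) (A : Finset (Fin M))
    (F : Fin M → Option (Fin K)) (j : Fin M) : Real.exp (-1) ≤ availability A F j := by
  have := card_rivals_lt A F j
  exact exp_neg_one_le_pow (by omega) (by omega)

lemma availability_le_one (A : Finset (Fin M)) (F : Fin M → Option (Fin K)) (j : Fin M) :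
    availability A F j ≤ 1 := by
  refine pow_le_one₀ ?_ (by simp)
  rw [sub_nonneg]
  exact Nat.cast_inv_le_one K

lemma reward_eq_zero {A : Finset (Fin M)} {π : Fin M → Fin K} {x : Fin K → ℝ} {j j' : Fin M}
    (hj : j ∈ A) (hj' : j' ∈ A) (hne : j' ≠ j) (he : π j' = π j) : reward A π x j = 0 := by
  have : 1 < (A.filter (fun i => π i = π j)).card :=
    Finset.one_lt_card.2 ⟨j, by simp [hj], j', by simp [hj', he], hne.symm⟩
  simp [reward, collision, this]

lemma reward_eq_value {A : Finset (Fin M)} {π : Fin M → Fin K} {x : Fin K → ℝ} {j : Fin M}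
    (h : ∀ j' ∈ A, j' ≠ j → π j' ≠ π j) : reward A π x j = x (π j) := by
  have : ¬ 1 < (A.filter (fun i => π i = π j)).card := by
    rw [not_lt]
    have : Nonempty (Fin M) := ⟨j⟩
    refine Finset.card_le_one_iff_subset_singleton.2 ⟨j, fun i hi => ?_⟩
    simp only [Finset.mem_filter] at hi
    by_contra hij
    exact h i hi.1 (by simpa using hij) hi.2
  simp [reward, collision, this]

lemma reward_mem (A : Finset (Fin M)) (π : Fin M → Fin K) {x : Fin K → ℝ}
    (hx : ∀ k, 0 ≤ x k ∧ x k ≤ 1) (j : Fin M) : 0 ≤ reward A π x j ∧ reward A π x j ≤ 1 := by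
  unfold reward collision
  split_ifs
  · simp
  · simpa using hx (π j)

section Game

variable (T : ℕ) (τ : Fin M → ℕ) (x : ℕ → Fin K → ℝ) (u : ℕ → Fin M → Fin K)

/-- The arms exploited by the players before stage `s`. -/
def exploited (s : ℕ) (j : Fin M) : Option (Fin K) := (states T τ x u s j).fixed

/-- The exploration of player `j` in local time. -/
def playerRun (j : Fin M) : Run K where
  arm t := u (τ j + t) j
  rew t := stageReward T τ x u (τ j + t) j
  avail t := availability (players τ (τ j + t)) (exploited T τ x u (τ j + t)) j
  taken t := takenBy (exploited T τ x u (τ j + t)) j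

variable {T τ x u}

lemma mem_players {s : ℕ} {j : Fin M} : j ∈ players τ s ↔ τ j ≤ s := by simp [players]

lemma states_of_le {j : Fin M} {s : ℕ} (hs : s ≤ τ j) : states T τ x u s j = initState K := by
  induction s with
  | zero => rfl
  | succ s ih =>
    rw [states]
    have : j ∉ players τ s := by rw [mem_players]; omega
    simp only [this, false_and, if_false]
    exact ih (by omega)

lemma states_succ_of_exploited {j : Fin M} {s : ℕ} {k : Fin K}
    (h : exploited T τ x u s j = some k) : states T τ x u (s + 1) j = states T τ x u s j := by
  unfold exploited at h
  rw [states]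
  simp [h]

lemma states_succ_of_explores {j : Fin M} {s : ℕ} (hj : τ j ≤ s)
    (h : exploited T τ x u s j = none) : states T τ x u (s + 1) j =
      explore (T - τ j) (states T τ x u s j) (u s j) (stageReward T τ x u s j) := by
  unfold exploited at h
  simp only [states]
  rw [if_pos ⟨mem_players.2 hj, h⟩]
  simp [stageReward, pulledArm, h]

lemma exploited_mono {j : Fin M} {k : Fin K} {s t : ℕ} (hst : s ≤ t)
    (h : exploited T τ x u s j = some k) : exploited T τ x u t j = some k := by
  induction t, hst using Nat.le_induction with
  | base => exact h
  | succ t ht ih => unfold exploited; rw [states_succ_of_exploited ih]; exact ih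

lemma explores_anti {j : Fin M} {s t : ℕ} (hst : s ≤ t) (h : exploited T τ x u t j = none) :
    exploited T τ x u s j = none := by
  rw [Option.eq_none_iff_forall_ne_some]
  intro k hk
  rw [exploited_mono hst hk] at h
  exact absurd h (by simp)

lemma le_of_exploited {j : Fin M} {k : Fin K} {s : ℕ} (h : exploited T τ x u s j = some k) :
    τ j ≤ s := by
  by_contra hs
  unfold exploited at h
  rw [states_of_le (by omega)] at h
  simp [initState] at h

/-- The bridge to the analysis of a `Run`. It holds during exploration only: afterwards the state in
the game is frozen, while `Run.state` would go on updating. -/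
lemma states_eq_state {j : Fin M} {t : ℕ} (h : exploited T τ x u (τ j + t) j = none) :
    states T τ x u (τ j + t) j = (playerRun T τ x u j).state (T - τ j) t := by
  induction t with
  | zero => exact states_of_le le_rfl
  | succ t ih =>
    have h' : exploited T τ x u (τ j + t) j = none := explores_anti (by omega) h
    rw [← add_assoc, states_succ_of_explores (by omega) h', ih h', Run.state_succ]
    rfl

/-- A player that starts exploiting an arm has just observed a positive reward on it. -/
lemma of_fixing {j : Fin M} {s : ℕ} {k : Fin K} (h : exploited T τ x u s j = none)
    (h' : exploited T τ x u (s + 1) j = some k) :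
    τ j ≤ s ∧ (states T τ x u s j).prefs[(states T τ x u s j).pos]? = some k ∧ u s j = k ∧
      0 < stageReward T τ x u s j := by
  by_cases hj : τ j ≤ s
  · unfold exploited at h'
    rw [states_succ_of_explores hj h, explore_fixed] at h'
    split_ifs at h' with hc
    · cases h'
      exact ⟨hj, hc.1, rfl, hc.2⟩
    · unfold exploited at h
      rw [h] at h'
      exact absurd h' (by simp)
  · unfold exploited at h'
    rw [states_of_le (by omega)] at h'
    simp [initState] at h'

lemma not_fixing_of_explores {j : Fin M} {t : ℕ}
    (h : exploited T τ x u (τ j + (t + 1)) j = none) :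
    ¬ (((playerRun T τ x u j).state (T - τ j) t).prefs[
      ((playerRun T τ x u j).state (T - τ j) t).pos]? = some ((playerRun T τ x u j).arm t) ∧
      0 < (playerRun T τ x u j).rew t) := by
  intro hc
  have h' : exploited T τ x u (τ j + t) j = none := explores_anti (by omega) h
  unfold exploited at h
  rw [← add_assoc, states_succ_of_explores (by omega) h', explore_fixed, states_eq_state h'] at h
  change (if _ then _ else _) = none at h
  rw [if_pos (by exact hc)] at h
  exact absurd h (by simp)

lemma stageReward_eq_zero {j j' : Fin M} {s : ℕ} (hj : τ j ≤ s) (hj' : τ j' ≤ s) (hne : j' ≠ j)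
    (he : pulledArm (states T τ x u s) (u s) j' = pulledArm (states T τ x u s) (u s) j) :
    stageReward T τ x u s j = 0 :=
  reward_eq_zero (mem_players.2 hj) (mem_players.2 hj') hne he

lemma pulledArm_of_explores {j : Fin M} {s : ℕ} (h : exploited T τ x u s j = none) :
    pulledArm (states T τ x u s) (u s) j = u s j := by
  unfold exploited at h; simp [pulledArm, h]

lemma pulledArm_of_exploited {j : Fin M} {s : ℕ} {k : Fin K}
    (h : exploited T τ x u s j = some k) : pulledArm (states T τ x u s) (u s) j = k := by
  unfold exploited at h; simp [pulledArm, h]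

lemma stageReward_of_mem_takenBy {j : Fin M} {s : ℕ} (hj : τ j ≤ s)
    (h : exploited T τ x u s j = none) (hk : u s j ∈ takenBy (exploited T τ x u s) j) :
    stageReward T τ x u s j = 0 := by
  obtain ⟨j', hne, hj'⟩ := mem_takenBy.1 hk
  refine stageReward_eq_zero hj (le_of_exploited hj') hne ?_
  rw [pulledArm_of_exploited hj', pulledArm_of_explores h]

/-- All the deviations that concern player `j` are under control. -/
structure IsFavorable (T : ℕ) (τ : Fin M → ℕ) (x : ℕ → Fin K → ℝ) (u : ℕ → Fin M → Fin K)
    (μ : Fin K → ℝ) (m : ℕ) (j : Fin M) : Prop where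
  two_le : 2 ≤ T - τ j
  gain_dev : ∀ k t, 1 ≤ t → t ≤ T - τ j → radius K (T - τ j) t ≤ 1 →
    exploited T τ x u (τ j + t) j = none →
    |(playerRun T τ x u j).gain k 0 t - μ k * (playerRun T τ x u j).count k 0 t / 2 -
      μ k / K * ((playerRun T τ x u j).mass k t - t / 2)| <
      2 / 3 * (t / K) * (radius K (T - τ j) t / 2)
  lt_count : ∀ k t, 1 ≤ t → t ≤ T - τ j → radius K (T - τ j) t ≤ 1 →
    (t / K : ℝ) * (1 - 5 / 6 * (radius K (T - τ j) t / 2)) < (playerRun T τ x u j).count k 0 t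
  count_lt : ∀ k t, 1 ≤ t → t ≤ T - τ j → radius K (T - τ j) t ≤ 1 →
    ((playerRun T τ x u j).count k 0 t : ℝ) < t / K * (1 + 4 / 3 * (radius K (T - τ j) t / 2))
  window : ∀ k s, s ≤ T - τ j → 4 * m ≤ (playerRun T τ x u j).count k s (s + 8 * K * m)
  zeros : ∀ k s t, s ≤ t → t ≤ T - τ j → exploited T τ x u (τ j + t) j = none →
    (∀ i, s ≤ i → i < t → k ∉ (playerRun T τ x u j).taken i) →
    (∀ i, s ≤ i → i < t → (playerRun T τ x u j).arm i = k → (playerRun T τ x u j).rew i = 0) →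
    (playerRun T τ x u j).count k s t * μ k < 2 * Real.exp 1 * Real.log (T - τ j : ℕ)

/-- In `IsFavorable`, conditions on the rewards are asked only while the player explores, because
later rewards do not come from her samples. Conditions on the counts concern the samples alone and
need no such restriction. -/
lemma IsFavorable.isGood {μ : Fin K → ℝ} {m : ℕ} {j : Fin M} (h : IsFavorable T τ x u μ m j)
    (hMK : M ≤ K) (hμ : ∀ k, 0 ≤ μ k ∧ μ k ≤ 1) (hx : ∀ s k, 0 ≤ x s k ∧ x s k ≤ 1) {N : ℕ}
    (hN : N ≤ T - τ j) (hE : exploited T τ x u (τ j + N) j = none) :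
    (playerRun T τ x u j).IsGood (T - τ j) m μ N where
  two_le := h.two_le
  mean_nonneg := fun k => (hμ k).1
  mean_le_one := fun k => (hμ k).2
  rew_nonneg := fun t => (reward_mem _ _ (hx _) j).1
  rew_le_one := fun t => (reward_mem _ _ (hx _) j).2
  le_avail := fun t => exp_neg_one_le_availability hMK _ _ j
  avail_le_one := fun t => availability_le_one _ _ j
  taken_mono := by
    intro s t hst k hk
    obtain ⟨j', hne, hj'⟩ := mem_takenBy.1 hk
    exact mem_takenBy.2 ⟨j', hne, exploited_mono (by omega) hj'⟩
  rew_of_taken := fun t ht hk =>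
    stageReward_of_mem_takenBy (by omega) (explores_anti (by omega) hE) hk
  gain_dev := fun k t h1 h2 h3 =>
    h.gain_dev k t h1 (h2.trans hN) h3 (explores_anti (by omega) hE)
  lt_count := fun k t h1 h2 => h.lt_count k t h1 (h2.trans hN)
  count_lt := fun k t h1 h2 => h.count_lt k t h1 (h2.trans hN)
  window := fun k s h1 => h.window k s (h1.trans hN)
  zeros := fun k s t h1 h2 =>
    h.zeros k s t h1 (h2.trans hN) (explores_anti (by omega) hE)

/-- The exploited arms are distinct, exploited by players in the game, and every arm that is better
than an exploited arm is exploited. -/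
structure IsWellPlaced (μ : Fin K → ℝ) (A : Finset (Fin M)) (F : Fin M → Option (Fin K)) :
    Prop where
  mem : ∀ j k, F j = some k → j ∈ A
  inj : ∀ j j' k, F j = some k → F j' = some k → j = j'
  better : ∀ j k l, F j = some k → μ k < μ l → ∃ j', F j' = some l

/-- Fixation needs a positive reward, so two players cannot fix on the same arm: at the same stage
they collide, and later the second one collides with the first. When a player fixes on `k`,
`mem_taken_of_better` shows that the better arms are exploited already, and exploitation lasts
forever. -/
theorem isWellPlaced {μ : Fin K → ℝ} {m : Fin M → ℕ} (hMK : M ≤ K)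
    (hμ : ∀ k, 0 ≤ μ k ∧ μ k ≤ 1) (hx : ∀ s k, 0 ≤ x s k ∧ x s k ≤ 1) {s : ℕ} (hs : s ≤ T)
    (h : ∀ j, τ j ≤ s → IsFavorable T τ x u μ (m j) j) :
    IsWellPlaced μ (players τ s) (exploited T τ x u s) := by
  refine ⟨fun j k hk => mem_players.2 (le_of_exploited hk), ?_, ?_⟩
  · clear h hs
    induction s with
    | zero => intro j j' k hj; simp [exploited, states, initState] at hj
    | succ s ih =>
      have key : ∀ j j' k, exploited T τ x u s j = none → exploited T τ x u (s + 1) j = some k →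
          exploited T τ x u (s + 1) j' = some k → j = j' := by
        intro j j' k h0 hj hj'
        by_contra hne
        obtain ⟨h1, -, h2, h3⟩ := of_fixing h0 hj
        refine h3.ne' ?_
        rcases h0' : exploited T τ x u s j' with _ | k'
        · obtain ⟨h1', -, h2', -⟩ := of_fixing h0' hj'
          refine stageReward_eq_zero h1 h1' (Ne.symm hne) ?_
          rw [pulledArm_of_explores h0, pulledArm_of_explores h0', h2, h2']
        · rw [exploited_mono (Nat.le_succ s) h0'] at hj'
          cases hj'
          exact stageReward_of_mem_takenBy h1 h0 (mem_takenBy.2 ⟨j', Ne.symm hne, h2 ▸ h0'⟩)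
      intro j j' k hj hj'
      rcases h0 : exploited T τ x u s j with _ | l
      · exact key j j' k h0 hj hj'
      · rcases h0' : exploited T τ x u s j' with _ | l'
        · exact (key j' j k h0' hj' hj).symm
        · rw [exploited_mono (Nat.le_succ s) h0] at hj
          rw [exploited_mono (Nat.le_succ s) h0'] at hj'
          cases hj; cases hj'
          exact ih j j' k h0 h0'
  · induction s with
    | zero => intro j k l hj; simp [exploited, states, initState] at hj
    | succ s ih =>
      intro j k l hj hkl
      rcases h0 : exploited T τ x u s j with _ | k'
      · obtain ⟨h1, h2, -, -⟩ := of_fixing h0 hj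
        obtain ⟨t, rfl⟩ := Nat.exists_eq_add_of_le h1
        have hg := (h j (by omega)).isGood hMK hμ hx (N := t) (by omega) h0
        rw [states_eq_state h0] at h2
        obtain ⟨j', -, hj'⟩ := mem_takenBy.1 (hg.mem_taken_of_better le_rfl h2 hkl)
        exact ⟨j', exploited_mono (Nat.le_succ _) hj'⟩
      · rw [exploited_mono (Nat.le_succ s) h0] at hj
        cases hj
        obtain ⟨j', hj'⟩ := ih (by omega) (fun j hj => h j (by omega)) j k l h0 hkl
        exact ⟨j', exploited_mono (Nat.le_succ _) hj'⟩

end Game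

end

end DynMMAB

/-! ### Order statistics: the best free arm and optimal sets of arms. -/

namespace DynMMAB

noncomputable section

section OrderStat

variable {K : ℕ} (μ : Fin K → ℝ)

lemma orderStat_succ {n : ℕ} (h : n < K) :
    orderStat μ (n + 1) = μ (Tuple.sort (fun i => -μ i) ⟨n, h⟩) := by
  unfold orderStat
  rw [dif_pos ⟨by omega, by omega⟩]
  rfl

lemma orderStat_of_lt {n : ℕ} (h : K < n) : orderStat μ n = 0 := by
  unfold orderStat
  rw [dif_neg (by omega)]

variable {μ}

lemma orderStat_nonneg (hμ : ∀ k, 0 ≤ μ k) (n : ℕ) : 0 ≤ orderStat μ n := by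
  unfold orderStat
  split_ifs
  · exact hμ _
  · exact le_rfl

lemma orderStat_le_one (hμ : ∀ k, μ k ≤ 1) (n : ℕ) : orderStat μ n ≤ 1 := by
  unfold orderStat
  split_ifs
  · exact hμ _
  · exact zero_le_one

lemma orderStat_anti (hμ : ∀ k, 0 ≤ μ k) {m n : ℕ} (hm : 1 ≤ m) (h : m ≤ n) :
    orderStat μ n ≤ orderStat μ m := by
  rcases lt_or_ge K n with hn | hn
  · rw [orderStat_of_lt μ hn]; exact orderStat_nonneg hμ m
  · obtain ⟨m, rfl⟩ := Nat.exists_eq_add_of_le' hm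
    obtain ⟨n, rfl⟩ := Nat.exists_eq_add_of_le' (hm.trans h)
    rw [orderStat_succ μ (by omega : m < K), orderStat_succ μ (by omega : n < K)]
    have := Tuple.monotone_sort (fun i => -μ i) (a := ⟨m, by omega⟩) (b := ⟨n, by omega⟩)
      (by simpa using h)
    simpa using this

lemma minGap_le {M n : ℕ} (hn : n < M) :
    minGap μ M ≤ orderStat μ (n + 1) - orderStat μ (n + 2) :=
  ciInf_le (Set.finite_range _).bddBelow (⟨n, hn⟩ : Fin M)

lemma minGap_le_orderStat (hμ : ∀ k, 0 ≤ μ k) {M : ℕ} (hM : 1 ≤ M) :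
    minGap μ M ≤ orderStat μ M := by
  obtain ⟨m, rfl⟩ := Nat.exists_eq_add_of_le' hM
  have := minGap_le (μ := μ) (Nat.lt_succ_self m)
  linarith [orderStat_nonneg hμ (m + 2)]

/-- The best arm outside of a set of fewer than `M` arms is one of the `M` best arms, and is
separated from the other arms outside of the set. -/
lemma exists_best_not_mem (hμ : ∀ k, 0 ≤ μ k) {M : ℕ} (hMK : M ≤ K) (A : Finset (Fin K))
    (hA : A.card < M) :
    ∃ i ∉ A, orderStat μ M ≤ μ i ∧ ∀ l, l ∉ A → l ≠ i → μ l + minGap μ M ≤ μ i := by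
  set σ := Tuple.sort (fun i => -μ i) with hσ
  -- Fewer than `M` arms cannot cover the `M` best ranks. The first rank `p` that is missed gives
  -- `i`, and every other arm outside of `A` has a rank beyond `p`, hence lies below the gap at `p <
  -- M`.
  have hex : ∃ p, ∃ hp : p < M, σ ⟨p, by omega⟩ ∉ A := by
    by_contra hno
    push Not at hno
    have hsub : Finset.univ.map (⟨fun p : Fin M => σ (Fin.castLE hMK p),
        σ.injective.comp (Fin.castLE_injective hMK)⟩ : Fin M ↪ Fin K) ⊆ A := by
      intro a ha
      simp only [Finset.mem_map, Finset.mem_univ, true_and, Function.Embedding.coeFn_mk] at ha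
      obtain ⟨p, rfl⟩ := ha
      exact hno p p.2
    have := Finset.card_le_card hsub
    simp only [Finset.card_map, Finset.card_univ, Fintype.card_fin] at this
    omega
  classical
  obtain ⟨hp, hpA⟩ := Nat.find_spec hex
  have hmin : ∀ q, q < Nat.find hex → ∀ hq : q < K, σ ⟨q, hq⟩ ∈ A := by
    intro q hq hqK
    have := Nat.find_min hex hq
    push Not at this
    exact this (by omega)
  generalize Nat.find hex = p at hp hpA hmin
  refine ⟨_, hpA, ?_, fun l hl hli => ?_⟩
  · rw [hσ, ← orderStat_succ μ (by omega : p < K)]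
    exact orderStat_anti hμ (by omega) (by omega)
  · obtain ⟨q, rfl⟩ := σ.surjective l
    have hqp : p < (q : ℕ) := by
      rcases lt_trichotomy (q : ℕ) p with h1 | h1 | h1
      · exact absurd (hmin q h1 q.2) hl
      · subst h1; exact absurd rfl hli
      · exact h1
    have e1 : μ (σ ⟨p, by omega⟩) = orderStat μ (p + 1) := (orderStat_succ μ _).symm
    have e2 : μ (σ q) = orderStat μ (q + 1) := (orderStat_succ μ q.2).symm
    have h1 := minGap_le (μ := μ) hp
    have h2 := orderStat_anti hμ (by omega : 1 ≤ p + 2) (by omega : p + 2 ≤ (q : ℕ) + 1)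
    rw [e1, e2]
    linarith

/-- A set of arms that contains all the arms better than one of its elements is optimal. -/
lemma sum_orderStat_le {A : Finset (Fin K)} (hA : ∀ k ∈ A, ∀ l, μ k < μ l → l ∈ A) :
    ∑ n ∈ Finset.Icc 1 A.card, orderStat μ n ≤ ∑ k ∈ A, μ k := by
  classical
  have hAK : A.card ≤ K := by simpa using A.card_le_univ
  set σ := Tuple.sort (fun i => -μ i) with hσ
  set e : Fin A.card ↪ Fin K := ⟨fun p => σ (Fin.castLE hAK p),
        σ.injective.comp (Fin.castLE_injective hAK)⟩ with he
  set B : Finset (Fin K) := Finset.univ.map e with hB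
  have hBc : B.card = A.card := by simp [hB]
  have hsum : ∑ n ∈ Finset.Icc 1 A.card, orderStat μ n = ∑ k ∈ B, μ k := by
    rw [hB, Finset.sum_map, ← Finset.Ico_succ_right_eq_Icc, Finset.sum_Ico_eq_sum_range,
      Finset.sum_range]
    simp only [Nat.succ_eq_succ, Nat.succ_eq_add_one]
    refine Finset.sum_congr rfl fun p _ => ?_
    rw [add_comm 1, orderStat_succ μ (p.2.trans_le hAK)]
    rfl
  -- Exchange argument against the set `B` of the best arms: `B \ A` and `A \ B` have the same
  -- cardinality, and an arm of `B \ A` that were better than one of `A \ B` would belong to `A`.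
  rw [hsum, ← Finset.sum_sdiff_le_sum_sdiff]
  have hc : (B \ A).card = (A \ B).card := Finset.card_sdiff_comm hBc
  have hle : ∀ l ∈ B \ A, ∀ k ∈ A \ B, μ l ≤ μ k := by
    intro l hl k hk
    rw [Finset.mem_sdiff] at hl hk
    by_contra hlt
    exact hl.2 (hA k hk.1 l (not_le.1 hlt))
  rcases (A \ B).eq_empty_or_nonempty with h0 | h0
  · rw [h0] at hc ⊢
    rw [Finset.card_empty, Finset.card_eq_zero] at hc
    rw [hc]
  · obtain ⟨k, hk, hmin⟩ := Finset.exists_min_image (A \ B) μ h0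
    calc ∑ l ∈ B \ A, μ l ≤ (B \ A).card • μ k := Finset.sum_le_card_nsmul _ _ _ fun l hl =>
          hle l hl k hk
      _ = (A \ B).card • μ k := by rw [hc]
      _ ≤ _ := Finset.card_nsmul_le_sum _ _ _ hmin

end OrderStat

/-! ### Explicit bounds for the exploration time. -/

section ExplorationTime

variable {K M : ℕ} {T : ℕ} {τ : Fin M → ℕ} {x : ℕ → Fin K → ℝ} {u : ℕ → Fin M → Fin K}

/-- The number of pulls that a free arm needs to show a positive reward. -/
def blockBound (n : ℕ) (μ₀ : ℝ) : ℕ := ⌈8 * Real.exp 1 ^ 2 * Real.log n / μ₀⌉₊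

/-- The time after which the estimates of the means separate the best arms. -/
def accurateTime (K n : ℕ) (Δ : ℝ) : ℕ := ⌈1536 * Real.exp 1 ^ 2 * K * Real.log n / Δ ^ 2⌉₊ + 1

lemma radius_accurateTime_le (K n : ℕ) {Δ : ℝ} (hΔ : 0 < Δ) :
    radius K n (accurateTime K n Δ) ≤ Δ / (8 * Real.exp 1) := by
  have hE := Real.exp_pos 1
  have h1 : 1536 * Real.exp 1 ^ 2 * K * Real.log n / Δ ^ 2 ≤ (accurateTime K n Δ : ℝ) := by
    unfold accurateTime
    push_cast
    linarith [Nat.le_ceil (1536 * Real.exp 1 ^ 2 * K * Real.log n / Δ ^ 2)]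
  have h2 : (0 : ℝ) < (accurateTime K n Δ : ℝ) := by unfold accurateTime; positivity
  unfold radius
  -- Here `1536 = 6 · 16²`.
  have h3 : Real.sqrt (6 * K * Real.log n / (accurateTime K n Δ : ℝ)) ≤
      Δ / (16 * Real.exp 1) := by
    rw [Real.sqrt_le_left (by positivity), div_pow, div_le_div_iff₀ h2 (by positivity)]
    rw [div_le_iff₀ (by positivity)] at h1
    linarith
  calc _ ≤ 2 * (Δ / (16 * Real.exp 1)) := by linarith
    _ = _ := by field_simp; ring

/-- A player whose deviations are under control explores for a short time. -/
theorem card_explores_le {μ : Fin K → ℝ} {j : Fin M} (hM : 1 ≤ M) (hMK : M ≤ K)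
    (hμ : ∀ k, 0 ≤ μ k ∧ μ k ≤ 1) (hx : ∀ s k, 0 ≤ x s k ∧ x s k ≤ 1) (hΔ : 0 < minGap μ M)
    (h : IsFavorable T τ x u μ (blockBound (T - τ j) (orderStat μ M)) j) :
    ((Finset.range T).filter (fun s => τ j ≤ s ∧ exploited T τ x u s j = none)).card ≤
      accurateTime K (T - τ j) (minGap μ M) +
        4 * (8 * K * blockBound (T - τ j) (orderStat μ M)) * M := by
  set n := T - τ j with hn
  set m := blockBound n (orderStat μ M) with hm
  set s₀ := accurateTime K n (minGap μ M) with hs₀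
  have hμ0 : ∀ k, 0 ≤ μ k := fun k => (hμ k).1
  have hle := minGap_le_orderStat hμ0 hM
  have hμ₀ : 0 < orderStat μ M := hΔ.trans_le hle
  have hlog : 0 < Real.log n := Real.log_pos (by exact_mod_cast h.two_le)
  have hr := radius_accurateTime_le K n hΔ
  have hE : 1 ≤ Real.exp 1 := Real.one_le_exp zero_le_one
  have hr1 : radius K n s₀ ≤ 1 := by
    refine hr.trans ?_
    rw [div_le_one (by positivity)]
    linarith [orderStat_le_one (fun k => (hμ k).2) M]
  have hsub : (Finset.range T).filter (fun s => τ j ≤ s ∧ exploited T τ x u s j = none) ⊆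
      Finset.Ico (τ j) (τ j + (s₀ + 4 * (8 * K * m) * M)) := by
    intro s hs
    simp only [Finset.mem_filter, Finset.mem_range] at hs
    obtain ⟨hsT, hjs, hE⟩ := hs
    obtain ⟨N, rfl⟩ := Nat.exists_eq_add_of_le hjs
    have hg := h.isGood hMK hμ hx (by omega) hE
    have := hg.lt_of_explores (μ₀ := orderStat μ M) (Δ := minGap μ M) (s := s₀) (M := M)
      (Nat.ceil_pos.2 (by positivity)) (by simp [hs₀, accurateTime]) hΔ hle
      (Nat.le_ceil _) hr hr1 (fun t => card_takenBy_lt _ _) (exists_best_not_mem hμ0 hMK)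
      (fun t ht => not_fixing_of_explores (explores_anti (by omega) hE))
    rw [Finset.mem_Ico]
    omega
  have := Finset.card_le_card hsub
  rw [Nat.card_Ico] at this
  omega

/-- Bookkeeping with `e² ≤ 8`. The units added by the ceilings are absorbed because `log T ≥ 1 / 2`
for `T ≥ 2`, while `μ₀` and `Δ` are at most `1`. This gives `1536 · 8 + 4 ≤ 12300` and `4 · 8 · (64
+ 2) = 2112`. -/
lemma exploration_bound_le {n : ℕ} {μ₀ Δ : ℝ} (hM : 1 ≤ M) (hMK : M ≤ K) (hn : 1 ≤ n)
    (hnT : n ≤ T) (hT : 2 ≤ T) (hΔ : 0 < Δ) (hle : Δ ≤ μ₀) (hμ₀ : μ₀ ≤ 1) :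
    ((accurateTime K n Δ + 4 * (8 * K * blockBound n μ₀) * M : ℕ) : ℝ) ≤
      12300 * (M * K * Real.log T / μ₀ + K * Real.log T / Δ ^ 2) := by
  have hK : (1 : ℝ) ≤ K := by exact_mod_cast hM.trans hMK
  have hM' : (1 : ℝ) ≤ M := by exact_mod_cast hM
  have hE2 : Real.exp 1 ^ 2 ≤ 8 := by
    have := Real.exp_one_lt_d9
    have := Real.exp_pos 1
    nlinarith
  have hln : 0 ≤ Real.log n := Real.log_natCast_nonneg n
  have hlog : Real.log n ≤ Real.log T :=
    Real.log_le_log (by exact_mod_cast hn) (by exact_mod_cast hnT)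
  have hlT : 1 / 2 ≤ Real.log T := by
    have h1 := Real.log_two_gt_d9
    have h2 : Real.log 2 ≤ Real.log T := Real.log_le_log (by norm_num) (by exact_mod_cast hT)
    linarith
  have hμ0 : 0 < μ₀ := hΔ.trans_le hle
  have hL : Real.log T ≤ Real.log T / μ₀ := le_div_self (by linarith) hμ0 hμ₀
  have hL' : Real.log T ≤ Real.log T / Δ ^ 2 :=
    le_div_self (by linarith) (by positivity) (pow_le_one₀ hΔ.le (hle.trans hμ₀))
  have h1 : (accurateTime K n Δ : ℝ) ≤ 12300 * (K * (Real.log T / Δ ^ 2)) := by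
    unfold accurateTime
    push_cast
    have hc := (Nat.ceil_lt_add_one (a := 1536 * Real.exp 1 ^ 2 * K * Real.log n / Δ ^ 2)
      (by positivity)).le
    have h2 : 1536 * Real.exp 1 ^ 2 * K * Real.log n / Δ ^ 2 ≤
        12288 * (K * (Real.log T / Δ ^ 2)) := by
      have : 1536 * Real.exp 1 ^ 2 * K * Real.log n / Δ ^ 2 =
        1536 * Real.exp 1 ^ 2 * (K * (Real.log n / Δ ^ 2)) := by ring
      rw [this]
      have h3 : K * (Real.log n / Δ ^ 2) ≤ K * (Real.log T / Δ ^ 2) := by gcongr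
      have h4 : 0 ≤ K * (Real.log n / Δ ^ 2) := by positivity
      nlinarith
    have h3 : 1 / 2 ≤ K * (Real.log T / Δ ^ 2) := by nlinarith
    linarith
  have h2 : (blockBound n μ₀ : ℝ) ≤ 66 * (Real.log T / μ₀) := by
    unfold blockBound
    have hc := (Nat.ceil_lt_add_one (a := 8 * Real.exp 1 ^ 2 * Real.log n / μ₀)
      (by positivity)).le
    have h2 : 8 * Real.exp 1 ^ 2 * Real.log n / μ₀ ≤ 64 * (Real.log T / μ₀) := by
      have : 8 * Real.exp 1 ^ 2 * Real.log n / μ₀ = 8 * Real.exp 1 ^ 2 * (Real.log n / μ₀) := by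
        ring
      rw [this]
      have h3 : Real.log n / μ₀ ≤ Real.log T / μ₀ := by gcongr
      have h4 : 0 ≤ Real.log n / μ₀ := by positivity
      nlinarith
    linarith
  push_cast
  have h3 : 4 * (8 * (K : ℝ) * blockBound n μ₀) * M ≤ 2112 * (M * K * (Real.log T / μ₀)) := by
    have h5 : (0 : ℝ) ≤ K * M := by positivity
    have := mul_le_mul_of_nonneg_left h2 h5
    linarith
  have h4 : 0 ≤ M * K * (Real.log T / μ₀) := by
    have : 0 ≤ Real.log T := by linarith
    positivity
  rw [mul_div_assoc, mul_div_assoc]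
  linarith

end ExplorationTime

end

end DynMMAB

namespace DynMMAB

noncomputable section

/-! ### Measurability of the states -/

section Measurability

variable {K M : ℕ}

instance : MeasurableSpace (List (Fin K)) := ⊤

instance : DiscreteMeasurableSpace (List (Fin K)) := ⟨fun _ => trivial⟩

instance : MeasurableSpace (Option (Fin K)) := ⊤

instance : DiscreteMeasurableSpace (Option (Fin K)) := ⟨fun _ => trivial⟩

/-- The memory of a player as a tuple of its discrete and of its numerical components. -/
def PlayerState.toTuple (st : PlayerState K) :
    (ℕ × ℕ × Option (Fin K) × List (Fin K) × Finset (Fin K)) ×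
      ((Fin K → ℕ) × (Fin K → ℕ)) × ((Fin K → ℝ) × (Fin K → ℝ)) × (Fin K → ℝ≥0∞) ×
      ((Fin K → ℝ) × (Fin K → ℝ)) :=
  ((st.time, st.pos, st.fixed, st.prefs, st.occ), (st.pulls, st.pullsTemp), (st.sum, st.sumTemp),
    st.len, (st.rinf, st.rsup))

instance : MeasurableSpace (PlayerState K) := MeasurableSpace.comap PlayerState.toTuple inferInstance

lemma measurable_toTuple : Measurable (PlayerState.toTuple (K := K)) := comap_measurable _

lemma measurable_time : Measurable (PlayerState.time (K := K)) := measurable_toTuple.fst.fst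

lemma measurable_pos : Measurable (PlayerState.pos (K := K)) := measurable_toTuple.fst.snd.fst

lemma measurable_fixed : Measurable (PlayerState.fixed (K := K)) :=
  measurable_toTuple.fst.snd.snd.fst

lemma measurable_prefs : Measurable (PlayerState.prefs (K := K)) :=
  measurable_toTuple.fst.snd.snd.snd.fst

lemma measurable_occ : Measurable (PlayerState.occ (K := K)) :=
  measurable_toTuple.fst.snd.snd.snd.snd

lemma measurable_pulls : Measurable (PlayerState.pulls (K := K)) := measurable_toTuple.snd.fst.fst

lemma measurable_pullsTemp : Measurable (PlayerState.pullsTemp (K := K)) :=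
  measurable_toTuple.snd.fst.snd

lemma measurable_sum : Measurable (PlayerState.sum (K := K)) := measurable_toTuple.snd.snd.fst.fst

lemma measurable_sumTemp : Measurable (PlayerState.sumTemp (K := K)) :=
  measurable_toTuple.snd.snd.fst.snd

lemma measurable_len : Measurable (PlayerState.len (K := K)) := measurable_toTuple.snd.snd.snd.fst

lemma measurable_rinf : Measurable (PlayerState.rinf (K := K)) :=
  measurable_toTuple.snd.snd.snd.snd.fst

lemma measurable_rsup : Measurable (PlayerState.rsup (K := K)) :=
  measurable_toTuple.snd.snd.snd.snd.snd

lemma measurable_update_of_measurable {α β : Type*} [MeasurableSpace α] [MeasurableSpace β]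
    {f : α → Fin K → β} {g : α → β} (hf : Measurable f) (hg : Measurable g) (k : Fin K) :
    Measurable fun a => Function.update (f a) k (g a) := by
  refine measurable_pi_lambda _ fun i => ?_
  by_cases h : i = k
  · subst h; simpa using hg
  · simpa [h, Function.comp_def] using (measurable_pi_apply i).comp hf

lemma measurable_blockLength (n : ℕ) : Measurable (blockLength n) := by
  unfold blockLength
  refine Measurable.ite (measurableSet_singleton 0) measurable_const ?_
  exact (measurable_const.div measurable_id).ennreal_ofReal

section ExploreFixedArm

variable (n : ℕ) (k : Fin K)

lemma measurable_explore_pulls : Measurable fun p : PlayerState K × ℝ =>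
    (explore n p.1 k p.2).pulls := by
  simp only [explore_pulls]
  have h : Measurable fun p : PlayerState K × ℝ => p.1.pulls :=
    measurable_pulls.comp measurable_fst
  exact measurable_update_of_measurable h
    ((measurable_of_countable (fun m : ℕ => m + 1)).comp ((measurable_pi_apply k).comp h)) k

lemma measurable_explore_sum : Measurable fun p : PlayerState K × ℝ =>
    (explore n p.1 k p.2).sum := by
  simp only [explore_sum]
  have h : Measurable fun p : PlayerState K × ℝ => p.1.sum :=
    measurable_sum.comp measurable_fst
  exact measurable_update_of_measurable h (((measurable_pi_apply k).comp h).add measurable_snd) k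

lemma measurable_explore_radius : Measurable fun p : PlayerState K × ℝ =>
    radius K n (p.1.time + 1) :=
  (measurable_of_countable (fun m : ℕ => radius K n (m + 1))).comp
    (measurable_time.comp measurable_fst)

lemma measurable_explore_mean (i : Fin K) : Measurable fun p : PlayerState K × ℝ =>
    (explore n p.1 k p.2).sum i / (explore n p.1 k p.2).pulls i :=
  ((measurable_pi_apply i).comp (measurable_explore_sum n k)).div
    ((measurable_of_countable (fun m : ℕ => (m : ℝ))).comp
      ((measurable_pi_apply i).comp (measurable_explore_pulls n k)))

lemma measurableSet_explore_pulls_eq_zero (i : Fin K) :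
    MeasurableSet {p : PlayerState K × ℝ | (explore n p.1 k p.2).pulls i = 0} :=
  ((measurable_pi_apply i).comp (measurable_explore_pulls n k)) (measurableSet_singleton 0)

lemma measurable_explore_rinf : Measurable fun p : PlayerState K × ℝ =>
    (explore n p.1 k p.2).rinf := by
  refine measurable_pi_lambda _ fun i => ?_
  simp only [explore_rinf]
  refine Measurable.ite (measurableSet_explore_pulls_eq_zero n k i)
    ((measurable_pi_apply i).comp (measurable_rinf.comp measurable_fst)) ?_
  exact ((measurable_explore_mean n k i).sub (measurable_explore_radius n)).max measurable_const

lemma measurable_explore_rsup : Measurable fun p : PlayerState K × ℝ =>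
    (explore n p.1 k p.2).rsup := by
  refine measurable_pi_lambda _ fun i => ?_
  simp only [explore_rsup]
  refine Measurable.ite (measurableSet_explore_pulls_eq_zero n k i)
    ((measurable_pi_apply i).comp (measurable_rsup.comp measurable_fst)) ?_
  exact ((measurable_explore_mean n k i).add (measurable_explore_radius n)).min measurable_const

lemma measurable_explore_len : Measurable fun p : PlayerState K × ℝ =>
    (explore n p.1 k p.2).len := by
  simp only [explore_len]
  have h : Measurable fun p : PlayerState K × ℝ => p.1.len :=
    measurable_len.comp measurable_fst
  refine measurable_update_of_measurable h (Measurable.min ?_ ((measurable_pi_apply k).comp h)) k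
  exact (measurable_blockLength n).comp
    ((measurable_pi_apply k).comp (measurable_explore_rinf n k))

lemma measurableSet_blockEnds :
    MeasurableSet {p : PlayerState K × ℝ | BlockEnds n p.1 k p.2} := by
  unfold BlockEnds
  refine measurableSet_le ((measurable_pi_apply k).comp (measurable_explore_len n k)) ?_
  exact (measurable_of_countable (fun m : ℕ => ((m + 1 : ℕ) : ℝ≥0∞))).comp
    ((measurable_pi_apply k).comp (measurable_pullsTemp.comp measurable_fst))

lemma measurable_explore_pullsTemp : Measurable fun p : PlayerState K × ℝ =>
    (explore n p.1 k p.2).pullsTemp := by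
  classical
  have h : Measurable fun p : PlayerState K × ℝ => p.1.pullsTemp :=
    measurable_pullsTemp.comp measurable_fst
  have e : (fun p : PlayerState K × ℝ => (explore n p.1 k p.2).pullsTemp) = fun p =>
      if BlockEnds n p.1 k p.2 then Function.update p.1.pullsTemp k 0
      else Function.update p.1.pullsTemp k (p.1.pullsTemp k + 1) := by
    funext p
    split_ifs with hb
    · exact explore_pullsTemp_of_ends _ _ _ _ hb
    · exact explore_pullsTemp_of_not_ends _ _ _ _ hb
  rw [e]
  refine Measurable.ite (measurableSet_blockEnds n k)
    (measurable_update_of_measurable h measurable_const k)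
    (measurable_update_of_measurable h ?_ k)
  exact (measurable_of_countable (fun m : ℕ => m + 1)).comp ((measurable_pi_apply k).comp h)

lemma measurable_sumTemp_add : Measurable fun p : PlayerState K × ℝ => p.1.sumTemp k + p.2 :=
  ((measurable_pi_apply k).comp (measurable_sumTemp.comp measurable_fst)).add measurable_snd

lemma measurable_explore_sumTemp : Measurable fun p : PlayerState K × ℝ =>
    (explore n p.1 k p.2).sumTemp := by
  classical
  have h : Measurable fun p : PlayerState K × ℝ => p.1.sumTemp :=
    measurable_sumTemp.comp measurable_fst
  have e : (fun p : PlayerState K × ℝ => (explore n p.1 k p.2).sumTemp) = fun p =>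
      if BlockEnds n p.1 k p.2 then Function.update p.1.sumTemp k 0
      else Function.update p.1.sumTemp k (p.1.sumTemp k + p.2) := by
    funext p
    split_ifs with hb
    · exact explore_sumTemp_of_ends _ _ _ _ hb
    · exact explore_sumTemp_of_not_ends _ _ _ _ hb
  rw [e]
  exact Measurable.ite (measurableSet_blockEnds n k)
    (measurable_update_of_measurable h measurable_const k)
    (measurable_update_of_measurable h (measurable_sumTemp_add k) k)

lemma measurable_explore_pos : Measurable fun p : PlayerState K × ℝ =>
    (explore n p.1 k p.2).pos := by
  classical
  exact (Measurable.of_discrete (f := fun q : List (Fin K) × ℕ × Finset (Fin K) =>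
    if ∃ i ∈ q.1[q.2.1]?, i ∈ q.2.2 then q.2.1 + 1 else q.2.1)).comp
    ((measurable_prefs.prodMk (measurable_pos.prodMk measurable_occ)).comp measurable_fst)

lemma measurable_explore_fixed : Measurable fun p : PlayerState K × ℝ =>
    (explore n p.1 k p.2).fixed := by
  classical
  simp only [explore_fixed]
  have h : Measurable fun p : PlayerState K × ℝ => (0 < p.2 : Prop) :=
    measurableSet_setOfPred.1 (measurableSet_lt measurable_const measurable_snd)
  have h' := (Measurable.of_discrete (f := fun q : (List (Fin K) × ℕ × Option (Fin K)) × Prop =>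
    if q.1.1[q.1.2.1]? = some k ∧ q.2 then some k else q.1.2.2)).comp
    (((measurable_prefs.prodMk (measurable_pos.prodMk measurable_fixed)).comp
      measurable_fst).prodMk h)
  convert h' using 1
  funext p
  simp only [Function.comp]

lemma measurable_occMid : Measurable fun p : PlayerState K × ℝ => occMid n p.1 k p.2 := by
  classical
  unfold occMid
  have h : Measurable fun p : PlayerState K × ℝ => p.1.occ :=
    measurable_occ.comp measurable_fst
  refine Measurable.ite ((measurableSet_blockEnds n k).inter
    ((measurable_sumTemp_add k) (measurableSet_singleton 0))) ?_ h
  exact (Measurable.of_discrete (f := fun s : Finset (Fin K) => insert k s)).comp h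

/-- Preferences and the detection of dominated arms use the real-valued bounds only through this
finite table of truth values. The rest of these updates is a function on a discrete space, for which
measurability is automatic. -/
lemma measurable_comparisons : Measurable fun p : PlayerState K × ℝ => fun l i : Fin K =>
    (explore n p.1 k p.2).rsup l < (explore n p.1 k p.2).rinf i := by
  refine measurable_pi_lambda _ fun l => measurable_pi_lambda _ fun i => ?_
  exact measurableSet_setOfPred.1 (measurableSet_lt
    ((measurable_pi_apply l).comp (measurable_explore_rsup n k))
    ((measurable_pi_apply i).comp (measurable_explore_rinf n k)))

lemma measurable_explore_prefs : Measurable fun p : PlayerState K × ℝ =>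
    (explore n p.1 k p.2).prefs := by
  classical
  simp only [explore_prefs]
  exact (Measurable.of_discrete
    (f := fun q : List (Fin K) × Finset (Fin K) × (Fin K → Fin K → Prop) =>
    q.1 ++ ((List.finRange K).find? (fun i => @decide (IsActive q.1 q.2.1 i ∧
      ∀ l, l ≠ i → IsActive q.1 q.2.1 l → q.2.2 l i) (Classical.propDecidable _))).toList)).comp
    ((measurable_prefs.comp measurable_fst).prodMk
      ((measurable_occMid n k).prodMk (measurable_comparisons n k)))

lemma measurable_explore_occ : Measurable fun p : PlayerState K × ℝ =>
    (explore n p.1 k p.2).occ := by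
  classical
  have h' := (Measurable.of_discrete
    (f := fun q : List (Fin K) × ℕ × Finset (Fin K) × (Fin K → Fin K → Prop) =>
    q.2.2.1 ∪ Finset.univ.filter (fun a => q.1[q.2.1]? = some a ∧
      ∃ l, (IsActive q.1 q.2.2.1 l ∨ l ∈ q.1.drop (q.2.1 + 1)) ∧ q.2.2.2 a l))).comp
    ((measurable_explore_prefs n k).prodMk ((measurable_explore_pos n k).prodMk
      ((measurable_occMid n k).prodMk (measurable_comparisons n k))))
  convert h' using 1
  funext p
  rw [explore_occ]
  simp only [IsDominated, Function.comp]
  congr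

lemma measurable_explore_aux : Measurable fun p : PlayerState K × ℝ => explore n p.1 k p.2 := by
  refine measurable_comap_iff.2 ?_
  refine Measurable.prodMk (Measurable.prodMk ?_ (Measurable.prodMk (measurable_explore_pos n k)
    (Measurable.prodMk (measurable_explore_fixed n k) (Measurable.prodMk
    (measurable_explore_prefs n k) (measurable_explore_occ n k)))))
    (Measurable.prodMk (Measurable.prodMk (measurable_explore_pulls n k)
    (measurable_explore_pullsTemp n k)) (Measurable.prodMk (Measurable.prodMk
    (measurable_explore_sum n k) (measurable_explore_sumTemp n k)) (Measurable.prodMk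
    (measurable_explore_len n k) (Measurable.prodMk (measurable_explore_rinf n k)
    (measurable_explore_rsup n k)))))
  exact (measurable_of_countable (fun m : ℕ => m + 1)).comp (measurable_time.comp measurable_fst)

end ExploreFixedArm

lemma measurable_explore (n : ℕ) : Measurable fun p : (PlayerState K × ℝ) × Fin K =>
    explore n p.1.1 p.2 p.1.2 :=
  measurable_from_prod_countable_left fun k => measurable_explore_aux n k

lemma measurable_reward (A : Finset (Fin M)) (j : Fin M) :
    Measurable fun p : (Fin K → ℝ) × (Fin M → Fin K) => reward A p.2 p.1 j := by
  refine measurable_from_prod_countable_left fun π => ?_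
  change Measurable fun y : Fin K → ℝ => y (π j) * (1 - collision A π (π j))
  exact (measurable_pi_apply (π j)).mul measurable_const

/-- The arms pulled by the players, who exploit the arms `F` or use their samples. -/
def armsPulled (F : Fin M → Option (Fin K)) (v : Fin M → Fin K) (j : Fin M) : Fin K :=
  (F j).getD (v j)

lemma measurable_armsPulled :
    Measurable fun p : (Fin M → Option (Fin K)) × (Fin M → Fin K) => armsPulled p.1 p.2 :=
  Measurable.of_discrete

variable {Ω : Type*} {X : ℕ → Ω → Fin K → ℝ} {U : ℕ → Ω → Fin M → Fin K} (T : ℕ) (τ : Fin M → ℕ)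

lemma measurable_states {mΩ : MeasurableSpace Ω} {s : ℕ} (hX : ∀ i < s, Measurable (X i))
    (hU : ∀ i < s, Measurable (U i)) :
    Measurable fun ω => states T τ (fun i => X i ω) (fun i => U i ω) s := by
  induction s with
  | zero => exact measurable_const
  | succ s ih =>
    have ih := ih (fun i hi => hX i (by omega)) (fun i hi => hU i (by omega))
    refine measurable_pi_lambda _ fun j => ?_
    have hF : Measurable fun ω => fun j => exploited T τ (fun i => X i ω) (fun i => U i ω) s j :=
      measurable_pi_lambda _ fun j => measurable_fixed.comp ((measurable_pi_apply j).comp ih)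
    have hπ : Measurable fun ω => armsPulled
        (fun j => exploited T τ (fun i => X i ω) (fun i => U i ω) s j) (U s ω) :=
      measurable_armsPulled.comp (hF.prodMk (hU s (by omega)))
    have hr := (measurable_reward (players τ s) j).comp ((hX s (by omega)).prodMk hπ)
    have hst := (measurable_pi_apply j).comp ih
    simp only [states]
    refine Measurable.ite ?_ ?_ hst
    · exact (MeasurableSet.const _).inter
        (((measurable_pi_apply j).comp hF) (measurableSet_singleton none))
    · exact (measurable_explore (T - τ j)).comp
        ((hst.prodMk hr).prodMk ((measurable_pi_apply j).comp hπ))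

lemma measurable_exploited {mΩ : MeasurableSpace Ω} {s : ℕ} (hX : ∀ i < s, Measurable (X i))
    (hU : ∀ i < s, Measurable (U i)) :
    Measurable fun ω => exploited T τ (fun i => X i ω) (fun i => U i ω) s :=
  measurable_pi_lambda _ fun j =>
    measurable_fixed.comp ((measurable_pi_apply j).comp (measurable_states T τ hX hU))

end Measurability

end

end DynMMAB

namespace DynMMAB

noncomputable section

/-! ### Independence of the past and the present, and a maximal inequality -/

section Past

lemma measurable_prodMk_of {Ω α β : Type*} {m : MeasurableSpace Ω} [MeasurableSpace α]
    [MeasurableSpace β] {f : Ω → α} {g : Ω → β} (hf : Measurable[m] f) (hg : Measurable[m] g) :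
    Measurable[m] fun ω => (f ω, g ω) := hf.prodMk hg

lemma measurable_mul_of {Ω : Type*} {m : MeasurableSpace Ω} {f g : Ω → ℝ≥0∞}
    (hf : Measurable[m] f) (hg : Measurable[m] g) : Measurable[m] fun ω => f ω * g ω := hf.mul hg

variable {K M : ℕ} {Ω : Type*}

/-- The events that depend on the stages before `s` only. -/
abbrev past (X : ℕ → Ω → Fin K → ℝ) (U : ℕ → Ω → Fin M → Fin K) (s : ℕ) : MeasurableSpace Ω :=
  ⨆ i ∈ Set.Iio s, MeasurableSpace.comap (fun ω => (X i ω, U i ω)) inferInstance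

variable {X : ℕ → Ω → Fin K → ℝ} {U : ℕ → Ω → Fin M → Fin K}

lemma measurable_stage_past {i s : ℕ} (hi : i < s) :
    Measurable[past X U s] (fun ω => (X i ω, U i ω)) :=
  Measurable.mono (comap_measurable _)
    (le_iSup₂ (f := fun i (_ : i ∈ Set.Iio s) =>
      MeasurableSpace.comap (fun ω => (X i ω, U i ω)) inferInstance) i hi) le_rfl

lemma past_mono {s t : ℕ} (hst : s ≤ t) : past X U s ≤ past X U t :=
  biSup_mono fun _ hi => lt_of_lt_of_le hi hst

/-- Predictability: the arms exploited at stage `s` are decided by the earlier stages, so they can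
be held fixed when integrating over stage `s`. -/
lemma measurable_exploited_past (T : ℕ) (τ : Fin M → ℕ) (s : ℕ) :
    Measurable[past X U s] fun ω => exploited T τ (fun i => X i ω) (fun i => U i ω) s :=
  measurable_exploited (mΩ := past X U s) T τ
    (fun _ hi => @Measurable.fst _ _ _ (past X U s) _ _ _ (measurable_stage_past hi))
    (fun _ hi => @Measurable.snd _ _ _ (past X U s) _ _ _ (measurable_stage_past hi))

variable [mΩ : MeasurableSpace Ω] {P : Measure Ω} [IsProbabilityMeasure P]
  {ν : Fin K → Measure ℝ}

namespace IsModel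

variable (hm : IsModel P ν X U)

include hm

omit [IsProbabilityMeasure P] in
lemma measurable_stage (s : ℕ) : Measurable (fun ω => (X s ω, U s ω)) :=
  (hm.measurable_value s).prodMk (hm.measurable_sample s)

omit [IsProbabilityMeasure P] in
lemma past_le (s : ℕ) : past X U s ≤ mΩ :=
  iSup₂_le fun i _ => (hm.measurable_stage i).comap_le

omit [IsProbabilityMeasure P] in
lemma indepFun_past {β : Type*} [MeasurableSpace β] {s : ℕ} {Y : Ω → β}
    (hY : Measurable[past X U s] Y) : IndepFun Y (fun ω => (X s ω, U s ω)) P := by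
  have h1 := indep_iSup_of_disjoint (fun i => (hm.measurable_stage i).comap_le) hm.indep_stages
    (S := Set.Iio s) (T := {s}) (by simp)
  rw [iSup_singleton] at h1
  exact indep_of_indep_of_le_left h1 hY.comap_le

/-- Integration over a stage given the past. -/
lemma lintegral_mul_le {β : Type*} [MeasurableSpace β] {s : ℕ} {W : Ω → ℝ≥0∞} {Y : Ω → β}
    (hW : Measurable[past X U s] W) (hY : Measurable[past X U s] Y)
    {g : β → (Fin K → ℝ) × (Fin M → Fin K) → ℝ≥0∞} (hg : Measurable (Function.uncurry g))
    (h1 : ∀ ω', ∫⁻ ω, g (Y ω') (X s ω, U s ω) ∂P ≤ 1) :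
    ∫⁻ ω, W ω * g (Y ω) (X s ω, U s ω) ∂P ≤ ∫⁻ ω, W ω ∂P := by
  have hWY : Measurable[past X U s] fun ω => (W ω, Y ω) :=
    measurable_prodMk_of hW hY
  have hind := hm.indepFun_past hWY
  have hWY' : Measurable fun ω => (W ω, Y ω) := hWY.mono (hm.past_le s) le_rfl
  have hZ := hm.measurable_stage s
  have hmeas : Measurable fun p : (ℝ≥0∞ × β) × ((Fin K → ℝ) × (Fin M → Fin K)) =>
      p.1.1 * g p.1.2 p.2 :=
    measurable_fst.fst.mul (hg.comp (measurable_fst.snd.prodMk measurable_snd))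
  have e := (indepFun_iff_map_prod_eq_prod_map_map hWY'.aemeasurable hZ.aemeasurable).1 hind
  calc ∫⁻ ω, W ω * g (Y ω) (X s ω, U s ω) ∂P
      = ∫⁻ p, p.1.1 * g p.1.2 p.2 ∂(P.map (fun ω => ((W ω, Y ω), (X s ω, U s ω)))) := by
        rw [lintegral_map hmeas (hWY'.prodMk hZ)]
    _ = ∫⁻ q, ∫⁻ z, q.1 * g q.2 z ∂(P.map (fun ω => (X s ω, U s ω)))
          ∂(P.map (fun ω => (W ω, Y ω))) := by
        rw [e, lintegral_prod _ hmeas.aemeasurable]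
    _ = ∫⁻ ω', ∫⁻ z, W ω' * g (Y ω') z ∂(P.map (fun ω => (X s ω, U s ω))) ∂P := by
        rw [lintegral_map hmeas.lintegral_prod_right' hWY']
    _ ≤ ∫⁻ ω', W ω' ∂P := by
        refine lintegral_mono fun ω' => ?_
        have hgY : Measurable (g (Y ω')) := hg.comp measurable_prodMk_left
        rw [lintegral_const_mul _ hgY, lintegral_map hgY hZ]
        exact mul_le_of_le_one_right' (h1 ω')

/-- The maximal inequality for products of conditionally subnormalized factors. -/
theorem measure_exists_le_prod {β : Type*} [MeasurableSpace β] {Y : ℕ → Ω → β}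
    (hY : ∀ i, Measurable[past X U i] (Y i))
    {g : ℕ → β → (Fin K → ℝ) × (Fin M → Fin K) → ℝ≥0∞}
    (hg : ∀ i, Measurable (Function.uncurry (g i)))
    (h1 : ∀ i ω', ∫⁻ ω, g i (Y i ω') (X i ω, U i ω) ∂P ≤ 1) (c : ℝ≥0∞) (n : ℕ) :
    c * P {ω | ∃ t ≤ n, c ≤ ∏ i ∈ Finset.range t, g i (Y i ω) (X i ω, U i ω)} ≤ 1 := by
  classical
  -- `V` is the product stopped when it first reaches `c`: from then on its factors are `1`. Its
  -- expectation never exceeds `1`, and a crossing at any time up to `n` is still visible in `V n`,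
  -- so Markov's inequality at time `n` suffices.
  set V : ℕ → Ω → ℝ≥0∞ := fun t ω => Nat.rec (motive := fun _ => ℝ≥0∞) 1
    (fun i w => w * (if c ≤ w then 1 else g i (Y i ω) (X i ω, U i ω))) t with hV
  have hV0 : ∀ ω, V 0 ω = 1 := fun ω => rfl
  have hVs : ∀ t ω, V (t + 1) ω =
    V t ω * (if c ≤ V t ω then 1 else g t (Y t ω) (X t ω, U t ω)) := fun t ω => rfl
  set G : ℕ → ℝ≥0∞ × β → (Fin K → ℝ) × (Fin M → Fin K) → ℝ≥0∞ :=
    fun i q z => if c ≤ q.1 then 1 else g i q.2 z with hG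
  have hGm : ∀ i, Measurable (Function.uncurry (G i)) := fun i =>
    Measurable.ite (measurableSet_le measurable_const measurable_fst.fst) measurable_const
      ((hg i).comp (measurable_fst.snd.prodMk measurable_snd))
  have hVm : ∀ t, Measurable[past X U t] (V t) := by
    intro t
    induction t with
    | zero => exact measurable_const
    | succ t ih =>
      have h2 : Measurable[past X U (t + 1)] (V t) := ih.mono (past_mono (Nat.le_succ t)) le_rfl
      have h3 : Measurable[past X U (t + 1)] (Y t) :=
        (hY t).mono (past_mono (Nat.le_succ t)) le_rfl
      have h4 := (hGm t).comp (measurable_prodMk_of (measurable_prodMk_of h2 h3)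
        (measurable_stage_past (X := X) (U := U) (Nat.lt_succ_self t)))
      exact measurable_mul_of h2 h4
  have hint : ∀ t, ∫⁻ ω, V t ω ∂P ≤ 1 := by
    intro t
    induction t with
    | zero => simp [hV0]
    | succ t ih =>
      refine le_trans ?_ ih
      simp only [hVs]
      refine hm.lintegral_mul_le (hVm t) (Y := fun ω => (V t ω, Y t ω))
        (measurable_prodMk_of (hVm t) (hY t)) (hGm t) fun ω' => ?_
      simp only [hG]
      split_ifs
      · simp
      · exact h1 t ω'
  have hsub : {ω | ∃ t ≤ n, c ≤ ∏ i ∈ Finset.range t, g i (Y i ω) (X i ω, U i ω)} ⊆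
      {ω | c ≤ V n ω} := by
    rintro ω ⟨t, ht, hct⟩
    have hfr : ∀ s u, s ≤ u → c ≤ V s ω → c ≤ V u ω := by
      intro s u hsu hs
      induction u, hsu using Nat.le_induction with
      | base => exact hs
      | succ u _ ih => rw [hVs, if_pos ih, mul_one]; exact ih
    by_contra hn
    have hlt : ∀ s ≤ n, ¬ c ≤ V s ω := fun s hs h => hn (hfr s n hs h)
    have heq : ∀ s ≤ n, V s ω = ∏ i ∈ Finset.range s, g i (Y i ω) (X i ω, U i ω) := by
      intro s
      induction s with
      | zero => intro _; simp [hV0]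
      | succ s ih =>
        intro hs
        rw [hVs, if_neg (hlt s (by omega)), Finset.prod_range_succ, ih (by omega)]
    exact hlt t ht (heq t ht ▸ hct)
  calc _ ≤ c * P {ω | c ≤ V n ω} := by gcongr
    _ ≤ ∫⁻ ω, V n ω ∂P :=
        mul_meas_ge_le_lintegral ((hVm n).mono (hm.past_le n) le_rfl) c
    _ ≤ 1 := hint n

end IsModel

end Past

/-! ### The law of the reward of an exploring player -/

section RewardLaw

variable {K M : ℕ} {Ω : Type*} [mΩ : MeasurableSpace Ω]
  {X : ℕ → Ω → Fin K → ℝ} {U : ℕ → Ω → Fin M → Fin K}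
  {P : Measure Ω} [IsProbabilityMeasure P] {ν : Fin K → Measure ℝ}

/-- The probability that arm `k` is left free by the players other than `j`. -/
def freeProb (A : Finset (Fin M)) (F : Fin M → Option (Fin K)) (j : Fin M) (k : Fin K) : ℝ :=
  if k ∈ takenBy F j then 0 else availability A F j

lemma freeProb_nonneg (A : Finset (Fin M)) (F : Fin M → Option (Fin K)) (j : Fin M) (k : Fin K) :
    0 ≤ freeProb A F j k := by
  unfold freeProb availability
  split_ifs
  · exact le_rfl
  · refine pow_nonneg ?_ _
    rw [sub_nonneg]; exact Nat.cast_inv_le_one K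

lemma freeProb_le_one (A : Finset (Fin M)) (F : Fin M → Option (Fin K)) (j : Fin M) (k : Fin K) :
    freeProb A F j k ≤ 1 := by
  unfold freeProb
  split_ifs
  · exact zero_le_one
  · exact availability_le_one A F j

namespace IsModel

variable (hm : IsModel P ν X U)

include hm

omit [IsProbabilityMeasure P] in
lemma measure_sample_eq (s : ℕ) (j : Fin M) (k : Fin K) :
    P {ω | U s ω j = k} = ENNReal.ofReal (K : ℝ)⁻¹ := by
  have hK : (0 : ℝ) < K := by exact_mod_cast k.pos
  rw [hm.law_sample, ENNReal.ofReal_inv_of_pos hK, ENNReal.ofReal_natCast]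

omit [IsProbabilityMeasure P] in
lemma measurableSet_sample (s : ℕ) (D : Set (Fin M → Fin K)) : MeasurableSet {ω | U s ω ∈ D} :=
  hm.measurable_sample s (DiscreteMeasurableSpace.forall_measurableSet D)

lemma measure_sample_ne (s : ℕ) (j : Fin M) (k : Fin K) :
    P {ω | U s ω j ≠ k} = ENNReal.ofReal (1 - (K : ℝ)⁻¹) := by
  have h : {ω | U s ω j ≠ k} = {ω | U s ω j = k}ᶜ := rfl
  have hms : MeasurableSet {ω | U s ω j = k} := hm.measurableSet_sample s {v | v j = k}
  rw [h, prob_compl_eq_one_sub hms,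
    hm.measure_sample_eq, ← ENNReal.ofReal_one, ENNReal.ofReal_sub _ (by positivity)]

/-- The probability that player `j` pulls the arm `k`, and no player of a set `B` does. -/
lemma measure_sample_eq_and_ne (s : ℕ) {j : Fin M} (k : Fin K) {B : Finset (Fin M)} (hj : j ∉ B) :
    P {ω | U s ω j = k ∧ ∀ j' ∈ B, U s ω j' ≠ k} =
      ENNReal.ofReal ((K : ℝ)⁻¹ * (1 - (K : ℝ)⁻¹) ^ B.card) := by
  classical
  have h1 : (0 : ℝ) ≤ 1 - (K : ℝ)⁻¹ := by rw [sub_nonneg]; exact Nat.cast_inv_le_one K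
  have h := (hm.indep_samples s).measure_inter_preimage_eq_mul (insert j B)
    (sets := fun i => if i = j then {k} else {k}ᶜ)
    (fun i _ => DiscreteMeasurableSpace.forall_measurableSet _)
  have e : {ω | U s ω j = k ∧ ∀ j' ∈ B, U s ω j' ≠ k} =
      ⋂ i ∈ insert j B, (fun ω => U s ω i) ⁻¹' (if i = j then {k} else {k}ᶜ) := by
    ext ω
    simp only [Set.mem_ofPred_eq, Finset.mem_insert, Set.mem_iInter, Set.mem_preimage]
    constructor
    · rintro ⟨ha, hb⟩ i (rfl | hi)
      · simpa using ha
      · have : i ≠ j := fun e => hj (e ▸ hi)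
        simpa [this] using hb i hi
    · intro hall
      refine ⟨by simpa using hall j (Or.inl rfl), fun i hi => ?_⟩
      have : i ≠ j := fun e => hj (e ▸ hi)
      simpa [this] using hall i (Or.inr hi)
  rw [e, h, Finset.prod_insert hj, ENNReal.ofReal_mul (by positivity), ENNReal.ofReal_pow h1]
  congr 1
  · simp only [if_true]
    exact hm.measure_sample_eq s j k
  · rw [← Finset.prod_const]
    refine Finset.prod_congr rfl fun i hi => ?_
    rw [if_neg (fun e : i = j => hj (e ▸ hi))]
    exact hm.measure_sample_ne s i k

omit [IsProbabilityMeasure P] in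
lemma lintegral_value_mul_indicator (s : ℕ) (k : Fin K) {φ : ℝ → ℝ≥0∞} (hφ : Measurable φ)
    (D : Set (Fin M → Fin K)) :
    ∫⁻ ω, {ω | U s ω ∈ D}.indicator (fun ω => φ (X s ω k)) ω ∂P =
      P {ω | U s ω ∈ D} * ∫⁻ y, φ y ∂(ν k) := by
  have hXk : Measurable fun ω => X s ω k := (measurable_pi_apply k).comp (hm.measurable_value s)
  have hD : Measurable (D.indicator (fun _ => (1 : ℝ≥0∞))) :=
    measurable_const.indicator (DiscreteMeasurableSpace.forall_measurableSet D)
  have hind := (hm.indep_value_sample s).symm.comp hD (hφ.comp (measurable_pi_apply k))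
  have h := lintegral_mul_eq_lintegral_mul_lintegral_of_indepFun
    (hD.comp (hm.measurable_sample s)) (hφ.comp hXk) hind
  have e1 : ∫⁻ ω, (D.indicator (fun _ => (1 : ℝ≥0∞)) ∘ U s) ω ∂P = P {ω | U s ω ∈ D} := by
    rw [← lintegral_indicator_one (hm.measurableSet_sample s D)]
    rfl
  have e2 : ∫⁻ ω, (φ ∘ fun ω => X s ω k) ω ∂P = ∫⁻ y, φ y ∂(ν k) := by
    rw [← hm.law_value s k, lintegral_map hφ hXk]; rfl
  rw [← e1, ← e2, ← h]
  refine lintegral_congr fun ω => ?_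
  by_cases hω : U s ω ∈ D <;> simp [hω]

-- On an arm that no other player exploits, only exploring rivals can cause a collision.
omit hm [IsProbabilityMeasure P] in
lemma reward_of_free {A : Finset (Fin M)} {F : Fin M → Option (Fin K)} {v : Fin M → Fin K}
    {x : Fin K → ℝ} {j : Fin M} {k : Fin K} (hj : j ∈ A) (hF : F j = none) (hv : v j = k)
    (hk : k ∉ takenBy F j) : reward A (armsPulled F v) x j =
      if ∀ j' ∈ rivals A F j, v j' ≠ k then x k else 0 := by
  have hpj : armsPulled F v j = k := by simp [armsPulled, hF, hv]
  split_ifs with h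
  · rw [reward_eq_value, hpj]
    intro j' hj' hne
    rw [hpj]
    rcases hF' : F j' with _ | l
    · simpa [armsPulled, hF'] using h j' (by simp [rivals, hj', hne, hF'])
    · intro e
      apply hk
      rw [mem_takenBy]
      refine ⟨j', hne, ?_⟩
      simp only [armsPulled, hF', Option.getD_some] at e
      rw [hF', e]
  · push Not at h
    obtain ⟨j', hj', e⟩ := h
    simp only [rivals, Finset.mem_filter] at hj'
    refine reward_eq_zero hj hj'.1 hj'.2.1 ?_
    rw [hpj]
    simp [armsPulled, hj'.2.2, e]

omit hm [IsProbabilityMeasure P] in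
lemma reward_of_taken {A : Finset (Fin M)} {F : Fin M → Option (Fin K)} {v : Fin M → Fin K}
    {x : Fin K → ℝ} {j : Fin M} {k : Fin K} (hj : j ∈ A) (hF : F j = none) (hv : v j = k)
    (hA : ∀ j k, F j = some k → j ∈ A) (hk : k ∈ takenBy F j) :
    reward A (armsPulled F v) x j = 0 := by
  obtain ⟨j', hne, hF'⟩ := mem_takenBy.1 hk
  refine reward_eq_zero hj (hA _ _ hF') hne ?_
  simp [armsPulled, hF, hF', hv]

/-- A bound on the expectation of a function of the reward of player `j` on the event that she pulls
the arm `k`, completed by a constant on the complement. -/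
lemma lintegral_reward_le (s : ℕ) {A : Finset (Fin M)} {F : Fin M → Option (Fin K)} {j : Fin M}
    (k : Fin K) (hj : j ∈ A) (hF : F j = none) (hA : ∀ j k, F j = some k → j ∈ A)
    {φ : ℝ → ℝ≥0∞} (hφ : Measurable φ) {a b d : ℝ} (ha : 0 ≤ a) (hb : 0 ≤ b) (hd : 0 ≤ d)
    (ha' : ∫⁻ y, φ y ∂(ν k) ≤ ENNReal.ofReal a) (hb' : φ 0 ≤ ENNReal.ofReal b) :
    ∫⁻ ω, (if U s ω j = k then φ (reward A (armsPulled F (U s ω)) (X s ω) j)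
      else ENNReal.ofReal d) ∂P ≤
      ENNReal.ofReal ((K : ℝ)⁻¹ * (freeProb A F j k * a + (1 - freeProb A F j k) * b) +
        (1 - (K : ℝ)⁻¹) * d) := by
  classical
  set γ := freeProb A F j k with hγ
  have hγ0 : 0 ≤ γ := freeProb_nonneg A F j k
  have hγ1 : γ ≤ 1 := freeProb_le_one A F j k
  have hK0 : (0 : ℝ) ≤ (K : ℝ)⁻¹ := by positivity
  have hK1 : (0 : ℝ) ≤ 1 - (K : ℝ)⁻¹ := by rw [sub_nonneg]; exact Nat.cast_inv_le_one K
  -- `D₁` is the event that `j` pulls `k` without a collision and `D₂` that she pulls it with one,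
  -- where the reward is `0`. Both depend on the samples only, so they are independent of the value
  -- of the arm.
  set D₁ : Set (Fin M → Fin K) := {v | v j = k ∧ k ∉ takenBy F j ∧ ∀ j' ∈ rivals A F j, v j' ≠ k}
    with hD₁
  set D₂ : Set (Fin M → Fin K) := {v | v j = k} \ D₁ with hD₂
  have hm1 : P {ω | U s ω ∈ D₁} = ENNReal.ofReal ((K : ℝ)⁻¹ * γ) := by
    by_cases hk : k ∈ takenBy F j
    · simp [hD₁, hγ, freeProb, hk]
    · simp only [hD₁, hγ, freeProb, hk, not_false_eq_true, true_and, if_false, Set.mem_ofPred_eq]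
      exact hm.measure_sample_eq_and_ne s k (by simp [rivals])
  have hm2 : P {ω | U s ω ∈ D₂} = ENNReal.ofReal ((K : ℝ)⁻¹ * (1 - γ)) := by
    have e : {ω | U s ω ∈ D₂} = {ω | U s ω j = k} \ {ω | U s ω ∈ D₁} := rfl
    have hsub : {ω | U s ω ∈ D₁} ⊆ {ω | U s ω j = k} := fun ω hω => hω.1
    rw [e, measure_sdiff hsub (hm.measurableSet_sample s D₁).nullMeasurableSet
      (measure_ne_top _ _), hm1, hm.measure_sample_eq, ← ENNReal.ofReal_sub _ (by positivity)]
    congr 1; ring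
  have hpt : ∀ ω, (if U s ω j = k then φ (reward A (armsPulled F (U s ω)) (X s ω) j)
      else ENNReal.ofReal d) = {ω | U s ω ∈ D₁}.indicator (fun ω => φ (X s ω k)) ω +
      ({ω | U s ω ∈ D₂}.indicator (fun _ => φ 0) ω +
        {ω | U s ω j ≠ k}.indicator (fun _ => ENNReal.ofReal d) ω) := by
    intro ω
    by_cases hv : U s ω j = k
    · rw [if_pos hv]
      by_cases hk : k ∈ takenBy F j
      · rw [reward_of_taken hj hF hv hA hk]
        simp [Set.indicator, hD₁, hD₂, hv, hk]
      · rw [reward_of_free hj hF hv hk]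
        by_cases hr : ∀ j' ∈ rivals A F j, U s ω j' ≠ k
        · have h1 : U s ω ∈ D₁ := ⟨hv, hk, hr⟩
          have h2 : U s ω ∉ D₂ := fun h => h.2 h1
          rw [if_pos hr]
          simp [Set.indicator, h1, h2, hv]
        · have h1 : U s ω ∉ D₁ := fun h => hr h.2.2
          have h2 : U s ω ∈ D₂ := ⟨hv, h1⟩
          rw [if_neg hr]
          simp [Set.indicator, h1, h2, hv]
    · have h1 : U s ω ∉ D₁ := fun h => hv h.1
      have h2 : U s ω ∉ D₂ := fun h => hv h.1
      simp [Set.indicator, h1, h2, hv]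
  have hne : MeasurableSet {ω | U s ω j ≠ k} := hm.measurableSet_sample s {v | v j ≠ k}
  have hms : ∀ D : Set (Fin M → Fin K), MeasurableSet {ω | U s ω ∈ D} := hm.measurableSet_sample s
  simp only [hpt]
  have hXk : Measurable fun ω => X s ω k := (measurable_pi_apply k).comp (hm.measurable_value s)
  have hφX : Measurable fun ω => φ (X s ω k) := hφ.comp hXk
  rw [lintegral_add_left (hφX.indicator (hms D₁)),
    lintegral_add_left (measurable_const.indicator (hms D₂)),
    hm.lintegral_value_mul_indicator s k hφ D₁, lintegral_indicator_const (hms D₂),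
    lintegral_indicator_const hne, hm1, hm2, hm.measure_sample_ne]
  have h1γ : 0 ≤ 1 - γ := by linarith
  calc _ ≤ ENNReal.ofReal ((K : ℝ)⁻¹ * γ) * ENNReal.ofReal a +
        (ENNReal.ofReal b * ENNReal.ofReal ((K : ℝ)⁻¹ * (1 - γ)) +
          ENNReal.ofReal d * ENNReal.ofReal (1 - (K : ℝ)⁻¹)) := by gcongr
    _ = _ := by
      rw [← ENNReal.ofReal_mul (by positivity), ← ENNReal.ofReal_mul hb, ← ENNReal.ofReal_mul hd,
        ← ENNReal.ofReal_add (by positivity) (by positivity),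
        ← ENNReal.ofReal_add (by positivity) (by positivity)]
      congr 1; ring

/-- The same bound for a function that takes a constant value on every arm. -/
lemma lintegral_sample_eq (s : ℕ) (j : Fin M) (k : Fin K) {a d : ℝ} (ha : 0 ≤ a) (hd : 0 ≤ d) :
    ∫⁻ ω, (if U s ω j = k then ENNReal.ofReal a else ENNReal.ofReal d) ∂P =
      ENNReal.ofReal ((K : ℝ)⁻¹ * a + (1 - (K : ℝ)⁻¹) * d) := by
  have hK1 : (0 : ℝ) ≤ 1 - (K : ℝ)⁻¹ := by rw [sub_nonneg]; exact Nat.cast_inv_le_one K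
  have hpt : ∀ ω, (if U s ω j = k then ENNReal.ofReal a else ENNReal.ofReal d) =
      {ω | U s ω j = k}.indicator (fun _ => ENNReal.ofReal a) ω +
        {ω | U s ω j ≠ k}.indicator (fun _ => ENNReal.ofReal d) ω := by
    intro ω
    by_cases hv : U s ω j = k <;> simp [Set.indicator, hv]
  have hne : MeasurableSet {ω | U s ω j ≠ k} := hm.measurableSet_sample s {v | v j ≠ k}
  have heq : MeasurableSet {ω | U s ω j = k} := hm.measurableSet_sample s {v | v j = k}
  simp only [hpt]
  rw [lintegral_add_right _ (measurable_const.indicator hne), lintegral_indicator_const heq,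
    lintegral_indicator_const hne, hm.measure_sample_eq, hm.measure_sample_ne,
    ← ENNReal.ofReal_mul ha, ← ENNReal.ofReal_mul hd,
    ← ENNReal.ofReal_add (by positivity) (by positivity)]
  congr 1; ring

end IsModel

end RewardLaw

end

end DynMMAB

namespace DynMMAB

noncomputable section

/-! ### Moments of the values of an arm. -/

section Means

variable {K : ℕ} {ν : Fin K → Measure ℝ}

lemma ae_mem_Icc (hν : ∀ k, ν k (Set.Icc (0 : ℝ) 1)ᶜ = 0) (k : Fin K) :
    ∀ᵐ y ∂ν k, 0 ≤ y ∧ y ≤ 1 := by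
  have := measure_eq_zero_iff_ae_notMem.1 (hν k)
  filter_upwards [this] with y hy
  simpa using hy

lemma integrable_id_law [∀ k, IsProbabilityMeasure (ν k)]
    (hν : ∀ k, ν k (Set.Icc (0 : ℝ) 1)ᶜ = 0) (k : Fin K) : Integrable (fun y => y) (ν k) := by
  refine Integrable.of_bound measurable_id.aestronglyMeasurable 1 ?_
  filter_upwards [ae_mem_Icc hν k] with y hy
  rw [Real.norm_eq_abs, abs_of_nonneg hy.1]
  exact hy.2

lemma armMean_nonneg (hν : ∀ k, ν k (Set.Icc (0 : ℝ) 1)ᶜ = 0) (k : Fin K) : 0 ≤ armMean ν k :=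
  integral_nonneg_of_ae ((ae_mem_Icc hν k).mono fun _ h => h.1)

lemma armMean_le_one [∀ k, IsProbabilityMeasure (ν k)]
    (hν : ∀ k, ν k (Set.Icc (0 : ℝ) 1)ᶜ = 0) (k : Fin K) : armMean ν k ≤ 1 := by
  have h := integral_mono_ae (integrable_id_law hν k) (integrable_const (1 : ℝ))
    ((ae_mem_Icc hν k).mono fun _ h => h.2)
  simpa [armMean] using h

lemma exp_le_quadratic {x : ℝ} (hx : |x| ≤ 1) : Real.exp x ≤ 1 + x + x ^ 2 := by
  have := (abs_le.1 (Real.abs_exp_sub_one_sub_id_le hx)).2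
  linarith

/-- `exp b ≥ 1 + b + b² / 2`, and `(1 - b + b² / 2) (1 + b + b² / 2) = 1 + b⁴ / 4 ≥ 1`. -/
lemma exp_neg_le_quadratic {b : ℝ} (hb : 0 ≤ b) : Real.exp (-b) ≤ 1 - b + b ^ 2 / 2 := by
  have h := Real.quadratic_le_exp_of_nonneg hb
  rw [Real.exp_neg, inv_le_iff_one_le_mul₀ (Real.exp_pos _)]
  have h1 : 0 ≤ 1 - b + b ^ 2 / 2 := by nlinarith [sq_nonneg (b - 1)]
  have h2 := mul_le_mul_of_nonneg_left h h1
  nlinarith [sq_nonneg (b ^ 2)]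

/-- The exponential moment of a centered value of an arm. -/
lemma lintegral_exp_le [∀ k, IsProbabilityMeasure (ν k)]
    (hν : ∀ k, ν k (Set.Icc (0 : ℝ) 1)ᶜ = 0) (k : Fin K) {l c : ℝ} (hl : |l| ≤ 1) :
    ∫⁻ y, ENNReal.ofReal (Real.exp (l * (y - armMean ν k / 2) - c)) ∂(ν k) ≤
      ENNReal.ofReal (Real.exp (-c) * (1 + l * armMean ν k / 2 + l ^ 2 / 3)) := by
  set μ := armMean ν k with hμ
  have hμ0 := armMean_nonneg hν k
  have hμ1 := armMean_le_one hν k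
  rw [← hμ] at hμ0 hμ1
  set q : ℝ → ℝ := fun y => Real.exp (-c) *
    (1 + l * (y - μ / 2) + l ^ 2 * ((1 - μ) * y + μ ^ 2 / 4)) with hq
  have hint : Integrable q (ν k) := by
    have h1 := integrable_id_law hν k
    exact ((((integrable_const 1).add ((h1.sub (integrable_const (μ / 2))).const_mul l)).add
      (((h1.const_mul (1 - μ)).add (integrable_const (μ ^ 2 / 4))).const_mul (l ^ 2))).const_mul
      (Real.exp (-c)))
  have hle : ∀ᵐ y ∂ν k, Real.exp (l * (y - μ / 2) - c) ≤ q y := by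
    filter_upwards [ae_mem_Icc hν k] with y hy
    have hy2 : |y - μ / 2| ≤ 1 := by rw [abs_le]; constructor <;> linarith [hy.1, hy.2]
    have h1 : |l * (y - μ / 2)| ≤ 1 := by
      rw [abs_mul]; exact mul_le_one₀ hl (abs_nonneg _) hy2
    have h2 := exp_le_quadratic h1
    -- `y² ≤ y` on the unit interval makes the bound affine in `y`. Its mean `μ - 3 μ² / 4` is
    -- largest at `μ = 2 / 3`, where it equals `1 / 3`.
    have h3 : (y - μ / 2) ^ 2 ≤ (1 - μ) * y + μ ^ 2 / 4 := by nlinarith [hy.1, hy.2]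
    have h4 : (l * (y - μ / 2)) ^ 2 ≤ l ^ 2 * ((1 - μ) * y + μ ^ 2 / 4) := by
      rw [mul_pow]; exact mul_le_mul_of_nonneg_left h3 (sq_nonneg l)
    rw [sub_eq_add_neg, Real.exp_add, mul_comm]
    exact mul_le_mul_of_nonneg_left (by linarith) (Real.exp_pos _).le
  have hq0 : 0 ≤ᵐ[ν k] q := hle.mono fun y hy => (Real.exp_pos _).le.trans hy
  calc _ ≤ ∫⁻ y, ENNReal.ofReal (q y) ∂(ν k) :=
        lintegral_mono_ae (hle.mono fun y hy => ENNReal.ofReal_le_ofReal hy)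
    _ = ENNReal.ofReal (∫ y, q y ∂(ν k)) := (ofReal_integral_eq_lintegral_ofReal hint hq0).symm
    _ ≤ _ := by
      refine ENNReal.ofReal_le_ofReal ?_
      have h1 := integrable_id_law hν k
      have e : ∫ y, q y ∂(ν k) = Real.exp (-c) *
          (1 + l * (μ - μ / 2) + l ^ 2 * ((1 - μ) * μ + μ ^ 2 / 4)) := by
        have e' : q = fun y => Real.exp (-c) * (1 - l * μ / 2 + l ^ 2 * (μ ^ 2 / 4)) +
            Real.exp (-c) * (l + l ^ 2 * (1 - μ)) * y := by
          funext y; simp only [hq]; ring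
        rw [e', integral_add (integrable_const _) (h1.const_mul _),
          show ∫ y, Real.exp (-c) * (l + l ^ 2 * (1 - μ)) * y ∂(ν k) =
            Real.exp (-c) * (l + l ^ 2 * (1 - μ)) * μ from integral_const_mul _ _]
        simp only [integral_const, probReal_univ, one_smul]
        ring
      rw [e]
      refine mul_le_mul_of_nonneg_left ?_ (Real.exp_pos _).le
      have : (1 - μ) * μ + μ ^ 2 / 4 ≤ 1 / 3 := by nlinarith [sq_nonneg (3 * μ - 2)]
      nlinarith [mul_le_mul_of_nonneg_left this (sq_nonneg l)]

/-- The probability that the value of an arm is `0`. -/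
lemma law_singleton_zero_le [∀ k, IsProbabilityMeasure (ν k)]
    (hν : ∀ k, ν k (Set.Icc (0 : ℝ) 1)ᶜ = 0) (k : Fin K) :
    ν k {0} ≤ ENNReal.ofReal (1 - armMean ν k) := by
  have hms : MeasurableSet ({0}ᶜ : Set ℝ) := (measurableSet_singleton 0).compl
  have h1 : armMean ν k ≤ ∫ y, ({0}ᶜ : Set ℝ).indicator (fun _ => (1 : ℝ)) y ∂(ν k) := by
    refine integral_mono_ae (integrable_id_law hν k) ((integrable_const 1).indicator hms) ?_
    filter_upwards [ae_mem_Icc hν k] with y hy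
    by_cases h0 : y = 0
    · simp [h0]
    · simpa [h0] using hy.2
  rw [integral_indicator_const _ hms, smul_eq_mul, mul_one,
    probReal_compl_eq_one_sub (measurableSet_singleton 0)] at h1
  rw [← ofReal_measureReal]
  exact ENNReal.ofReal_le_ofReal (by linarith)

end Means

/-! ### Exponential deviation bounds for counts, gains and runs of zeros. -/

section Deviations

variable {K M : ℕ} {Ω : Type*} [mΩ : MeasurableSpace Ω]
  {X : ℕ → Ω → Fin K → ℝ} {U : ℕ → Ω → Fin M → Fin K}
  {P : Measure Ω} [IsProbabilityMeasure P] {ν : Fin K → Measure ℝ}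

/-- The run of player `j` on the outcome `ω`. -/
abbrev runAt (X : ℕ → Ω → Fin K → ℝ) (U : ℕ → Ω → Fin M → Fin K) (T : ℕ) (τ : Fin M → ℕ)
    (j : Fin M) (ω : Ω) : Run K := playerRun T τ (fun s => X s ω) (fun s => U s ω) j

/-- Player `j` still explores after `t` steps. -/
abbrev ExploresAt (X : ℕ → Ω → Fin K → ℝ) (U : ℕ → Ω → Fin M → Fin K) (T : ℕ) (τ : Fin M → ℕ)
    (j : Fin M) (t : ℕ) (ω : Ω) : Prop :=
  exploited T τ (fun s => X s ω) (fun s => U s ω) (τ j + t) j = none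

omit [IsProbabilityMeasure P] in
lemma measure_le_exp_neg {S : Set Ω} {c : ℝ} (h : ENNReal.ofReal (Real.exp c) * P S ≤ 1) :
    P S ≤ ENNReal.ofReal (Real.exp (-c)) := by
  rw [Real.exp_neg, ENNReal.ofReal_inv_of_pos (Real.exp_pos c)]
  rw [ENNReal.le_inv_iff_mul_le, mul_comm]
  exact h

namespace IsModel

variable (hm : IsModel P ν X U)

include hm

omit [IsProbabilityMeasure P] in
lemma isProbabilityMeasure_law [IsProbabilityMeasure P] (k : Fin K) :
    IsProbabilityMeasure (ν k) := by
  rw [← hm.law_value 0 k]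
  exact Measure.isProbabilityMeasure_map
    ((measurable_pi_apply k).comp (hm.measurable_value 0)).aemeasurable

/-- Deviations of the number of pulls. -/
lemma measure_count_le (T : ℕ) (τ : Fin M → ℕ) (j : Fin M) (k : Fin K) (s t : ℕ) (hst : s ≤ t)
    {l κ : ℝ} (hκ : Real.exp l ≤ 1 + κ * K) (c : ℝ) :
    P {ω | c ≤ l * (runAt X U T τ j ω).count k s t - (t - s : ℝ) * κ} ≤
      ENNReal.ofReal (Real.exp (-c)) := by
  have hK : (0 : ℝ) < K := by exact_mod_cast k.pos
  -- The factor is `exp (l - κ)` for a pull and `exp (-κ)` otherwise, and trivial before local time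
  -- `s`. Its mean is at most `(1 + κ) exp (-κ) ≤ 1`.
  set g : ℕ → (Fin M → Option (Fin K)) → (Fin K → ℝ) × (Fin M → Fin K) → ℝ≥0∞ := fun i _ z =>
    if τ j + s ≤ i then (if z.2 j = k then ENNReal.ofReal (Real.exp (l - κ))
      else ENNReal.ofReal (Real.exp (-κ))) else 1 with hg
  have hgm : ∀ i, Measurable (Function.uncurry (g i)) := by
    intro i
    have : Measurable fun v : Fin M → Fin K => (if τ j + s ≤ i then
      (if v j = k then ENNReal.ofReal (Real.exp (l - κ))
      else ENNReal.ofReal (Real.exp (-κ))) else 1) := Measurable.of_discrete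
    exact this.comp measurable_snd.snd
  have h1 : ∀ i ω', ∫⁻ ω, g i (exploited T τ (fun s => X s ω') (fun s => U s ω') i)
      (X i ω, U i ω) ∂P ≤ 1 := by
    intro i ω'
    simp only [hg]
    split_ifs with hi
    · rw [hm.lintegral_sample_eq i j k (Real.exp_pos _).le (Real.exp_pos _).le,
        ← ENNReal.ofReal_one]
      refine ENNReal.ofReal_le_ofReal ?_
      have h2 : (K : ℝ)⁻¹ * Real.exp l + (1 - (K : ℝ)⁻¹) ≤ 1 + κ := by
        have h3 : (K : ℝ)⁻¹ * Real.exp l ≤ (K : ℝ)⁻¹ * (1 + κ * K) := by gcongr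
        have h4 : (K : ℝ)⁻¹ * (1 + κ * K) = (K : ℝ)⁻¹ + κ := by field_simp
        linarith
      have h3 := Real.add_one_le_exp κ
      calc (K : ℝ)⁻¹ * Real.exp (l - κ) + (1 - (K : ℝ)⁻¹) * Real.exp (-κ)
          = ((K : ℝ)⁻¹ * Real.exp l + (1 - (K : ℝ)⁻¹)) * Real.exp (-κ) := by
            rw [sub_eq_add_neg l, Real.exp_add]; ring
        _ ≤ Real.exp κ * Real.exp (-κ) :=
            mul_le_mul_of_nonneg_right (by linarith) (Real.exp_pos _).le
        _ = 1 := by rw [← Real.exp_add]; simp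
    · simp
  have hmax := hm.measure_exists_le_prod (Y := fun i ω => exploited T τ (fun s => X s ω)
    (fun s => U s ω) i) (fun i => measurable_exploited_past T τ i) hgm h1
    (ENNReal.ofReal (Real.exp c)) (τ j + t)
  refine measure_le_exp_neg (le_trans ?_ hmax)
  refine mul_le_mul' le_rfl (measure_mono fun ω hω => ?_)
  refine ⟨τ j + t, le_rfl, ?_⟩
  have hprod : ∀ u, s ≤ u → ∏ i ∈ Finset.range (τ j + u), g i
      (exploited T τ (fun s => X s ω) (fun s => U s ω) i) (X i ω, U i ω) =
      ENNReal.ofReal (Real.exp (l * (runAt X U T τ j ω).count k s u - (u - s : ℝ) * κ)) := by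
    intro u hu
    induction u, hu using Nat.le_induction with
    | base =>
      rw [Finset.prod_eq_one, Run.count_self]
      · simp
      · intro i hi
        rw [Finset.mem_range] at hi
        simp only [hg]
        rw [if_neg (by omega)]
    | succ u hu ih =>
      rw [← add_assoc, Finset.prod_range_succ, ih, Run.count_succ _ _ hu]
      simp only [hg]
      rw [if_pos (by omega)]
      change _ * (if (runAt X U T τ j ω).arm u = k then _ else _) = _
      split_ifs <;>
      · rw [← ENNReal.ofReal_mul (Real.exp_pos _).le, ← Real.exp_add]
        push_cast
        ring_nf
  rw [hprod t hst]
  exact ENNReal.ofReal_le_ofReal (Real.exp_le_exp.2 hω)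

/-- Deviations of the sum of the rewards. -/
lemma measure_gain_le (hν : ∀ k, ν k (Set.Icc (0 : ℝ) 1)ᶜ = 0) (T : ℕ) (τ : Fin M → ℕ)
    (j : Fin M) (k : Fin K) (t : ℕ) {l : ℝ} (hl : |l| ≤ 1) (c : ℝ) :
    P {ω | ExploresAt X U T τ j t ω ∧ c ≤ l * ((runAt X U T τ j ω).gain k 0 t -
        armMean ν k * (runAt X U T τ j ω).count k 0 t / 2 -
        armMean ν k / K * ((runAt X U T τ j ω).mass k t - t / 2)) - l ^ 2 / 3 * (t / K)} ≤
      ENNReal.ofReal (Real.exp (-c)) := by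
  have hprob := hm.isProbabilityMeasure_law
  have hK : (0 : ℝ) < K := by exact_mod_cast k.pos
  set μ := armMean ν k with hμ
  have hμ0 : 0 ≤ μ := armMean_nonneg hν k
  have hμ1 : μ ≤ 1 := armMean_le_one hν k
  -- Given the past, a pull of `k` is free with probability `γ = freeProb` and yields a centred
  -- moment of at most `1 + l μ / 2 + l² / 3`. With a collision the reward is `0` and the bound is
  -- `1 - l μ / 2 + l² / 3`. Averaging these and the stages without a pull gives exactly `1 + κ ≤
  -- exp κ`.
  set κ : ℕ → (Fin M → Option (Fin K)) → ℝ := fun i F =>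
    (K : ℝ)⁻¹ * (l * μ * (freeProb (players τ i) F j k - 1 / 2) + l ^ 2 / 3) with hκ
  set g : ℕ → (Fin M → Option (Fin K)) → (Fin K → ℝ) × (Fin M → Fin K) → ℝ≥0∞ := fun i F z =>
    if τ j ≤ i ∧ F j = none then (if z.2 j = k then
      ENNReal.ofReal (Real.exp (l * (reward (players τ i) (armsPulled F z.2) z.1 j - μ / 2) - κ i F))
      else ENNReal.ofReal (Real.exp (-κ i F))) else 1 with hg
  have hgm : ∀ i, Measurable (Function.uncurry (g i)) := by
    intro i
    refine measurable_from_prod_countable_right fun F => ?_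
    refine measurable_from_prod_countable_left fun v => ?_
    have hr : Measurable fun x : Fin K → ℝ => reward (players τ i) (armsPulled F v) x j := by
      have hp : Measurable fun x : Fin K → ℝ => (x, armsPulled F v) := measurable_prodMk_right
      exact (measurable_reward (players τ i) j).comp hp
    simp only [Function.uncurry, hg]
    split_ifs
    · exact ((((hr.sub_const _).const_mul l).sub_const _).exp).ennreal_ofReal
    · exact measurable_const
    · exact measurable_const
  have h1 : ∀ i ω', ∫⁻ ω, g i (exploited T τ (fun s => X s ω') (fun s => U s ω') i)
      (X i ω, U i ω) ∂P ≤ 1 := by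
    intro i ω'
    set F := exploited T τ (fun s => X s ω') (fun s => U s ω') i with hF
    simp only [hg]
    split_ifs with hi
    · have hexp := Real.exp_pos (-κ i F)
      have hl1 := abs_le.1 hl
      have ha : 0 ≤ 1 + l * μ / 2 + l ^ 2 / 3 := by nlinarith
      have hb : 0 ≤ 1 - l * μ / 2 + l ^ 2 / 3 := by nlinarith
      refine (hm.lintegral_reward_le i k (mem_players.2 hi.1) hi.2
        (fun j k h => mem_players.2 (le_of_exploited h))
        (φ := fun r => ENNReal.ofReal (Real.exp (l * (r - μ / 2) - κ i F)))
        ((((measurable_id.sub_const _).const_mul l).sub_const _).exp.ennreal_ofReal)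
        (mul_nonneg hexp.le ha) (mul_nonneg hexp.le hb) hexp.le
        (lintegral_exp_le hν k hl) ?_).trans ?_
      · refine ENNReal.ofReal_le_ofReal ?_
        have h2 : |l * (0 - μ / 2)| ≤ 1 := by
          rw [abs_mul]
          refine mul_le_one₀ hl (abs_nonneg _) ?_
          rw [abs_le]; constructor <;> linarith
        have h3 := exp_le_quadratic h2
        rw [sub_eq_add_neg (l * (0 - μ / 2)), Real.exp_add, mul_comm]
        refine mul_le_mul_of_nonneg_left ?_ hexp.le
        nlinarith [mul_le_mul_of_nonneg_left (show μ ^ 2 / 4 ≤ 1 / 3 by nlinarith) (sq_nonneg l)]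
      · rw [← ENNReal.ofReal_one]
        refine ENNReal.ofReal_le_ofReal ?_
        have h3 := Real.add_one_le_exp (κ i F)
        calc _ = (1 + κ i F) * Real.exp (-κ i F) := by simp only [hκ]; ring
          _ ≤ Real.exp (κ i F) * Real.exp (-κ i F) :=
              mul_le_mul_of_nonneg_right (by linarith) hexp.le
          _ = 1 := by rw [← Real.exp_add]; simp
    · simp
  have hmax := hm.measure_exists_le_prod (Y := fun i ω => exploited T τ (fun s => X s ω)
    (fun s => U s ω) i) (fun i => measurable_exploited_past T τ i) hgm h1
    (ENNReal.ofReal (Real.exp c)) (τ j + t)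
  refine measure_le_exp_neg (le_trans ?_ hmax)
  refine mul_le_mul' le_rfl (measure_mono ?_)
  rintro ω ⟨hE, hω⟩
  refine ⟨τ j + t, le_rfl, ?_⟩
  have hprod : ∀ u ≤ t, ∏ i ∈ Finset.range (τ j + u), g i
      (exploited T τ (fun s => X s ω) (fun s => U s ω) i) (X i ω, U i ω) =
      ENNReal.ofReal (Real.exp (l * ((runAt X U T τ j ω).gain k 0 u -
        μ * (runAt X U T τ j ω).count k 0 u / 2 -
        μ / K * ((runAt X U T τ j ω).mass k u - u / 2)) - l ^ 2 / 3 * (u / K))) := by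
    intro u
    induction u with
    | zero =>
      intro _
      rw [Finset.prod_eq_one, Run.count_self, Run.gain_self]
      · simp [Run.mass]
      · intro i hi
        rw [Finset.mem_range] at hi
        simp only [hg]
        rw [if_neg (by omega)]
    | succ u ih =>
      intro hu
      have hEu : exploited T τ (fun s => X s ω) (fun s => U s ω) (τ j + u) j = none :=
        explores_anti (by omega) hE
      rw [← add_assoc, Finset.prod_range_succ, ih (by omega), Run.count_succ _ _ (Nat.zero_le u),
        Run.gain_succ _ _ (Nat.zero_le u), Run.mass_succ]
      simp only [hg]
      rw [if_pos ⟨by omega, hEu⟩]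
      have hfree : (if k ∈ (runAt X U T τ j ω).taken u then (0 : ℝ) else
          (runAt X U T τ j ω).avail u) = freeProb (players τ (τ j + u))
          (exploited T τ (fun s => X s ω) (fun s => U s ω) (τ j + u)) j k := rfl
      rw [hfree]
      change _ * (if (runAt X U T τ j ω).arm u = k then
        ENNReal.ofReal (Real.exp (l * ((runAt X U T τ j ω).rew u - μ / 2) - _)) else _) = _
      split_ifs <;>
      · rw [← ENNReal.ofReal_mul (Real.exp_pos _).le, ← Real.exp_add]
        congr 2
        simp only [hκ]
        push_cast
        field_simp
        ring
  rw [hprod t le_rfl]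
  exact ENNReal.ofReal_le_ofReal (Real.exp_le_exp.2 hω)

/-- A long run of zero rewards on a free arm is unlikely. -/
lemma measure_zeros_le (hMK : M ≤ K) (hν : ∀ k, ν k (Set.Icc (0 : ℝ) 1)ᶜ = 0) (T : ℕ)
    (τ : Fin M → ℕ) (j : Fin M) (k : Fin K) (s n : ℕ) (c : ℝ) :
    P {ω | ∃ t, s ≤ t ∧ t ≤ n ∧ ExploresAt X U T τ j t ω ∧
      (∀ i, s ≤ i → i < t → k ∉ (runAt X U T τ j ω).taken i) ∧
      (∀ i, s ≤ i → i < t → (runAt X U T τ j ω).arm i = k → (runAt X U T τ j ω).rew i = 0) ∧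
      Real.exp 1 * c ≤ (runAt X U T τ j ω).count k s t * armMean ν k} ≤
      ENNReal.ofReal (Real.exp (-c)) := by
  have hprob := hm.isProbabilityMeasure_law
  have hK : (0 : ℝ) < K := by exact_mod_cast k.pos
  set μ := armMean ν k with hμ
  have hμ0 : 0 ≤ μ := armMean_nonneg hν k
  have hμ1 : μ ≤ 1 := armMean_le_one hν k
  -- A pull of a free arm gives `0` with probability at most `1 - γ μ ≤ 1 - θ ≤ exp (-θ)`. So the
  -- factor `exp θ` for a zero, `0` for a positive reward and `1` for no pull has mean at most `1`;
  -- along a run of zeros the product is `exp (θ · count)`. The maximal inequality covers all end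
  -- times `t` at once.
  set θ : ℝ := μ * Real.exp (-1) with hθ
  set g : ℕ → (Fin M → Option (Fin K)) → (Fin K → ℝ) × (Fin M → Fin K) → ℝ≥0∞ := fun i F z =>
    if τ j + s ≤ i ∧ F j = none ∧ k ∉ takenBy F j then (if z.2 j = k then
      (({0} : Set ℝ).indicator (fun _ => ENNReal.ofReal (Real.exp θ))
        (reward (players τ i) (armsPulled F z.2) z.1 j))
      else ENNReal.ofReal 1) else 1 with hg
  have hφ : Measurable (({0} : Set ℝ).indicator (fun _ => ENNReal.ofReal (Real.exp θ))) :=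
    measurable_const.indicator (measurableSet_singleton 0)
  have hgm : ∀ i, Measurable (Function.uncurry (g i)) := by
    intro i
    refine measurable_from_prod_countable_right fun F => ?_
    refine measurable_from_prod_countable_left fun v => ?_
    have hr : Measurable fun x : Fin K → ℝ => reward (players τ i) (armsPulled F v) x j := by
      have hp : Measurable fun x : Fin K → ℝ => (x, armsPulled F v) := measurable_prodMk_right
      exact (measurable_reward (players τ i) j).comp hp
    simp only [Function.uncurry, hg]
    split_ifs
    · exact hφ.comp hr
    · exact measurable_const
    · exact measurable_const
  have h1 : ∀ i ω', ∫⁻ ω, g i (exploited T τ (fun s => X s ω') (fun s => U s ω') i)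
      (X i ω, U i ω) ∂P ≤ 1 := by
    intro i ω'
    set F := exploited T τ (fun s => X s ω') (fun s => U s ω') i with hF
    simp only [hg]
    split_ifs with hi
    · refine (hm.lintegral_reward_le i k (mem_players.2 (by omega)) hi.2.1
        (fun j k h => mem_players.2 (le_of_exploited h)) hφ
        (a := (1 - μ) * Real.exp θ) (b := Real.exp θ)
        (mul_nonneg (by linarith) (Real.exp_pos _).le) (Real.exp_pos _).le zero_le_one ?_
        (by simp)).trans ?_
      · rw [lintegral_indicator_const (measurableSet_singleton 0), mul_comm,
          ENNReal.ofReal_mul (by linarith)]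
        gcongr
        exact law_singleton_zero_le hν k
      · rw [← ENNReal.ofReal_one]
        refine ENNReal.ofReal_le_ofReal ?_
        have hγ : Real.exp (-1) ≤ freeProb (players τ i) F j k := by
          unfold freeProb
          rw [if_neg hi.2.2]
          exact exp_neg_one_le_availability hMK _ _ j
        set γ := freeProb (players τ i) F j k
        have h2 : (1 - γ * μ) * Real.exp θ ≤ 1 := by
          have h3 := Real.add_one_le_exp (-θ)
          have h4 : θ ≤ γ * μ := by
            rw [hθ, mul_comm]; exact mul_le_mul_of_nonneg_right hγ hμ0
          calc (1 - γ * μ) * Real.exp θ ≤ Real.exp (-θ) * Real.exp θ :=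
                mul_le_mul_of_nonneg_right (by linarith) (Real.exp_pos _).le
            _ = 1 := by rw [← Real.exp_add]; simp
        have h5 : (K : ℝ)⁻¹ * ((1 - γ * μ) * Real.exp θ) ≤ (K : ℝ)⁻¹ * 1 := by gcongr
        linarith
    · simp
  have hmax := hm.measure_exists_le_prod (Y := fun i ω => exploited T τ (fun s => X s ω)
    (fun s => U s ω) i) (fun i => measurable_exploited_past T τ i) hgm h1
    (ENNReal.ofReal (Real.exp c)) (τ j + n)
  refine measure_le_exp_neg (le_trans ?_ hmax)
  refine mul_le_mul' le_rfl (measure_mono ?_)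
  rintro ω ⟨t, hst, htn, hE, hfree, hzero, hω⟩
  refine ⟨τ j + t, by omega, ?_⟩
  have hprod : ∀ u, s ≤ u → u ≤ t → ∏ i ∈ Finset.range (τ j + u), g i
      (exploited T τ (fun s => X s ω) (fun s => U s ω) i) (X i ω, U i ω) =
      ENNReal.ofReal (Real.exp (θ * (runAt X U T τ j ω).count k s u)) := by
    intro u hu
    induction u, hu using Nat.le_induction with
    | base =>
      intro _
      rw [Finset.prod_eq_one, Run.count_self]
      · simp
      · intro i hi
        rw [Finset.mem_range] at hi
        simp only [hg]
        rw [if_neg (by omega)]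
    | succ u hu ih =>
      intro hut
      have hEu : exploited T τ (fun s => X s ω) (fun s => U s ω) (τ j + u) j = none :=
        explores_anti (by omega) hE
      rw [← add_assoc, Finset.prod_range_succ, ih (by omega), Run.count_succ _ _ hu]
      simp only [hg]
      rw [if_pos ⟨by omega, hEu, hfree u hu (by omega)⟩]
      change _ * (if (runAt X U T τ j ω).arm u = k then
        (({0} : Set ℝ).indicator _ ((runAt X U T τ j ω).rew u)) else _) = _
      split_ifs with ha
      · rw [hzero u hu (by omega) ha, Set.indicator_of_mem (Set.mem_singleton 0),
          ← ENNReal.ofReal_mul (Real.exp_pos _).le, ← Real.exp_add]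
        push_cast
        ring_nf
      · simp
  rw [hprod t hst le_rfl]
  refine ENNReal.ofReal_le_ofReal (Real.exp_le_exp.2 ?_)
  have h2 : c = Real.exp (-1) * (Real.exp 1 * c) := by
    rw [← mul_assoc, ← Real.exp_add]; simp
  rw [h2, hθ]
  calc _ ≤ Real.exp (-1) * ((runAt X U T τ j ω).count k s t * μ) := by gcongr
    _ = _ := by ring

end IsModel

end Deviations

end

end DynMMAB

namespace DynMMAB

noncomputable section

/-! ### The probability that the deviations of a player are under control. -/

section Favorable

variable {K M : ℕ} {Ω : Type*} [mΩ : MeasurableSpace Ω]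
  {X : ℕ → Ω → Fin K → ℝ} {U : ℕ → Ω → Fin M → Fin K}
  {P : Measure Ω} [IsProbabilityMeasure P] {ν : Fin K → Measure ℝ}

/-- The constant `6` of the radius is tuned here: each deviation bound below leaves a third of this
quantity in the exponent, that is `2 log n`, hence a failure probability of `n⁻²`. -/
lemma div_mul_radius_sq {n t : ℕ} (hK : 0 < K) (ht : 1 ≤ t) :
    (t / K : ℝ) * (radius K n t / 2) ^ 2 = 6 * Real.log n := by
  have ht0 : (0 : ℝ) < t := by exact_mod_cast ht
  have hK0 : (0 : ℝ) < K := by exact_mod_cast hK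
  have hl : 0 ≤ Real.log n := Real.log_natCast_nonneg n
  have : radius K n t / 2 = Real.sqrt (6 * K * Real.log n / t) := by unfold radius; ring
  rw [this, Real.sq_sqrt (by positivity)]
  field_simp

namespace IsModel

variable (hm : IsModel P ν X U) (T : ℕ) (τ : Fin M → ℕ) (j : Fin M)

include hm

/-- The failure probability of the control of the gain of an arm at a given time. -/
lemma measure_not_gain_dev_le (hν : ∀ k, ν k (Set.Icc (0 : ℝ) 1)ᶜ = 0) (n : ℕ) (k : Fin K)
    {t : ℕ} (ht : 1 ≤ t) (hr : radius K n t ≤ 1) :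
    P {ω | ExploresAt X U T τ j t ω ∧ ¬ |(runAt X U T τ j ω).gain k 0 t -
        armMean ν k * (runAt X U T τ j ω).count k 0 t / 2 -
        armMean ν k / K * ((runAt X U T τ j ω).mass k t - t / 2)| <
        2 / 3 * (t / K) * (radius K n t / 2)} ≤
      2 * ENNReal.ofReal (Real.exp (-(2 * Real.log n))) := by
  have hr0 := radius_nonneg K n t
  have hb := div_mul_radius_sq (n := n) k.pos ht
  -- With `b = radius / 2`, the exponent is `(2/3) b² t / K - (1/3) b² t / K = 2 log n`.
  have h1 := hm.measure_gain_le hν T τ j k t (l := radius K n t / 2)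
    (by rw [abs_le]; constructor <;> linarith) (2 * Real.log n)
  have h2 := hm.measure_gain_le hν T τ j k t (l := -(radius K n t / 2))
    (by rw [abs_le]; constructor <;> linarith) (2 * Real.log n)
  rw [two_mul]
  refine le_trans (measure_mono ?_) ((measure_union_le _ _).trans (add_le_add h1 h2))
  rintro ω ⟨hE, hω⟩
  rw [not_lt] at hω
  have hb0 : 0 ≤ radius K n t / 2 := by linarith
  rcases le_abs.1 hω with h3 | h3
  · refine Or.inl ⟨hE, ?_⟩
    have := mul_le_mul_of_nonneg_left h3 hb0
    linarith
  · refine Or.inr ⟨hE, ?_⟩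
    have := mul_le_mul_of_nonneg_left h3 hb0
    linarith

lemma measure_not_count_lt_le (n : ℕ) (k : Fin K) {t : ℕ} (ht : 1 ≤ t) (hr : radius K n t ≤ 1) :
    P {ω | ¬ ((runAt X U T τ j ω).count k 0 t : ℝ) < t / K * (1 + 4 / 3 * (radius K n t / 2))} ≤
      ENNReal.ofReal (Real.exp (-(2 * Real.log n))) := by
  have hr0 := radius_nonneg K n t
  have hb := div_mul_radius_sq (n := n) k.pos ht
  have hK0 : (0 : ℝ) < K := by exact_mod_cast k.pos
  set b := radius K n t / 2 with hb'
  refine le_trans (measure_mono ?_) (hm.measure_count_le T τ j k 0 t (Nat.zero_le t) (l := b)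
    (κ := (b + b ^ 2) / K) ?_ (2 * Real.log n))
  · intro ω hω
    have hω : (t / K : ℝ) * (1 + 4 / 3 * b) ≤ (runAt X U T τ j ω).count k 0 t := not_lt.1 hω
    have h1 := mul_le_mul_of_nonneg_left hω (show 0 ≤ b by linarith)
    have h2 : ((t : ℝ) - (0 : ℕ)) * ((b + b ^ 2) / K) = t / K * b + t / K * b ^ 2 := by
      push_cast; ring
    change 2 * Real.log n ≤ _
    rw [h2]
    linarith
  · have := exp_le_quadratic (x := b) (by rw [abs_le]; constructor <;> linarith)
    rw [div_mul_cancel₀ _ hK0.ne']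
    linarith

/-- The sharper bound `exp (-b) ≤ 1 - b + b² / 2` allows the constant `5/6 = 1/2 + 1/3`, against
`4/3 = 1 + 1/3` for the upper deviation. -/
lemma measure_not_lt_count_le (n : ℕ) (k : Fin K) {t : ℕ} (ht : 1 ≤ t) :
    P {ω | ¬ (t / K : ℝ) * (1 - 5 / 6 * (radius K n t / 2)) < (runAt X U T τ j ω).count k 0 t} ≤
      ENNReal.ofReal (Real.exp (-(2 * Real.log n))) := by
  have hr0 := radius_nonneg K n t
  have hb := div_mul_radius_sq (n := n) k.pos ht
  have hK0 : (0 : ℝ) < K := by exact_mod_cast k.pos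
  set b := radius K n t / 2 with hb'
  refine le_trans (measure_mono ?_) (hm.measure_count_le T τ j k 0 t (Nat.zero_le t) (l := -b)
    (κ := (-b + b ^ 2 / 2) / K) ?_ (2 * Real.log n))
  · intro ω hω
    have hω : (runAt X U T τ j ω).count k 0 t ≤ (t / K : ℝ) * (1 - 5 / 6 * b) := not_lt.1 hω
    have h1 := mul_le_mul_of_nonneg_left hω (show 0 ≤ b by linarith)
    have h2 : ((t : ℝ) - (0 : ℕ)) * ((-b + b ^ 2 / 2) / K) = -(t / K * b) + t / K * b ^ 2 / 2 := by
      push_cast; ring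
    change 2 * Real.log n ≤ _
    rw [h2]
    linarith
  · have := exp_neg_le_quadratic (b := b) (by linarith)
    rw [div_mul_cancel₀ _ hK0.ne']
    linarith

/-- The expected count is `8 m`. With `l = -1/2`, a count of at most `4 m` contributes at least `-2
m` and the compensator contributes `3 m`, which leaves `m ≥ c`. -/
lemma measure_not_window_le (k : Fin K) (s : ℕ) {m : ℕ} {c : ℝ} (hc : c ≤ m) :
    P {ω | ¬ 4 * m ≤ (runAt X U T τ j ω).count k s (s + 8 * K * m)} ≤
      ENNReal.ofReal (Real.exp (-c)) := by
  have hK0 : (0 : ℝ) < K := by exact_mod_cast k.pos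
  refine le_trans (measure_mono ?_) (hm.measure_count_le T τ j k s (s + 8 * K * m)
    (Nat.le_add_right _ _) (l := -(1 / 2)) (κ := (-(1 / 2) + (1 / 2) ^ 2 / 2) / K) ?_ c)
  · intro ω hω
    have hω : ((runAt X U T τ j ω).count k s (s + 8 * K * m) : ℝ) ≤ 4 * m := by
      exact_mod_cast (not_le.1 hω).le
    have h2 : (((s + 8 * K * m : ℕ) : ℝ) - s) * ((-(1 / 2) + (1 / 2) ^ 2 / 2) / K) = -(3 * m) := by
      push_cast; field_simp; ring
    change c ≤ _
    rw [h2]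
    linarith
  · have := exp_neg_le_quadratic (b := 1 / 2) (by norm_num)
    rw [div_mul_cancel₀ _ hK0.ne']
    linarith

/-- The probability that the deviations that concern player `j` are not under control. -/
theorem measure_not_isFavorable_le (hMK : M ≤ K) (hν : ∀ k, ν k (Set.Icc (0 : ℝ) 1)ᶜ = 0)
    {m : ℕ} (hj : τ j < T) (hmn : 2 * Real.log (T - τ j : ℕ) ≤ m) :
    P {ω | ¬ IsFavorable T τ (fun s => X s ω) (fun s => U s ω) (armMean ν) m j} ≤
      ENNReal.ofReal (12 * K / (T - τ j : ℕ)) := by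
  set n := T - τ j with hn
  have hn1 : 1 ≤ n := by omega
  have hn0 : (0 : ℝ) < n := by exact_mod_cast hn1
  have hK1 : (1 : ℝ) ≤ K := by have := j.pos; exact_mod_cast (by omega : 1 ≤ K)
  -- For `n = 1` the event fails by `IsFavorable.two_le`, but the bound claimed is then at least
  -- `1`.
  rcases Nat.lt_or_ge n 2 with hn2 | hn2
  · have : n = 1 := by omega
    refine prob_le_one.trans ?_
    rw [this, ← ENNReal.ofReal_one]
    refine ENNReal.ofReal_le_ofReal ?_
    push_cast
    linarith
  set ε := ENNReal.ofReal (Real.exp (-(2 * Real.log n))) with hε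
  set S₁ : Fin K → ℕ → Set Ω := fun k t => {ω | (1 ≤ t ∧ radius K n t ≤ 1) ∧
    ExploresAt X U T τ j t ω ∧ ¬ |(runAt X U T τ j ω).gain k 0 t -
        armMean ν k * (runAt X U T τ j ω).count k 0 t / 2 -
        armMean ν k / K * ((runAt X U T τ j ω).mass k t - t / 2)| <
        2 / 3 * (t / K) * (radius K n t / 2)} with hS₁
  set S₂ : Fin K → ℕ → Set Ω := fun k t => {ω | (1 ≤ t ∧ radius K n t ≤ 1) ∧
    ¬ ((runAt X U T τ j ω).count k 0 t : ℝ) < t / K * (1 + 4 / 3 * (radius K n t / 2))} with hS₂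
  set S₃ : Fin K → ℕ → Set Ω := fun k t => {ω | 1 ≤ t ∧
    ¬ (t / K : ℝ) * (1 - 5 / 6 * (radius K n t / 2)) < (runAt X U T τ j ω).count k 0 t} with hS₃
  set S₄ : Fin K → ℕ → Set Ω := fun k s =>
    {ω | ¬ 4 * m ≤ (runAt X U T τ j ω).count k s (s + 8 * K * m)} with hS₄
  set S₅ : Fin K → ℕ → Set Ω := fun k s => {ω | ∃ t, s ≤ t ∧ t ≤ n ∧ ExploresAt X U T τ j t ω ∧
      (∀ i, s ≤ i → i < t → k ∉ (runAt X U T τ j ω).taken i) ∧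
      (∀ i, s ≤ i → i < t → (runAt X U T τ j ω).arm i = k → (runAt X U T τ j ω).rew i = 0) ∧
      Real.exp 1 * (2 * Real.log n) ≤ (runAt X U T τ j ω).count k s t * armMean ν k} with hS₅
  have h1 : ∀ k t, P (S₁ k t) ≤ 2 * ε := by
    intro k t
    by_cases h : 1 ≤ t ∧ radius K n t ≤ 1
    · exact (measure_mono fun ω hω => hω.2).trans
        (hm.measure_not_gain_dev_le T τ j hν n k h.1 h.2)
    · simp [hS₁, h]
  have h2 : ∀ k t, P (S₂ k t) ≤ ε := by
    intro k t
    by_cases h : 1 ≤ t ∧ radius K n t ≤ 1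
    · exact (measure_mono fun ω hω => hω.2).trans
        (hm.measure_not_count_lt_le T τ j n k h.1 h.2)
    · simp [hS₂, h]
  have h3 : ∀ k t, P (S₃ k t) ≤ ε := by
    intro k t
    by_cases h : 1 ≤ t
    · exact (measure_mono fun ω hω => hω.2).trans (hm.measure_not_lt_count_le T τ j n k h)
    · simp [hS₃, h]
  have h4 : ∀ k t, P (S₄ k t) ≤ ε := fun k t => hm.measure_not_window_le T τ j k t hmn
  have h5 : ∀ k t, P (S₅ k t) ≤ ε := fun k t => hm.measure_zeros_le hMK hν T τ j k t n _
  have hsub : {ω | ¬ IsFavorable T τ (fun s => X s ω) (fun s => U s ω) (armMean ν) m j} ⊆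
      ⋃ k, ⋃ t ∈ Finset.range (n + 1),
        (S₁ k t ∪ (S₂ k t ∪ (S₃ k t ∪ (S₄ k t ∪ S₅ k t)))) := by
    intro ω hω
    by_contra hno
    apply hω
    have hno' : ∀ k t, t ≤ n → ω ∉ S₁ k t ∧ ω ∉ S₂ k t ∧ ω ∉ S₃ k t ∧ ω ∉ S₄ k t ∧ ω ∉ S₅ k t := by
      intro k t ht
      have : ω ∉ S₁ k t ∪ (S₂ k t ∪ (S₃ k t ∪ (S₄ k t ∪ S₅ k t))) := fun h =>
        hno (Set.mem_iUnion.2 ⟨k, Set.mem_iUnion₂.2 ⟨t, Finset.mem_range.2 (by omega), h⟩⟩)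
      simpa only [Set.mem_union, not_or] using this
    refine ⟨hn2, ?_, ?_, ?_, ?_, ?_⟩
    · intro k t ht htn hr hE
      by_contra hc
      exact (hno' k t htn).1 ⟨⟨ht, hr⟩, hE, hc⟩
    · intro k t ht htn hr
      by_contra hc
      exact (hno' k t htn).2.2.1 ⟨ht, hc⟩
    · intro k t ht htn hr
      by_contra hc
      exact (hno' k t htn).2.1 ⟨⟨ht, hr⟩, hc⟩
    · intro k s hs
      by_contra hc
      exact (hno' k s hs).2.2.2.1 hc
    · intro k s t hst ht hE hfree hzero
      by_contra hc
      refine (hno' k s (hst.trans ht)).2.2.2.2 ⟨t, hst, ht, hE, hfree, hzero, ?_⟩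
      rw [not_lt] at hc
      linarith
  -- The gain counts twice, for its two signs. The union over `K` arms and `n + 1` times then costs
  -- `6 K (n + 1) / n² ≤ 12 K / n`.
  have hterm : ∀ k t, P (S₁ k t ∪ (S₂ k t ∪ (S₃ k t ∪ (S₄ k t ∪ S₅ k t)))) ≤ 6 * ε := by
    intro k t
    calc _ ≤ P (S₁ k t) + (P (S₂ k t) + (P (S₃ k t) + (P (S₄ k t) + P (S₅ k t)))) := by
          refine (measure_union_le _ _).trans (add_le_add le_rfl ?_)
          refine (measure_union_le _ _).trans (add_le_add le_rfl ?_)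
          refine (measure_union_le _ _).trans (add_le_add le_rfl ?_)
          exact measure_union_le _ _
      _ ≤ 2 * ε + (ε + (ε + (ε + ε))) :=
          add_le_add (h1 k t) (add_le_add (h2 k t) (add_le_add (h3 k t)
            (add_le_add (h4 k t) (h5 k t))))
      _ = 6 * ε := by ring
  have hε' : ε = ENNReal.ofReal (((n : ℝ) ^ 2)⁻¹) := by
    rw [hε, Real.exp_neg, two_mul, Real.exp_add, Real.exp_log hn0, sq]
  calc _ ≤ ∑ k : Fin K, ∑ t ∈ Finset.range (n + 1),
        P (S₁ k t ∪ (S₂ k t ∪ (S₃ k t ∪ (S₄ k t ∪ S₅ k t)))) := by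
        refine (measure_mono hsub).trans ((measure_iUnion_fintype_le _ _).trans ?_)
        exact Finset.sum_le_sum fun k _ => measure_biUnion_finset_le _ _
    _ ≤ ∑ k : Fin K, ∑ t ∈ Finset.range (n + 1), 6 * ε :=
        Finset.sum_le_sum fun k _ => Finset.sum_le_sum fun t _ => hterm k t
    _ = ENNReal.ofReal (K * ((n + 1) * (6 * ((n : ℝ) ^ 2)⁻¹))) := by
        rw [hε', Finset.sum_const, Finset.sum_const, Finset.card_univ, Fintype.card_fin,
          Finset.card_range, nsmul_eq_mul, nsmul_eq_mul, ENNReal.ofReal_mul (by positivity),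
          ENNReal.ofReal_mul (by positivity), ENNReal.ofReal_mul (by positivity),
          ENNReal.ofReal_natCast]
        congr 3
        · rw [← ENNReal.ofReal_natCast]; push_cast; rfl
        · simp
    _ ≤ _ := by
        refine ENNReal.ofReal_le_ofReal ?_
        have h6 : ((n : ℝ) + 1) * (6 * ((n : ℝ) ^ 2)⁻¹) ≤ 12 / n := by
          have : (1 : ℝ) ≤ n := by exact_mod_cast hn1
          rw [le_div_iff₀ hn0]
          have e : ((n : ℝ) + 1) * (6 * ((n : ℝ) ^ 2)⁻¹) * n = 6 * (n + 1) / n := by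
            field_simp
          rw [e, div_le_iff₀ hn0]
          linarith
        calc _ ≤ (K : ℝ) * (12 / n) := by gcongr
          _ = _ := by ring

end IsModel

end Favorable

end

end DynMMAB

namespace DynMMAB

noncomputable section

/-! ### The regret of a stage -/

section StageLoss

variable {K M : ℕ} {μ : Fin K → ℝ} {A : Finset (Fin M)} {F : Fin M → Option (Fin K)}

/-- The arms that are exploited by some player. -/
def exploitedArms (F : Fin M → Option (Fin K)) : Finset (Fin K) :=
  Finset.univ.filter (fun k => ∃ j, F j = some k)

/-- The players of `A` that explore. -/
def explorers (A : Finset (Fin M)) (F : Fin M → Option (Fin K)) : Finset (Fin M) :=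
  A.filter (fun j => F j = none)

lemma mem_exploitedArms {k : Fin K} : k ∈ exploitedArms F ↔ ∃ j, F j = some k := by
  simp [exploitedArms]

lemma card_exploitedArms_le (F : Fin M → Option (Fin K)) : (exploitedArms F).card ≤ M := by
  classical
  have hsub : (exploitedArms F).map ⟨some, Option.some_injective _⟩ ⊆ Finset.univ.image F := by
    intro o ho
    simp only [Finset.mem_map, mem_exploitedArms] at ho
    obtain ⟨k, ⟨j, hF⟩, rfl⟩ := ho
    exact Finset.mem_image.2 ⟨j, Finset.mem_univ _, hF⟩
  simpa using (Finset.card_le_card hsub).trans Finset.card_image_le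

lemma card_le_card_fin (A : Finset (Fin M)) : A.card ≤ M := by
  simpa using Finset.card_le_univ A

/-- A collision on an exploited arm is due to an explorer. -/
lemma IsWellPlaced.sum_value_le (h : IsWellPlaced μ A F) {x : Fin K → ℝ}
    (hx : ∀ k, 0 ≤ x k ∧ x k ≤ 1) (v : Fin M → Fin K) :
    ∑ k ∈ exploitedArms F, x k ≤
      ∑ j ∈ A, reward A (armsPulled F v) x j + (explorers A F).card := by
  classical
  set r := reward A (armsPulled F v) x with hr
  have hr0 : ∀ j, 0 ≤ r j := fun j => (reward_mem A _ hx j).1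
  -- Either an explorer hits `k`, and `x k ≤ 1` is charged to her, or the exploiting player is alone
  -- on `k` and collects `x k`. An explorer hits one arm only, so she is charged at most once.
  have hk : ∀ k ∈ exploitedArms F, x k ≤ ∑ j ∈ A, (if F j = some k then r j else 0) +
      ∑ e ∈ explorers A F, (if v e = k then (1 : ℝ) else 0) := by
    intro k hk
    obtain ⟨j, hj⟩ := mem_exploitedArms.1 hk
    have hjA := h.mem j k hj
    have hn1 : 0 ≤ ∑ j ∈ A, (if F j = some k then r j else 0) :=
      Finset.sum_nonneg fun j _ => by split_ifs <;> simp [hr0]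
    have hn2 : 0 ≤ ∑ e ∈ explorers A F, (if v e = k then (1 : ℝ) else 0) :=
      Finset.sum_nonneg fun j _ => by split_ifs <;> simp
    by_cases he : ∃ e ∈ explorers A F, v e = k
    · obtain ⟨e, he, hv⟩ := he
      have h1 := Finset.single_le_sum (f := fun e => if v e = k then (1 : ℝ) else 0)
        (fun e _ => by split_ifs <;> simp) he
      simp only [hv, if_true] at h1
      linarith [(hx k).2]
    · push Not at he
      have h1 := Finset.single_le_sum (f := fun j => if F j = some k then r j else 0)
        (fun e _ => by split_ifs <;> simp [hr0]) hjA
      simp only [hj, if_true] at h1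
      have hpj : armsPulled F v j = k := by simp [armsPulled, hj]
      have h2 : r j = x k := by
        rw [hr, reward_eq_value, hpj]
        intro j' hj' hne
        rw [hpj]
        rcases hF' : F j' with _ | l
        · simpa [armsPulled, hF'] using he j' (by simp [explorers, hj', hF'])
        · intro e
          simp only [armsPulled, hF', Option.getD_some] at e
          exact hne (h.inj j' j k (e ▸ hF') hj)
      linarith
  refine (Finset.sum_le_sum hk).trans ?_
  rw [Finset.sum_add_distrib, Finset.sum_comm, Finset.sum_comm (t := explorers A F)]
  refine add_le_add (Finset.sum_le_sum fun j _ => ?_) ?_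
  · rcases hF : F j with _ | l
    · simpa using hr0 j
    · simp only [Option.some.injEq, Finset.sum_ite_eq]
      split_ifs <;> simp [hr0]
  · rw [Finset.card_eq_sum_ones]
    push_cast
    refine Finset.sum_le_sum fun e _ => ?_
    rw [Finset.sum_ite_eq]
    split_ifs <;> simp

lemma IsWellPlaced.card_le (h : IsWellPlaced μ A F) :
    A.card ≤ (exploitedArms F).card + (explorers A F).card := by
  classical
  have hsub : (A.filter (fun j => ¬ F j = none)).image F ⊆
      (exploitedArms F).map ⟨some, Option.some_injective _⟩ := by
    intro o ho
    obtain ⟨j, hj, rfl⟩ := Finset.mem_image.1 ho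
    obtain ⟨k, hk⟩ := Option.ne_none_iff_exists'.1 (Finset.mem_filter.1 hj).2
    exact Finset.mem_map.2 ⟨k, mem_exploitedArms.2 ⟨j, hk⟩, hk.symm⟩
  have hinj : Set.InjOn F (A.filter (fun j => ¬ F j = none)) := by
    intro j hj j' _ he
    obtain ⟨k, hk⟩ := Option.ne_none_iff_exists'.1 (Finset.mem_filter.1 hj).2
    exact h.inj j j' k hk (he ▸ hk)
  have h1 := Finset.card_le_card hsub
  rw [Finset.card_image_of_injOn hinj, Finset.card_map] at h1
  have h2 := Finset.card_filter_add_card_filter_not (s := A) (fun j => F j = none)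
  unfold explorers
  omega

lemma sum_orderStat_le_add (hμ : ∀ k, 0 ≤ μ k ∧ μ k ≤ 1) {a b c : ℕ} (h : a ≤ b + c) :
    ∑ n ∈ Finset.Icc 1 a, orderStat μ n ≤ ∑ n ∈ Finset.Icc 1 b, orderStat μ n + c := by
  have hsub : Finset.Icc 1 a ⊆ Finset.Icc 1 b ∪ Finset.Ioc b (b + c) := by
    intro n hn
    simp only [Finset.mem_Icc, Finset.mem_union, Finset.mem_Ioc] at hn ⊢
    omega
  have hdis : Disjoint (Finset.Icc 1 b) (Finset.Ioc b (b + c)) := by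
    rw [Finset.disjoint_left]
    intro n h1 h2
    simp only [Finset.mem_Icc, Finset.mem_Ioc] at h1 h2
    omega
  refine (Finset.sum_le_sum_of_subset_of_nonneg hsub
    fun n _ _ => orderStat_nonneg (fun k => (hμ k).1) n).trans ?_
  rw [Finset.sum_union hdis]
  gcongr
  refine (Finset.sum_le_card_nsmul _ _ 1 fun n _ => orderStat_le_one (fun k => (hμ k).2) n).trans ?_
  simp

/-- The loss of a stage, up to a term that is centred given the past. -/
lemma stage_loss_le (hμ : ∀ k, 0 ≤ μ k ∧ μ k ≤ 1) {x : Fin K → ℝ}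
    (hx : ∀ k, 0 ≤ x k ∧ x k ≤ 1) (v : Fin M → Fin K) {b : ℝ} (hb : 0 ≤ b)
    (h : ¬ IsWellPlaced μ A F → 1 ≤ b) :
    ∑ n ∈ Finset.Icc 1 A.card, orderStat μ n - ∑ j ∈ A, reward A (armsPulled F v) x j ≤
      ∑ k ∈ exploitedArms F, (μ k - x k) + 2 * (explorers A F).card + 2 * M * b := by
  rw [Finset.sum_sub_distrib]
  -- If the players are well placed, an explorer is charged once for the arm that she does not
  -- exploit and once for the collision that she may cause. If not, the stage loses at most `M` and
  -- the centred term is at least `-M`, whence `2 M`.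
  by_cases hw : IsWellPlaced μ A F
  · have h1 := hw.sum_value_le hx v
    have h2 := sum_orderStat_le_add hμ hw.card_le
    have h3 : ∑ n ∈ Finset.Icc 1 (exploitedArms F).card, orderStat μ n ≤
        ∑ k ∈ exploitedArms F, μ k := by
      refine sum_orderStat_le fun k hk l hkl => ?_
      obtain ⟨j, hj⟩ := mem_exploitedArms.1 hk
      exact mem_exploitedArms.2 (hw.better j k l hj hkl)
    have h4 : 0 ≤ 2 * M * b := by positivity
    linarith
  · have h1 : 0 ≤ ∑ j ∈ A, reward A (armsPulled F v) x j :=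
      Finset.sum_nonneg fun j _ => (reward_mem A _ hx j).1
    have h2 := sum_orderStat_le_add hμ (a := A.card) (b := 0) (c := M)
      (by simpa using card_le_card_fin A)
    have h3 : 0 ≤ ∑ k ∈ exploitedArms F, μ k := Finset.sum_nonneg fun k _ => (hμ k).1
    have h4 : ∑ k ∈ exploitedArms F, x k ≤ M := by
      refine (Finset.sum_le_card_nsmul _ _ 1 fun k _ => (hx k).2).trans ?_
      simpa using card_exploitedArms_le F
    have h5 : (2 * M : ℝ) ≤ 2 * M * b := le_mul_of_one_le_right (by positivity) (h hw)
    have h6 : (0 : ℝ) ≤ (explorers A F).card := by positivity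
    simp only [Finset.Icc_eq_empty_of_lt Nat.zero_lt_one, Finset.sum_empty, zero_add] at h2
    linarith

end StageLoss

/-! ### The loss summed over the stages, on a fixed outcome. -/

section TotalLoss

variable {K M : ℕ} {T : ℕ} {τ : Fin M → ℕ} {x : ℕ → Fin K → ℝ} {u : ℕ → Fin M → Fin K}
  {μ : Fin K → ℝ}

lemma sum_card_explorers :
    ∑ s ∈ Finset.range T, ((explorers (players τ s) (exploited T τ x u s)).card : ℝ) =
      ∑ j, (((Finset.range T).filter
        (fun s => τ j ≤ s ∧ exploited T τ x u s j = none)).card : ℝ) := by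
  simp only [explorers, players, Finset.filter_filter, Finset.card_filter]
  push_cast
  exact Finset.sum_comm

lemma sum_players_le (B : Fin M → ℝ) :
    ∑ s ∈ Finset.range T, ∑ j ∈ players τ s, B j = ∑ j, ((T - τ j : ℕ) : ℝ) * B j := by
  simp only [players, Finset.sum_filter]
  rw [Finset.sum_comm]
  refine Finset.sum_congr rfl fun j _ => ?_
  rw [← Finset.sum_filter, Finset.sum_const, nsmul_eq_mul]
  congr 2
  have : (Finset.range T).filter (fun s => τ j ≤ s) = Finset.Ico (τ j) T := by
    ext s; simp [and_comm]
  rw [this, Nat.card_Ico]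

/-- The loss of the game, up to terms that are centred given the past; `b j` is at least `1` if
some deviation that concerns player `j` is out of control. -/
theorem total_loss_le (hM : 1 ≤ M) (hMK : M ≤ K) (hμ : ∀ k, 0 ≤ μ k ∧ μ k ≤ 1)
    (hx : ∀ s k, 0 ≤ x s k ∧ x s k ≤ 1) (hΔ : 0 < minGap μ M)
    {b : Fin M → ℝ} (hb : ∀ j, 0 ≤ b j)
    (h : ∀ j, ¬ IsFavorable T τ x u μ (blockBound (T - τ j) (orderStat μ M)) j → 1 ≤ b j) :
    (∑ s ∈ Finset.range T, ∑ n ∈ Finset.Icc 1 (players τ s).card, orderStat μ n) -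
        totalReward T τ x u ≤
      (∑ s ∈ Finset.range T, ∑ k ∈ exploitedArms (exploited T τ x u s), (μ k - x s k)) +
      2 * ∑ j, ((accurateTime K (T - τ j) (minGap μ M) +
        4 * (8 * K * blockBound (T - τ j) (orderStat μ M)) * M : ℕ) : ℝ) +
      (2 * M + 2) * ∑ j, ((T - τ j : ℕ) : ℝ) * b j := by
  have hstage : ∀ s ∈ Finset.range T,
      (∑ n ∈ Finset.Icc 1 (players τ s).card, orderStat μ n) -
        ∑ j ∈ players τ s, stageReward T τ x u s j ≤
      ∑ k ∈ exploitedArms (exploited T τ x u s), (μ k - x s k) +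
        2 * (explorers (players τ s) (exploited T τ x u s)).card +
        2 * M * ∑ j ∈ players τ s, b j := by
    intro s hs
    -- Only players who have entered can spoil the placement at stage `s`. An unfavorable player `j`
    -- is thus charged on `T - τ j` stages rather than `T`, which matches her failure probability.
    refine stage_loss_le hμ (hx s) (u s) (Finset.sum_nonneg fun j _ => hb j) fun hw => ?_
    have : ∃ j, τ j ≤ s ∧
        ¬ IsFavorable T τ x u μ (blockBound (T - τ j) (orderStat μ M)) j := by
      by_contra hall
      push Not at hall
      exact hw (isWellPlaced hMK hμ hx (Finset.mem_range.1 hs).le hall)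
    obtain ⟨j, hj, hbad⟩ := this
    exact (h j hbad).trans (Finset.single_le_sum (fun j _ => hb j) (mem_players.2 hj))
  -- An unfavorable player may explore until the horizon. Each exploration stage costs `2`, which
  -- adds the `2` in `2 * M + 2`.
  have hexp : ∀ j, (((Finset.range T).filter
      (fun s => τ j ≤ s ∧ exploited T τ x u s j = none)).card : ℝ) ≤
      ((accurateTime K (T - τ j) (minGap μ M) +
        4 * (8 * K * blockBound (T - τ j) (orderStat μ M)) * M : ℕ) : ℝ) +
      ((T - τ j : ℕ) : ℝ) * b j := by
    intro j
    by_cases hf : IsFavorable T τ x u μ (blockBound (T - τ j) (orderStat μ M)) j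
    · have h1 := card_explores_le hM hMK hμ hx hΔ hf
      have h2 : 0 ≤ ((T - τ j : ℕ) : ℝ) * b j := mul_nonneg (by positivity) (hb j)
      have h3 := (Nat.cast_le (α := ℝ)).2 h1
      linarith
    · have h1 : ((Finset.range T).filter
          (fun s => τ j ≤ s ∧ exploited T τ x u s j = none)).card ≤ T - τ j := by
        rw [← Nat.card_Ico]
        refine Finset.card_le_card fun s hs => ?_
        simp only [Finset.mem_filter, Finset.mem_range] at hs
        exact Finset.mem_Ico.2 ⟨hs.2.1, hs.1⟩
      have h2 : ((T - τ j : ℕ) : ℝ) ≤ ((T - τ j : ℕ) : ℝ) * b j :=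
        le_mul_of_one_le_right (by positivity) (h j hf)
      have h3 := (Nat.cast_le (α := ℝ)).2 h1
      have h4 : (0 : ℝ) ≤ ((accurateTime K (T - τ j) (minGap μ M) +
        4 * (8 * K * blockBound (T - τ j) (orderStat μ M)) * M : ℕ) : ℝ) := Nat.cast_nonneg _
      linarith
  have h1 := Finset.sum_le_sum hstage
  have h2 := Finset.sum_le_sum fun j (_ : j ∈ Finset.univ) => hexp j
  rw [← sum_card_explorers, Finset.sum_add_distrib] at h2
  rw [Finset.sum_sub_distrib, Finset.sum_add_distrib, Finset.sum_add_distrib, ← Finset.mul_sum,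
    ← Finset.mul_sum, sum_players_le b] at h1
  unfold totalReward
  linarith

end TotalLoss

end

end DynMMAB

namespace DynMMAB

noncomputable section

/-! ### The expected regret -/

lemma two_mul_log_le_blockBound (n : ℕ) {μ₀ : ℝ} (h0 : 0 < μ₀) (h1 : μ₀ ≤ 1) :
    2 * Real.log n ≤ blockBound n μ₀ := by
  refine le_trans ?_ (Nat.le_ceil _)
  have hl := Real.log_natCast_nonneg n
  have hE : (1 : ℝ) ≤ Real.exp 1 ^ 2 := one_le_pow₀ (Real.one_le_exp zero_le_one)
  calc 2 * Real.log n ≤ 8 * Real.exp 1 ^ 2 * Real.log n := by nlinarith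
    _ ≤ _ := le_div_self (by positivity) h0 h1

section Regret

variable {K M : ℕ} {Ω : Type*} [mΩ : MeasurableSpace Ω]
  {X : ℕ → Ω → Fin K → ℝ} {U : ℕ → Ω → Fin M → Fin K}
  {P : Measure Ω} [IsProbabilityMeasure P] {ν : Fin K → Measure ℝ}

namespace IsModel

variable (hm : IsModel P ν X U)

include hm

omit [IsProbabilityMeasure P] in
lemma measurable_value_apply (s : ℕ) (k : Fin K) : Measurable fun ω => X s ω k :=
  (measurable_pi_apply k).comp (hm.measurable_value s)

omit [IsProbabilityMeasure P] in
lemma ae_value_mem (hν : ∀ k, ν k (Set.Icc (0 : ℝ) 1)ᶜ = 0) :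
    ∀ᵐ ω ∂P, ∀ s k, 0 ≤ X s ω k ∧ X s ω k ≤ 1 := by
  refine ae_all_iff.2 fun s => ae_all_iff.2 fun k => ?_
  have h := ae_mem_Icc hν k
  rw [← hm.law_value s k] at h
  exact ae_of_ae_map (hm.measurable_value_apply s k).aemeasurable h

lemma integrable_value (hν : ∀ k, ν k (Set.Icc (0 : ℝ) 1)ᶜ = 0) (s : ℕ) (k : Fin K) :
    Integrable (fun ω => X s ω k) P := by
  refine Integrable.of_bound (hm.measurable_value_apply s k).aestronglyMeasurable 1 ?_
  filter_upwards [hm.ae_value_mem hν] with ω hω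
  rw [Real.norm_eq_abs, abs_of_nonneg (hω s k).1]
  exact (hω s k).2

omit [IsProbabilityMeasure P] in
lemma integral_value (s : ℕ) (k : Fin K) : ∫ ω, X s ω k ∂P = armMean ν k := by
  unfold armMean
  rw [← hm.law_value s k]
  exact (integral_map (hm.measurable_value_apply s k).aemeasurable
    measurable_id.aestronglyMeasurable).symm

omit hm [IsProbabilityMeasure P] in
lemma sum_exploitedArms_eq (F : Fin M → Option (Fin K)) (f : Fin K → ℝ) :
    ∑ k ∈ exploitedArms F, f k = ∑ k, (if k ∈ exploitedArms F then 1 else 0) * f k := by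
  simp

/-- The values of the arms exploited at a stage are centred given the past. -/
lemma integral_exploited_value (hν : ∀ k, ν k (Set.Icc (0 : ℝ) 1)ᶜ = 0) (T : ℕ) (τ : Fin M → ℕ)
    (s : ℕ) :
    Integrable (fun ω => ∑ k ∈ exploitedArms
      (exploited T τ (fun i => X i ω) (fun i => U i ω) s), (armMean ν k - X s ω k)) P ∧
    ∫ ω, ∑ k ∈ exploitedArms (exploited T τ (fun i => X i ω) (fun i => U i ω) s),
      (armMean ν k - X s ω k) ∂P = 0 := by
  simp only [sum_exploitedArms_eq]
  set I : Fin K → Ω → ℝ := fun k ω =>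
    if k ∈ exploitedArms (exploited T τ (fun i => X i ω) (fun i => U i ω) s) then 1 else 0 with hI
  have hIm : ∀ k, Measurable[past X U s] (I k) := fun k =>
    (Measurable.of_discrete (f := fun F : Fin M → Option (Fin K) =>
      if k ∈ exploitedArms F then (1 : ℝ) else 0)).comp (measurable_exploited_past T τ s)
  have hIm' : ∀ k, Measurable (I k) := fun k => (hIm k).mono (hm.past_le s) le_rfl
  have hYi : ∀ k, Integrable (fun ω => armMean ν k - X s ω k) P := fun k =>
    (integrable_const _).sub (hm.integrable_value hν s k)
  have hint : ∀ k, Integrable (fun ω => I k ω * (armMean ν k - X s ω k)) P := fun k =>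
    (hYi k).bdd_mul (hIm' k).aestronglyMeasurable (c := 1)
      (Filter.Eventually.of_forall fun ω => by simp only [hI]; split_ifs <;> simp)
  refine ⟨integrable_finsetSum _ fun k _ => hint k, ?_⟩
  rw [integral_finsetSum _ fun k _ => hint k]
  refine Finset.sum_eq_zero fun k _ => ?_
  have hind := (hm.indepFun_past (hIm k)).comp measurable_id
    (ψ := fun z : (Fin K → ℝ) × (Fin M → Fin K) => armMean ν k - z.1 k)
    (measurable_const.sub ((measurable_pi_apply k).comp measurable_fst))
  have h := hind.integral_fun_mul_eq_mul_integral (hIm' k).aestronglyMeasurable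
    (hYi k).aestronglyMeasurable
  refine h.trans ?_
  have h0 : ∫ ω, (armMean ν k - X s ω k) ∂P = 0 := by
    rw [integral_sub (integrable_const _) (hm.integrable_value hν s k), hm.integral_value]
    simp
  exact mul_eq_zero_of_right _ h0

omit [IsProbabilityMeasure P] in
lemma measurable_stageReward (T : ℕ) (τ : Fin M → ℕ) (s : ℕ) (j : Fin M) :
    Measurable fun ω => stageReward T τ (fun s => X s ω) (fun s => U s ω) s j :=
  (measurable_reward (players τ s) j).comp ((hm.measurable_value s).prodMk
    (measurable_armsPulled.comp ((measurable_exploited T τ (fun i _ => hm.measurable_value i)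
      (fun i _ => hm.measurable_sample i)).prodMk (hm.measurable_sample s))))

theorem integrable_totalReward (hν : ∀ k, ν k (Set.Icc (0 : ℝ) 1)ᶜ = 0) (T : ℕ)
    (τ : Fin M → ℕ) :
    Integrable (fun ω => totalReward T τ (fun s => X s ω) (fun s => U s ω)) P := by
  refine integrable_finsetSum _ fun s _ => integrable_finsetSum _ fun j _ => ?_
  refine Integrable.of_bound (hm.measurable_stageReward T τ s j).aestronglyMeasurable 1 ?_
  filter_upwards [hm.ae_value_mem hν] with ω hω
  have h : 0 ≤ stageReward T τ (fun s => X s ω) (fun s => U s ω) s j ∧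
      stageReward T τ (fun s => X s ω) (fun s => U s ω) s j ≤ 1 := reward_mem _ _ (hω s) j
  rw [Real.norm_eq_abs, abs_of_nonneg h.1]
  exact h.2

/-- The expected regret is bounded by the exploration times of the players. -/
theorem regret_le (hM : 1 ≤ M) (hMK : M ≤ K) (hν : ∀ k, ν k (Set.Icc (0 : ℝ) 1)ᶜ = 0)
    (hΔ : 0 < minGap (armMean ν) M) {T : ℕ} {τ : Fin M → ℕ} (hτ : ∀ j, τ j < T) :
    regret P ν X U T τ ≤
      2 * ∑ j, ((accurateTime K (T - τ j) (minGap (armMean ν) M) +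
        4 * (8 * K * blockBound (T - τ j) (orderStat (armMean ν) M)) * M : ℕ) : ℝ) +
      (2 * M + 2) * (M * (12 * K)) := by
  classical
  have := fun k => hm.isProbabilityMeasure_law k
  have hμ : ∀ k, 0 ≤ armMean ν k ∧ armMean ν k ≤ 1 := fun k =>
    ⟨armMean_nonneg hν k, armMean_le_one hν k⟩
  have hμ₀ : 0 < orderStat (armMean ν) M :=
    hΔ.trans_le (minGap_le_orderStat (fun k => (hμ k).1) hM)
  -- Passing to a measurable superset of equal measure avoids having to prove that `IsFavorable` is
  -- a measurable event.
  set bad : Fin M → Set Ω := fun j => toMeasurable P {ω | ¬ IsFavorable T τ (fun s => X s ω)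
    (fun s => U s ω) (armMean ν) (blockBound (T - τ j) (orderStat (armMean ν) M)) j} with hbad
  have hbm : ∀ j, MeasurableSet (bad j) := fun j => measurableSet_toMeasurable _ _
  have hbP : ∀ j, ((T - τ j : ℕ) : ℝ) * P.real (bad j) ≤ 12 * K := by
    intro j
    have hn : (0 : ℝ) < ((T - τ j : ℕ) : ℝ) := by
      have := hτ j
      exact_mod_cast (by omega : 0 < T - τ j)
    have h1 : P (bad j) ≤ ENNReal.ofReal (12 * K / (T - τ j : ℕ)) := by
      rw [hbad, measure_toMeasurable]
      exact hm.measure_not_isFavorable_le T τ j hMK hν (hτ j)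
        (two_mul_log_le_blockBound _ hμ₀ (orderStat_le_one (fun k => (hμ k).2) M))
    have h2 : P.real (bad j) ≤ 12 * K / (T - τ j : ℕ) :=
      ENNReal.toReal_le_of_le_ofReal (by positivity) h1
    rw [le_div_iff₀ hn] at h2
    linarith
  set b : Fin M → Ω → ℝ := fun j => (bad j).indicator fun _ => (1 : ℝ) with hb
  have hbi : ∀ j, Integrable (b j) P := fun j => (integrable_const _).indicator (hbm j)
  have hbI : ∀ j, ∫ ω, b j ω ∂P = P.real (bad j) := fun j => by
    rw [hb, integral_indicator_const _ (hbm j), smul_eq_mul, mul_one]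
  set c := ∑ j, ((accurateTime K (T - τ j) (minGap (armMean ν) M) +
    4 * (8 * K * blockBound (T - τ j) (orderStat (armMean ν) M)) * M : ℕ) : ℝ)
  have hv := hm.integral_exploited_value hν T τ
  have hR := hm.integrable_totalReward hν T τ
  have hi1 := integrable_finsetSum (Finset.range T) fun s _ => (hv s).1
  have hi12 : Integrable (fun ω => (∑ s ∈ Finset.range T, ∑ k ∈ exploitedArms
      (exploited T τ (fun i => X i ω) (fun i => U i ω) s), (armMean ν k - X s ω k)) + 2 * c) P :=
    hi1.add (integrable_const (2 * c))
  have hi2 : Integrable (fun ω => (2 * M + 2) * ∑ j, ((T - τ j : ℕ) : ℝ) * b j ω) P :=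
    (integrable_finsetSum _ fun j _ => (hbi j).const_mul _).const_mul _
  have hae : ∀ᵐ ω ∂P, (∑ s ∈ Finset.range T, ∑ n ∈ Finset.Icc 1 (players τ s).card,
      orderStat (armMean ν) n) - totalReward T τ (fun s => X s ω) (fun s => U s ω) ≤
      (∑ s ∈ Finset.range T, ∑ k ∈ exploitedArms
        (exploited T τ (fun i => X i ω) (fun i => U i ω) s), (armMean ν k - X s ω k)) + 2 * c +
      (2 * M + 2) * ∑ j, ((T - τ j : ℕ) : ℝ) * b j ω := by
    filter_upwards [hm.ae_value_mem hν] with ω hω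
    refine total_loss_le hM hMK hμ hω hΔ (fun j => Set.indicator_nonneg (by simp) ω) fun j hj => ?_
    have : ω ∈ bad j := subset_toMeasurable _ _ hj
    simp [hb, this]
  have h := integral_mono_ae ((integrable_const _).sub hR)
    (hi12.add hi2) hae
  simp only [Pi.add_apply, Pi.sub_apply] at h
  rw [integral_sub (integrable_const _) hR] at h
  rw [integral_add hi12 hi2, integral_add hi1 (integrable_const _),
    integral_finsetSum _ fun s _ => (hv s).1, Finset.sum_eq_zero fun s _ => (hv s).2,
    integral_const_mul, integral_const_mul,
    integral_finsetSum _ fun j _ => (hbi j).const_mul _] at h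
  simp only [integral_const, probReal_univ, one_smul, integral_const_mul, hbI] at h
  have hs : ∑ j, ((T - τ j : ℕ) : ℝ) * P.real (bad j) ≤ M * (12 * K) := by
    refine (Finset.sum_le_card_nsmul _ _ _ fun j _ => hbP j).trans ?_
    simp
  have hs' := mul_le_mul_of_nonneg_left hs (by positivity : (0 : ℝ) ≤ 2 * M + 2)
  unfold regret
  linarith

end IsModel

end Regret

end

end DynMMAB

theorem theorem2 :
    ∃ C : ℝ, 0 < C ∧
      ∀ (K M T : ℕ), 1 ≤ M → M ≤ K → 2 ≤ T →
      ∀ (τ : Fin M → ℕ), (∀ j, τ j < T) →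
      ∀ (ν : Fin K → Measure ℝ), (∀ k, ν k (Set.Icc (0 : ℝ) 1)ᶜ = 0) →
      0 < DynMMAB.minGap (DynMMAB.armMean ν) M →
      ∀ {Ω : Type*} [MeasurableSpace Ω] (P : Measure Ω) [IsProbabilityMeasure P]
        (X : ℕ → Ω → Fin K → ℝ) (U : ℕ → Ω → Fin M → Fin K),
      DynMMAB.IsModel P ν X U →
        Integrable (fun ω => DynMMAB.totalReward T τ (fun s => X s ω) (fun s => U s ω)) P ∧
        DynMMAB.regret P ν X U T τ ≤
          C * ((M : ℝ) ^ 2 * K * Real.log T / DynMMAB.orderStat (DynMMAB.armMean ν) M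
            + (M : ℝ) * K * Real.log T / DynMMAB.minGap (DynMMAB.armMean ν) M ^ 2) := by
  -- Exploration contributes `2 · 12300`. The unfavorable events contribute at most `48 M² K ≤ 96 M²
  -- K log T / μ₀`, since `log T / μ₀ ≥ 1 / 2`.
  refine ⟨24700, by norm_num, fun K M T hM hMK hT τ hτ ν hν hΔ Ω _ P _ X U hm =>
    ⟨hm.integrable_totalReward hν T τ, ?_⟩⟩
  have := fun k => hm.isProbabilityMeasure_law k
  have hle := DynMMAB.minGap_le_orderStat (DynMMAB.armMean_nonneg hν) hM
  have hμ1 := DynMMAB.orderStat_le_one (DynMMAB.armMean_le_one hν) M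
  have h1 := hm.regret_le hM hMK hν hΔ hτ
  set Δ := DynMMAB.minGap (DynMMAB.armMean ν) M
  set μ₀ := DynMMAB.orderStat (DynMMAB.armMean ν) M
  have hμ0 : 0 < μ₀ := hΔ.trans_le hle
  have hM' : (1 : ℝ) ≤ M := by exact_mod_cast hM
  have hlT : 1 / 2 ≤ Real.log T := by
    have h3 := Real.log_two_gt_d9
    have h4 : Real.log 2 ≤ Real.log T := Real.log_le_log (by norm_num) (by exact_mod_cast hT)
    linarith
  have hL : 1 / 2 ≤ Real.log T / μ₀ := hlT.trans (le_div_self (by linarith) hμ0 hμ1)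
  have h2 := Finset.sum_le_card_nsmul Finset.univ _ _ fun j (_ : j ∈ Finset.univ) =>
    DynMMAB.exploration_bound_le (K := K) (n := T - τ j) hM hMK (by have := hτ j; omega)
      (Nat.sub_le _ _) hT hΔ hle hμ1
  rw [Finset.card_univ, Fintype.card_fin, nsmul_eq_mul] at h2
  have h3 : (2 * M + 2 : ℝ) * (M * (12 * K)) ≤ 48 * ((M : ℝ) ^ 2 * K) := by
    have : (0 : ℝ) ≤ M * K := by positivity
    nlinarith
  have h4 : (M : ℝ) ^ 2 * K * (1 / 2) ≤ M ^ 2 * K * (Real.log T / μ₀) := by gcongr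
  have h5 : 0 ≤ (M : ℝ) * K * Real.log T / Δ ^ 2 := by
    have : 0 ≤ Real.log T := by linarith
    positivity
  have h7 : (0 : ℝ) ≤ M ^ 2 * K := by positivity
  have h6 : (M : ℝ) * (12300 * (M * K * Real.log T / μ₀ + K * Real.log T / Δ ^ 2)) =
      12300 * ((M : ℝ) ^ 2 * K * (Real.log T / μ₀) + M * K * Real.log T / Δ ^ 2) := by ring
  rw [h6] at h2
  rw [mul_div_assoc]
  linarith
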